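/- **Setting.** Let $m,q\ge 0$ be integers, $U\subset\mathbb{R}^m$ a nonempty open set, $\Omega$ a locally compact Hausdorff space with its Borel $\sigma$-algebra, and $\mathcal H$ a separable complex Hilbert space (inner products are linear in the first argument). For a multi-index $\alpha\in\mathbb{Z}_+^m$ write $|\alpha|=\alpha_1+\dots+\alpha_m$. *Differentiability.* A kernel $K:U\times U\to V$ ($V$ a normed space) is in $C^{q,q}(U\times U,V)$ if the derivatives $\partial_1^\alpha\partial_2^\beta K$, $|\alpha|,|\beta|\le q$, exist and are jointly continuous. A function $p:\Omega\times U\times U\to\mathbb{C}$ is in $C^{0,q,q}$ if $p_w:=p(w,\cdot,\cdot)\in C^{q,q}$ for every $w$ and each $(w,x,y)\mapsto\partial_1^\alpha\partial_2^\beta p_w(x,y)$, $|\alpha|,|\beta|\le q$, is continuous. It is $C^q$-dominated with respect to a measure $\mu$ if there is a $\mu$-integrable $h:\Omega\to\mathbb{C}$ with $|\partial_1^\alpha\partial_2^\beta p_w(x,y)|\le|h(w)|$ for all $w,x,y$ and $|\alpha|,|\beta|\le q$. $C^q_0(U,\mathcal H)$ is the set of $F\in C^q(U,\mathcal H)$ such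 that $\partial^\alpha F$ vanishes at infinity on $U$ for all $|\alpha|\le q$. *Kernels.* A kernel $K:U\times U\to\mathcal L(\mathcal H)$ is positive definite if $\sum_{i,j}\langle K(x_i,x_j)v_j,v_i\rangle\ge 0$ for all finite families $x_i\in U$, $v_i\in\mathcal H$; $\mathcal H_K$ is its reproducing kernel Hilbert space of functions $U\to\mathcal H$, generated by the functions $K(\cdot,y)v$. Complex valued kernels are the case $\mathcal H=\mathbb{C}$. $K$ is *$C^q$-universal* if it is positive definite, $\mathcal H_K\subset C^q(U,\mathcal H)$, and for every compact $A\subset U$, every $g\in C^q(U,\mathcal H)$ and every $\varepsilon>0$ there is $f\in\mathcal H_K$ with $\sup_{x\in A}\sum_{|\alpha|\le q}\|\partial^\alpha f(x)-\partial^\alpha g(x)\|<\varepsilon$. For an $\mathcal H$-valued measure $\eta$ of bounded variation, $\int\langle F,d\eta\rangle$ denotes the integral with $\int\langle v\chi_A,d\eta\rangle=\langle v,\eta(A)\rangle$, and, for an operator valued function $T$, $\int T\,d\eta\in\mathcal H$ is the vector such that $\langle v,\int T\,d\eta\rangle=\int\langle T(x)v,d\eta(x)\rangle$ for all $v\in\mathcal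 H$. $K$ is *$C^q$-integrally strictly positive definite* if it is positive definite, $K\in C^{q,q}(U\times U,\mathcal L(\mathcal H))$, the functions $x\mapsto\|\partial_1^\alpha\partial_2^\alpha K(x,x)\|$ are bounded on $U$ for $|\alpha|\le q$, and for all families $(\eta_\alpha)_{|\alpha|\le q}$ of $\mathcal H$-valued Radon measures of bounded variation on $U$, $$\sum_{|\alpha|,|\beta|\le q}\int\Big\langle\int\partial_1^\alpha\partial_2^\beta K(x,y)\,d\eta_\alpha(x),d\eta_\beta(y)\Big\rangle=0\ \Longrightarrow\ \sum_{|\alpha|\le q}\int\langle\partial^\alpha F,d\eta_\alpha\rangle=0\ \text{ for all }F\in C_0^q(U,\mathcal H).$$ **Theorem.** Let $p\in C^{0,q,q}(\Omega\times U\times U)$ be complex valued such that $p_w$ is positive definite for every $w\in\Omega$. Let $\Lambda$ be an $\mathcal L(\mathcal H)$-valued Radon measure of bounded variation on $\Omega$ (countably additive in operator norm, with $|\Lambda|$ finite, outer regular on Borel sets and inner regular on open sets), such that $\Lambda(A)$ is positive semidefinite for every Borel set $A$, and which admits a Radon–Nikodým decomposition $d\Lambda=G\,d\lambda$ with $\lambda$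 a finite nonnegative measure and $G:\Omega\to\mathcal L(\mathcal H)$ Bochner integrable with respect to $\lambda$. Assume that $p$ is $C^q$-dominated with respect to the variation $|\Lambda|$. Put $$P(x,y)=\int_\Omega p_w(x,y)\,d\Lambda(w),\qquad P_v(x,y)=\langle P(x,y)v,v\rangle,\qquad \Lambda_v(A)=\langle\Lambda(A)v,v\rangle .$$ Then: 1. $P$ is well defined ($w\mapsto p_w(x,y)$ is $|\Lambda|$-integrable for all $x,y$) and positive definite, $P\in C^{q,q}(U\times U,\mathcal L(\mathcal H))$, and $\mathcal H_P\subset C^q(U,\mathcal H)$. 2. If $p_w$ is $C^q$-universal for every $w\in\Omega$, the following are equivalent: $P$ is $C^q$-universal; $P_v$ is $C^q$-universal for every $v\in\mathcal H\setminus\{0\}$; $\Lambda_v$ is a nonzero measure for every $v\in\mathcal H\setminus\{0\}$. 3. If $p_w$ is $C^q$-integrally strictly positive definite for every $w\in\Omega$, the following are equivalent: $P$ is $C^q$-integrally strictly positive definite; $P_v$ is $C^q$-integrally strictly positive definite for every $v\in\mathcal H\setminus\{0\}$; $\Lambda_v$ is a nonzero measure for every $v\in\mathcal H\setminus\{0\}$.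 -/

import Mathlib

open MeasureTheory TopologicalSpace

noncomputable section

namespace OpKernel

/-! ## Differentiable functions on an open subset of `ℝᵐ` -/

section Differentiability

variable {m : ℕ} {U : Opens (EuclideanSpace ℝ (Fin m))}
  {V : Type*} [NormedAddCommGroup V] [NormedSpace ℝ V]

/-- Extension by zero of a function defined on the open set `U`. Differentiability and derivatives
at the points of `U` do not depend on the values outside `U`. -/
def zeroExt (F : U → V) : EuclideanSpace ℝ (Fin m) → V :=
  Function.extend Subtype.val F 0

/-- The partial derivative in the direction of the `i`-th coordinate vector. -/
def partialDeriv (i : Fin m) (F : U → V) : U → V :=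
  fun x => lineDeriv ℝ (zeroExt F) x (EuclideanSpace.single i (1 : ℝ))

/-- The iterated partial derivative `∂^α`, for a multi-index `α`. -/
def multiDeriv (α : Fin m → ℕ) (F : U → V) : U → V :=
  (List.finRange m).foldr (fun i G => (partialDeriv i)^[α i] G) F

/-- The multi-indices `α` in `m` variables with `|α| ≤ q`. -/
def multiIndices (m q : ℕ) : Finset (Fin m → ℕ) :=
  (Fintype.piFinset fun _ : Fin m => Finset.range (q + 1)).filter fun α => ∑ i, α i ≤ q

theorem mem_multiIndices {q : ℕ} {α : Fin m → ℕ} : α ∈ multiIndices m q ↔ ∑ i, α i ≤ q := by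
  simp only [multiIndices, Finset.mem_filter, Fintype.mem_piFinset, Finset.mem_range,
    and_iff_right_iff_imp]
  intro h i
  have := Finset.single_le_sum (f := α) (fun j _ => Nat.zero_le _) (Finset.mem_univ i)
  omega

/-- `F ∈ C^q(U, V)`. -/
def IsCq (q : ℕ) (F : U → V) : Prop :=
  ContDiffOn ℝ q (zeroExt F) U

/-- `F ∈ C^q_0(U, V)`: every derivative of order at most `q` vanishes at infinity on `U`. -/
def IsCqZero (q : ℕ) (F : U → V) : Prop :=
  IsCq q F ∧ ∀ α ∈ multiIndices m q,
    Filter.Tendsto (multiDeriv α F) (Filter.cocompact U) (nhds 0)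

/-- The mixed derivative `∂₁^α ∂₂^β K (x, y)`. -/
def mixedDeriv (α β : Fin m → ℕ) (K : U → U → V) (x y : U) : V :=
  multiDeriv α (fun x' => multiDeriv β (K x') y) x

/-- `K ∈ C^{q,q}(U × U, V)`: the derivatives `∂₁^α ∂₂^β K` with `|α|, |β| ≤ q` exist and are
jointly continuous. -/
def IsCqq (q : ℕ) (K : U → U → V) : Prop :=
  (∀ x, IsCq q (K x)) ∧
  (∀ β ∈ multiIndices m q, ∀ y, IsCq q fun x => multiDeriv β (K x) y) ∧
  ∀ α ∈ multiIndices m q, ∀ β ∈ multiIndices m q,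
    Continuous fun z : U × U => mixedDeriv α β K z.1 z.2

/-- `p ∈ C^{0,q,q}(Ω × U × U, V)`. -/
def IsCzqq {Ω : Type*} [TopologicalSpace Ω] (q : ℕ) (p : Ω → U → U → V) : Prop :=
  (∀ w, IsCqq q (p w)) ∧
  ∀ α ∈ multiIndices m q, ∀ β ∈ multiIndices m q,
    Continuous fun z : Ω × U × U => mixedDeriv α β (p z.1) z.2.1 z.2.2

/-- `p` is `C^q`-dominated with respect to the measure `μ`. -/
def IsCqDominated {Ω : Type*} [MeasurableSpace Ω] (q : ℕ) (p : Ω → U → U → V)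
    (μ : Measure Ω) : Prop :=
  ∃ h : Ω → ℂ, Integrable h μ ∧
    ∀ α ∈ multiIndices m q, ∀ β ∈ multiIndices m q, ∀ w x y,
      ‖mixedDeriv α β (p w) x y‖ ≤ ‖h w‖

end Differentiability

/-! ## Operator valued positive definite kernels and their reproducing kernel Hilbert spaces -/

section Kernels

variable {X : Type*} {H : Type*} [NormedAddCommGroup H] [InnerProductSpace ℂ H] [CompleteSpace H]

/-- Positive definite operator valued kernels (see `isPosDef_iff` for the finite sums). -/
def IsPosDef (K : X → X → H →L[ℂ] H) : Prop :=
  (Matrix.of K).PosSemidef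

open scoped ComplexOrder in
/-- A kernel is positive definite if and only if all the double sums
`∑ ⟨K(x_μ, x_ν) v_ν, v_μ⟩` are nonnegative real numbers. -/
theorem isPosDef_iff (K : X → X → H →L[ℂ] H) :
    IsPosDef K ↔ ∀ v : X →₀ H,
      0 ≤ v.sum fun x a => v.sum fun y b => inner ℂ a (K x y b) := by
  have key := (RKHS.posSemidef_tfae (K := Matrix.of K)).out 0 2
  rw [IsPosDef, key]
  have hconj : ∀ v : X →₀ H, (starRingEnd ℂ)
      (v.sum fun x w => v.sum fun x' w' => inner ℂ (K x' x w) w') =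
      v.sum fun x a => v.sum fun y b => inner ℂ a (K x y b) := by
    intro v
    rw [Finsupp.sum_comm]
    simp only [map_finsuppSum, inner_conj_symm]
  constructor
  · rintro ⟨hH, h⟩ v
    have h1 := h v
    simp only [Matrix.of_apply] at h1
    have hsym : (v.sum fun x w => v.sum fun x' w' => inner ℂ (K x' x w) w') =
        v.sum fun x a => v.sum fun y b => inner ℂ a (K x y b) := by
      congr! 6 with x w y b
      have h3 : star (K x y) = K y x := hH.apply y x
      rw [← h3, ContinuousLinearMap.star_eq_adjoint, ContinuousLinearMap.adjoint_inner_left]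
    rw [Complex.le_def]
    have h2 := hconj v
    rw [hsym] at h1 h2
    refine ⟨h1, ?_⟩
    have := congrArg Complex.im h2
    simp only [Complex.conj_im] at this
    simp only [Complex.zero_im]
    linarith
  · intro h
    refine ⟨?_, fun v => ?_⟩
    · let B : (X →₀ H) → (X →₀ H) → ℂ := fun u v => u.sum fun x a => v.sum fun y b => inner ℂ a (K x y b)
      have hadd1 : ∀ u u' v, B (u + u') v = B u v + B u' v := by
        intro u u' v
        classical
        refine Finsupp.sum_add_index' (by simp) fun x a a' => ?_
        simp only [inner_add_left, Finsupp.sum_add]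
      have hadd2 : ∀ u v v', B u (v + v') = B u v + B u v' := by
        intro u v v'
        classical
        simp only [B]
        have h3 : ∀ x a, ((v + v').sum fun y b => inner ℂ a (K x y b)) =
            (v.sum fun y b => inner ℂ a (K x y b)) + v'.sum fun y b => inner ℂ a (K x y b) :=
          fun x a => Finsupp.sum_add_index' (by simp) fun y b b1 => by simp
        simp only [h3, Finsupp.sum_add]
      have hs1 : ∀ (c : ℂ) u v, B (c • u) v = (starRingEnd ℂ) c * B u v := by
        intro c u v
        simp only [B]
        rw [Finsupp.sum_smul_index' (fun x => by simp)]
        simp only [inner_smul_left, Finsupp.sum, Finset.mul_sum]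
      have hs2 : ∀ (c : ℂ) u v, B u (c • v) = c * B u v := by
        intro c u v
        simp only [B]
        have h3 : ∀ x a, ((c • v).sum fun y b => inner ℂ a (K x y b)) =
            c * v.sum fun y b => inner ℂ a (K x y b) := by
          intro x a
          rw [Finsupp.sum_smul_index' (by simp)]
          simp only [map_smul, inner_smul_right, Finsupp.sum, Finset.mul_sum]
        simp only [h3]
        simp only [Finsupp.sum, Finset.mul_sum]
      have him : ∀ u, (B u u).im = 0 := fun u => (Complex.le_def.1 (h u)).2.symm
      have hsymm : ∀ u v, B u v = (starRingEnd ℂ) (B v u) := by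
        intro u v
        have e1 := him (u + v)
        have e2 := him (u + Complex.I • v)
        simp only [hadd1, hadd2, hs1, hs2, Complex.add_im, him, Complex.conj_I, Complex.mul_im, Complex.mul_re,
          Complex.neg_re, Complex.neg_im, Complex.I_re, Complex.I_im] at e1 e2
        apply Complex.ext
        · simp only [Complex.conj_re]; linarith [him v]
        · simp only [Complex.conj_im]; linarith
      ext x y : 1
      refine ContinuousLinearMap.ext fun b => ext_inner_left ℂ fun a => ?_
      have := hsymm (Finsupp.single x a) (Finsupp.single y b)
      simp only [B, inner_zero_left, inner_zero_right, map_zero, Finsupp.sum_single_index, inner_conj_symm] at this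
      simp [ContinuousLinearMap.star_eq_adjoint, ContinuousLinearMap.adjoint_inner_right, this]
    · have h1 := (Complex.le_def.1 (h v)).1
      rw [← hconj v] at h1
      simpa using h1

/-- The reproducing kernel Hilbert space `H_K` of a positive definite kernel, as a set of functions
from `X` to `H`. -/
def rkhs (K : X → X → H →L[ℂ] H) : Set (X → H) :=
  {f | ∃ hK : (Matrix.of K).PosSemidef,
    haveI : Fact (Matrix.of K).PosSemidef := ⟨hK⟩
    ∃ F : RKHS.OfKernel (Matrix.of K), RKHS.coeCLM ℂ F = f}

/-- A complex valued kernel, regarded as an operator valued kernel with `H = ℂ`. -/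
def scalarKernel (k : X → X → ℂ) : X → X → ℂ →L[ℂ] ℂ :=
  fun x y => ContinuousLinearMap.mul ℂ ℂ (k x y)

/-- The scalar valued projection `K_v(x, y) = ⟨K(x, y) v, v⟩` (the inner product of Mathlib is
conjugate linear in its first argument). -/
def kernelProj (K : X → X → H →L[ℂ] H) (v : H) : X → X → ℂ :=
  fun x y => inner ℂ v (K x y v)

end Kernels

/-! ## Vector valued measures -/

section Measures

variable {X : Type*} [MeasurableSpace X]
  {H : Type*} [NormedAddCommGroup H] [InnerProductSpace ℂ H]

/-- A vector valued Radon measure of bounded variation. -/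
def IsRadonBV [TopologicalSpace X] {V : Type*} [NormedAddCommGroup V]
    (η : VectorMeasure X V) : Prop :=
  IsFiniteMeasure η.variation ∧ η.variation.Regular

variable (H) in
/-- The pairing `(u, v) ↦ ⟨u, v⟩`, linear in `u` and conjugate linear in `v`, as a real bilinear
map. -/
def pairing : H →L[ℝ] H →L[ℝ] ℂ :=
  LinearMap.mkContinuous₂
    (LinearMap.mk₂ ℝ (fun u v : H => inner ℂ v u)
      (fun _ _ _ => inner_add_right _ _ _)
      (fun c u v => by
        rw [← Complex.coe_smul, inner_smul_right, Complex.real_smul])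
      (fun _ _ _ => inner_add_left _ _ _)
      (fun c u v => by
        rw [← Complex.coe_smul, inner_smul_left, Complex.conj_ofReal, Complex.real_smul]))
    1 (fun u v => by
      simpa [mul_comm] using norm_inner_le_norm (𝕜 := ℂ) v u)

theorem pairing_apply (u v : H) : pairing H u v = inner ℂ v u := rfl

/-- The integral `∫ ⟨F(x), dη(x)⟩` of an `H`-valued function with respect to an `H`-valued
measure. -/
def bartleIntegral (η : VectorMeasure X H) (F : X → H) : ℂ :=
  η.integral F (pairing H)

/-- `u` is the weak-Bochner integral `∫ T(x) dη(x)`, that is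
`⟨v, u⟩ = ∫ ⟨T(x) v, dη(x)⟩` for all `v`. -/
def IsWeakBochnerIntegral (η : VectorMeasure X H) (T : X → H →L[ℂ] H) (u : H) : Prop :=
  (∀ v, η.Integrable fun x => T x v) ∧
    ∀ v, inner ℂ u v = bartleIntegral η fun x => T x v

open scoped Classical in
/-- The weak-Bochner integral `∫ T(x) dη(x)` (zero if it does not exist). -/
def weakBochnerIntegral (η : VectorMeasure X H) (T : X → H →L[ℂ] H) : H :=
  if h : ∃ u, IsWeakBochnerIntegral η T u then h.choose else 0

/-- The scalar valued projection `Λ_v(A) = ⟨Λ(A) v, v⟩` of an operator valued measure. -/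
def measureProj (Λ : VectorMeasure X (H →L[ℂ] H)) (v : H) : VectorMeasure X ℂ :=
  Λ.mapRange ((innerSL ℂ v).comp (ContinuousLinearMap.apply ℂ H v)).toLinearMap.toAddMonoidHom
    ((innerSL ℂ v).comp (ContinuousLinearMap.apply ℂ H v)).continuous

/-- The kernel `P(x, y) = ∫ p_w(x, y) dΛ(w)`. -/
def integralKernel {Y : Type*} (p : X → Y → Y → ℂ) (Λ : VectorMeasure X (H →L[ℂ] H)) :
    Y → Y → H →L[ℂ] H :=
  fun x y => Λ.integral (fun w => p w x y) (ContinuousLinearMap.lsmul ℝ ℂ)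

end Measures

/-! ## Differentiable universality -/

section Universality

variable {m : ℕ} {U : Opens (EuclideanSpace ℝ (Fin m))}
  {H : Type*} [NormedAddCommGroup H] [InnerProductSpace ℂ H] [CompleteSpace H]

/-- `C^q`-universal kernels. -/
def IsCqUniversal (q : ℕ) (K : U → U → H →L[ℂ] H) : Prop :=
  IsPosDef K ∧ (∀ f ∈ rkhs K, IsCq q f) ∧
  ∀ A : Set U, IsCompact A → ∀ g : U → H, IsCq q g → ∀ ε > (0 : ℝ),
    ∃ f ∈ rkhs K, ∀ x ∈ A,
      ∑ α ∈ multiIndices m q, ‖multiDeriv α f x - multiDeriv α g x‖ < ε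

/-- The quadratic form
`∑_{|α|,|β| ≤ q} ∫ ⟨∫ ∂₁^α ∂₂^β K(x, y) dη_α(x), dη_β(y)⟩`. -/
def energy (q : ℕ) (K : U → U → H →L[ℂ] H) (η : (Fin m → ℕ) → VectorMeasure U H) : ℂ :=
  ∑ α ∈ multiIndices m q, ∑ β ∈ multiIndices m q,
    bartleIntegral (η β) fun y => weakBochnerIntegral (η α) fun x => mixedDeriv α β K x y

/-- `C^q`-integrally strictly positive definite kernels. -/
def IsCqIntStrictPosDef (q : ℕ) (K : U → U → H →L[ℂ] H) : Prop :=
  IsPosDef K ∧ IsCqq q K ∧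
  (∀ α ∈ multiIndices m q, ∃ M : ℝ, ∀ x, ‖mixedDeriv α α K x x‖ ≤ M) ∧
  ∀ η : (Fin m → ℕ) → VectorMeasure U H, (∀ α ∈ multiIndices m q, IsRadonBV (η α)) →
    energy q K η = 0 →
    ∀ F : U → H, IsCqZero q F →
      ∑ α ∈ multiIndices m q, bartleIntegral (η α) (multiDeriv α F) = 0

end Universality

end OpKernel

end

/-! Both equivalences rest on one duality argument. Write P = ∫ p_w G(w) dλ. Almost every G(w) is a
positive operator, so p_w G(w) is positive definite by the Schur product theorem, and P inherits
positivity; its derivatives come from differentiation under the integral (`IsAdmissible.isPosDef`,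
`IsAdmissible.isCqq`).

For 3 → 1, let L be a continuous functional on jets (the families of all derivatives of order at
most q) that vanishes on H_P. For every Borel set B the kernel P_B = ∫_B p_w G(w) dλ satisfies
H_{P_B} ⊆ H_P, because P = P_B + P_{Bᶜ}. Hence L kills the sections of every P_B, so ∫_B L(p_w(·,y)
⊗ G(w)v) dλ(w) = 0 for every B, and the integrand vanishes almost everywhere. Separability of U and
H gives a single null set for all y and v (`IsAdmissible.ae_functional_eq_zero`). Outside it, φ ↦
L(φ ⊗ G(w)v) vanishes on H_{p_w}, hence on all admissible scalar functions f by the hypothesis on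
p_w. If u represents v ↦ L(f ⊗ v), then ⟨u, G(w)v⟩ = 0 for all v, so G(w)u = 0 almost everywhere,
Λ_u = 0 and u = 0. Thus L kills all f ⊗ v, and by projection onto finite dimensional subspaces it
kills every jet with totally bounded range (`IsAdmissible.functional_eq_zero`).

For universality, L is any functional on jets over a compact set, and Hahn–Banach turns the
vanishing into approximation. For strict positivity, L is given by the measures η_α:
`energy_eq_zero_iff` writes the energy as ‖Z‖², where Z represents the functional on H_K, so zero
energy means exactly that L vanishes on H_K.

This uses `exists_jet_features`: a positive definite kernel of class C^{q,q} has a feature map whose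
derivatives Φ_α satisfy ∂₁^α∂₂^β K(x,y) = Φ_α(x)* Φ_β(y). It also uses `exists_density`, by which
Hilbert space valued measures of bounded variation have densities.

The remaining implications are short. For 1 → 2, scalar data are tested against f(x) v/‖v‖². For 2 →
3, Λ_v = 0 forces P_v = 0, and the zero kernel has neither property on a nonempty U. -/

namespace OpKernel

open Filter Topology

/-! ### Partial derivatives on an open set, and interchange of their order -/

section Calculus

variable {m : ℕ} {U : Opens (EuclideanSpace ℝ (Fin m))}
  {V : Type*} [NormedAddCommGroup V]

@[simp]
theorem zeroExt_coe (F : U → V) (x : U) : zeroExt F x = F x :=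
  Subtype.val_injective.extend_apply _ _ _

theorem zeroExt_of_notMem (F : U → V) {x : EuclideanSpace ℝ (Fin m)} (hx : x ∉ U) :
    zeroExt F x = 0 := by
  rw [zeroExt, Function.extend_apply']
  · rfl
  · rintro ⟨a, rfl⟩
    exact hx a.2

variable [NormedSpace ℝ V] {W : Type*} [NormedAddCommGroup W] [NormedSpace ℝ W]

/-- `F'` is the partial derivative of `F` in the `i`-th coordinate direction. -/
def HasPartial (i : Fin m) (F F' : U → V) : Prop :=
  ∀ x : U, HasLineDerivAt ℝ (zeroExt F) (F' x) x (EuclideanSpace.single i (1 : ℝ))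

theorem HasPartial.partialDeriv_eq {i : Fin m} {F F' : U → V} (h : HasPartial i F F') :
    partialDeriv i F = F' :=
  funext fun x => (h x).lineDeriv

/-- Partial differentiability in terms of the points of `U` only. -/
theorem hasPartial_iff {i : Fin m} {F F' : U → V} :
    HasPartial i F F' ↔ ∀ x : U, ∀ ε > 0, ∃ δ > 0, ∀ (t : ℝ) (y : U), |t| < δ →
      (y : EuclideanSpace ℝ (Fin m)) = x + t • EuclideanSpace.single i (1 : ℝ) →
      ‖F y - F x - t • F' x‖ ≤ ε * |t| := by
  refine forall_congr' fun x => ?_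
  rw [hasLineDerivAt_iff_isLittleO_nhds_zero, Asymptotics.isLittleO_iff]
  constructor
  · intro h ε hε
    obtain ⟨δ, hδ, h1⟩ := Metric.eventually_nhds_iff.1 (h hε)
    refine ⟨δ, hδ, fun t y ht hy => ?_⟩
    have := h1 (y := t) (by simpa using ht)
    rwa [← hy, zeroExt_coe, zeroExt_coe, Real.norm_eq_abs] at this
  · intro h ε hε
    obtain ⟨δ, hδ, h1⟩ := h ε hε
    have hU : ∀ᶠ t : ℝ in 𝓝 0,
        (x : EuclideanSpace ℝ (Fin m)) + t • EuclideanSpace.single i (1 : ℝ) ∈ U := by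
      have hc : Continuous fun t : ℝ =>
          (x : EuclideanSpace ℝ (Fin m)) + t • EuclideanSpace.single i (1 : ℝ) := by fun_prop
      exact hc.continuousAt.eventually_mem (U.isOpen.mem_nhds (by simp))
    filter_upwards [hU, Metric.ball_mem_nhds (0 : ℝ) hδ] with t ht1 ht2
    have := h1 t ⟨_, ht1⟩ (by simpa using ht2) rfl
    rwa [← zeroExt_coe F ⟨_, ht1⟩, ← zeroExt_coe F x] at this

theorem HasPartial.comp_clm {i : Fin m} {F F' : U → V} (h : HasPartial i F F') (L : V →L[ℝ] W) :
    HasPartial i (fun x => L (F x)) fun x => L (F' x) := by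
  intro x
  have h1 : zeroExt (fun x => L (F x)) = fun y => L (zeroExt F y) := by
    funext y
    by_cases hy : y ∈ U
    · exact (zeroExt_coe _ ⟨y, hy⟩).trans (by rw [← zeroExt_coe F ⟨y, hy⟩])
    · rw [zeroExt_of_notMem _ hy, zeroExt_of_notMem _ hy, map_zero]
  rw [h1]
  exact L.hasFDerivAt.comp_hasDerivAt (0 : ℝ) (h x)

theorem HasPartial.sub {i : Fin m} {F F' G G' : U → V} (h : HasPartial i F F')
    (h' : HasPartial i G G') : HasPartial i (fun x => F x - G x) fun x => F' x - G' x := by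
  intro x
  have h1 : zeroExt (fun x => F x - G x) = fun y => zeroExt F y - zeroExt G y := by
    funext y
    by_cases hy : y ∈ U
    · exact (zeroExt_coe _ ⟨y, hy⟩).trans
        (by rw [← zeroExt_coe F ⟨y, hy⟩, ← zeroExt_coe G ⟨y, hy⟩])
    · simp only [zeroExt_of_notMem _ hy, sub_zero]
  rw [h1]
  exact HasDerivAt.fun_sub (h x) (h' x)

/-- The mean value inequality along a coordinate direction. -/
theorem HasPartial.norm_sub_le {i : Fin m} {F F' : U → V} (h : HasPartial i F F') {c : V} {ε : ℝ}
    {x₀ : EuclideanSpace ℝ (Fin m)} {r : ℝ} (hU : Metric.ball x₀ r ⊆ U)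
    (hε : ∀ z : U, (z : EuclideanSpace ℝ (Fin m)) ∈ Metric.ball x₀ r → ‖F' z - c‖ ≤ ε)
    {y y' : U} {t : ℝ} (hy : (y : EuclideanSpace ℝ (Fin m)) ∈ Metric.ball x₀ r)
    (hy' : (y' : EuclideanSpace ℝ (Fin m)) ∈ Metric.ball x₀ r)
    (hyy' : (y' : EuclideanSpace ℝ (Fin m)) = y + t • EuclideanSpace.single i (1 : ℝ)) :
    ‖F y' - F y - t • c‖ ≤ ε * |t| := by
  set e := EuclideanSpace.single i (1 : ℝ)
  let S : Set ℝ := (fun s : ℝ => (y : EuclideanSpace ℝ (Fin m)) + s • e) ⁻¹' Metric.ball x₀ r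
  have hS : Convex ℝ S := by
    have : S = (AffineMap.lineMap (y : EuclideanSpace ℝ (Fin m)) (y + e)) ⁻¹' Metric.ball x₀ r := by
      ext s
      simp [S, AffineMap.lineMap_apply, add_comm]
    rw [this]
    exact (convex_ball x₀ r).affine_preimage _
  have hd : ∀ s ∈ S, HasDerivWithinAt (fun s : ℝ => zeroExt F (y + s • e) - s • c)
      (zeroExt F' (y + s • e) - c) S s := by
    intro s hs
    have h1 := h ⟨_, hU hs⟩
    rw [HasLineDerivAt] at h1
    have h2 : HasDerivAt (fun s' : ℝ => zeroExt F ((y + s • e) + (s' - s) • e))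
        (F' ⟨_, hU hs⟩) s := by
      have h3 : HasDerivAt (fun s' : ℝ => s' - s) 1 s := by simpa using (hasDerivAt_id s).sub_const s
      have := HasDerivAt.scomp_of_eq (h := fun s' : ℝ => s' - s) s h1 h3 (by simp)
      simpa [Function.comp_def] using! this
    have h4 : HasDerivAt (fun s : ℝ => s • c) c s := by
      simpa using (hasDerivAt_id s).smul_const c
    have h5 := (h2.fun_sub h4).hasDerivWithinAt (s := S)
    have h6 : zeroExt F' (y + s • e) = F' ⟨_, hU hs⟩ := zeroExt_coe F' ⟨_, hU hs⟩
    rw [h6]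
    refine h5.congr_of_mem (fun s' _ => ?_) hs
    congr 2
    module
  have := hS.norm_image_sub_le_of_norm_hasDerivWithin_le (C := ε) hd (fun s hs => by
    rw [show zeroExt F' (y + s • e) = F' ⟨_, hU hs⟩ from zeroExt_coe F' ⟨_, hU hs⟩]
    exact hε _ hs) (x := 0) (y := t) (by simpa [S] using hy) (by simpa [S, ← hyy'] using hy')
  simp only [← hyy', zeroExt_coe, zero_smul, add_zero, sub_zero, Real.norm_eq_abs] at this
  convert this using 2
  abel

/-- The second difference of a function of two variables is controlled by its mixed derivative. -/
theorem norm_second_difference_le {i j : Fin m} {f g k : U → U → V}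
    (hgk : ∀ y, HasPartial i (fun x => g x y) fun x => k x y)
    (hfg : ∀ x, HasPartial j (f x) (g x))
    (hk : Continuous fun z : U × U => k z.1 z.2) (x y : U) {ε : ℝ} (hε : 0 < ε) :
    ∃ δ > 0, ∀ (s t : ℝ) (x' y' : U), |s| < δ → |t| < δ →
      (x' : EuclideanSpace ℝ (Fin m)) = x + s • EuclideanSpace.single i (1 : ℝ) →
      (y' : EuclideanSpace ℝ (Fin m)) = y + t • EuclideanSpace.single j (1 : ℝ) →
      ‖f x' y' - f x y' - (f x' y - f x y) - (s * t) • k x y‖ ≤ ε * |s| * |t| := by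
  obtain ⟨δ₁, hδ₁, h1⟩ := Metric.continuous_iff.1 hk (x, y) ε hε
  obtain ⟨δ₂, hδ₂, h2⟩ := Metric.isOpen_iff.1 U.isOpen x x.2
  obtain ⟨δ₃, hδ₃, h3⟩ := Metric.isOpen_iff.1 U.isOpen y y.2
  obtain ⟨δ, hδ, hle1, hle2, hle3⟩ : ∃ δ > 0, δ ≤ δ₁ ∧ δ ≤ δ₂ ∧ δ ≤ δ₃ :=
    ⟨min δ₁ (min δ₂ δ₃), by positivity, by simp, by simp, by simp⟩
  have hkε : ∀ x' y' : U, (x' : EuclideanSpace ℝ (Fin m)) ∈ Metric.ball (x : EuclideanSpace ℝ (Fin m)) δ →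
      (y' : EuclideanSpace ℝ (Fin m)) ∈ Metric.ball (y : EuclideanSpace ℝ (Fin m)) δ →
      ‖k x' y' - k x y‖ ≤ ε := by
    intro x' y' hx' hy'
    rw [← dist_eq_norm]
    refine (h1 (x', y') ?_).le
    rw [Prod.dist_eq, max_lt_iff]
    exact ⟨lt_of_lt_of_le hx' hle1, lt_of_lt_of_le hy' hle1⟩
  have hx2 := (Metric.ball_subset_ball hle2).trans h2
  have hy3 := (Metric.ball_subset_ball hle3).trans h3
  refine ⟨δ, hδ, fun s t x' y' hs ht hx' hy' => ?_⟩
  have hx'b : (x' : EuclideanSpace ℝ (Fin m)) ∈ Metric.ball (x : EuclideanSpace ℝ (Fin m)) δ := by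
    simpa [hx', norm_smul] using hs
  have hy'b : (y' : EuclideanSpace ℝ (Fin m)) ∈ Metric.ball (y : EuclideanSpace ℝ (Fin m)) δ := by
    simpa [hy', norm_smul] using ht
  -- Mean value inequality twice: first in the first variable for `g`, whose derivative `k` is
  -- within ε of `k x y`; then in the second variable for `f x' - f x`, whose derivative `g x' - g
  -- x` has just been compared with `s • k x y`.
  have hg : ∀ b : U, (b : EuclideanSpace ℝ (Fin m)) ∈ Metric.ball (y : EuclideanSpace ℝ (Fin m)) δ →
      ‖(g x' b - g x b) - s • k x y‖ ≤ ε * |s| := fun b hb =>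
    (hgk b).norm_sub_le hx2 (fun z hz => hkε z b hz hb) (Metric.mem_ball_self hδ) hx'b hx'
  have := ((hfg x').sub (hfg x)).norm_sub_le hy3 hg (Metric.mem_ball_self hδ) hy'b hy'
  rwa [smul_smul, mul_comm t s] at this

/-- Interchange of the order of differentiation. -/
theorem HasPartial.interchange {i j : Fin m} {f g h k : U → U → V}
    (hfh : ∀ y, HasPartial i (fun x => f x y) fun x => h x y)
    (hgk : ∀ y, HasPartial i (fun x => g x y) fun x => k x y)
    (hfg : ∀ x, HasPartial j (f x) (g x))
    (hk : Continuous fun z : U × U => k z.1 z.2) (x : U) : HasPartial j (h x) (k x) := by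
  rw [hasPartial_iff]
  intro y ε hε
  obtain ⟨δ, hδ, h1⟩ := norm_second_difference_le hgk hfg hk x y hε
  refine ⟨δ, hδ, fun t y' ht hy' => ?_⟩
  -- Dividing the second difference by s and letting s → 0 turns the differences in the first
  -- variable into `h x y' - h x y`; the bound ε|t| survives the limit.
  have hlim := ((hfh y').sub (hfh y) x).tendsto_slope_zero
  rw [show zeroExt (fun x => f x y' - f x y) x = f x y' - f x y from zeroExt_coe _ x] at hlim
  refine le_of_tendsto (hlim.sub_const (t • k x y)).norm ?_
  have hU : ∀ᶠ s : ℝ in 𝓝 0,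
      (x : EuclideanSpace ℝ (Fin m)) + s • EuclideanSpace.single i (1 : ℝ) ∈ U := by
    have hc : Continuous fun t : ℝ =>
        (x : EuclideanSpace ℝ (Fin m)) + t • EuclideanSpace.single i (1 : ℝ) := by fun_prop
    exact hc.continuousAt.eventually_mem (U.isOpen.mem_nhds (by simp))
  filter_upwards [self_mem_nhdsWithin, nhdsWithin_le_nhds hU,
    nhdsWithin_le_nhds (Metric.ball_mem_nhds (0 : ℝ) hδ)] with s hs0 hsU hsδ
  have hs0 : s ≠ 0 := hs0
  rw [show zeroExt (fun x => f x y' - f x y) (x + s • EuclideanSpace.single i (1 : ℝ)) = _ from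
    zeroExt_coe _ ⟨_, hsU⟩]
  have h2 := h1 s t ⟨_, hsU⟩ y' (by simpa using hsδ) ht rfl hy'
  have h3 : s⁻¹ • (f ⟨_, hsU⟩ y' - f ⟨_, hsU⟩ y - (f x y' - f x y)) - t • k x y =
      s⁻¹ • (f ⟨_, hsU⟩ y' - f x y' - (f ⟨_, hsU⟩ y - f x y) - (s * t) • k x y) := by
    rw [smul_sub s⁻¹ _ ((s * t) • k x y), smul_smul, inv_mul_cancel_left₀ hs0]
    congr 2
    abel
  rw [h3, norm_smul, norm_inv, Real.norm_eq_abs, inv_mul_le_iff₀ (abs_pos.2 hs0)]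
  linarith

/-- The increment is split into moves along single coordinates; each costs at most ε'|v i| by the
mean value inequality, since the partial derivatives are continuous at x. -/
theorem hasFDerivAt_zeroExt {F : U → V} {F' : Fin m → U → V} (h : ∀ i, HasPartial i F (F' i))
    (hc : ∀ i, Continuous (F' i)) (x : U) :
    HasFDerivAt (zeroExt F)
      (∑ i, (EuclideanSpace.proj i : EuclideanSpace ℝ (Fin m) →L[ℝ] ℝ).smulRight (F' i x))
      (x : EuclideanSpace ℝ (Fin m)) := by
  rw [hasFDerivAt_iff_isLittleO_nhds_zero, Asymptotics.isLittleO_iff]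
  intro ε hε
  -- The m coordinate moves add up to at most m ε'‖v‖; the extra 1 keeps the denominator positive
  -- for m = 0.
  set ε' := ε / (m + 1) with hε'_def
  have hm : (0 : ℝ) < m + 1 := by positivity
  have hε' : 0 < ε' := by positivity
  have hcont : ∀ᶠ z : U in 𝓝 x, ∀ i, dist (F' i z) (F' i x) < ε' :=
    eventually_all.2 fun i => Metric.tendsto_nhds.1 ((hc i).continuousAt (x := x)) ε' hε'
  obtain ⟨δ₁, hδ₁, h1⟩ := Metric.eventually_nhds_iff.1 hcont
  obtain ⟨δ₂, hδ₂, h2⟩ := Metric.isOpen_iff.1 U.isOpen x x.2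
  set r := min δ₁ δ₂
  have hr : 0 < r := lt_min hδ₁ hδ₂
  have hrU : Metric.ball (x : EuclideanSpace ℝ (Fin m)) r ⊆ U :=
    (Metric.ball_subset_ball (min_le_right _ _)).trans h2
  have hr1 : ∀ i, ∀ z : U, (z : EuclideanSpace ℝ (Fin m)) ∈ Metric.ball (x : EuclideanSpace ℝ (Fin m)) r →
      ‖F' i z - F' i x‖ ≤ ε' := by
    intro i z hz
    rw [← dist_eq_norm]
    exact (h1 (lt_of_lt_of_le hz (min_le_left _ _)) i).le
  filter_upwards [Metric.ball_mem_nhds (0 : EuclideanSpace ℝ (Fin m))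
    (show 0 < r / (m + 1) by positivity)] with v hv
  have hv : ‖v‖ < r / (m + 1) := by simpa using hv
  have hvi : ∀ i, |v i| ≤ ‖v‖ := fun i => by
    simpa using PiLp.norm_apply_le v i
  have hsum : ∀ s : Finset (Fin m), ∑ i ∈ s, |v i| ≤ m * ‖v‖ := fun s =>
    (Finset.sum_le_card_nsmul s _ _ fun i _ => hvi i).trans (by
      rw [nsmul_eq_mul]
      gcongr
      simpa using s.card_le_univ)
  have hmem : ∀ s : Finset (Fin m), (x : EuclideanSpace ℝ (Fin m)) +
      ∑ i ∈ s, v i • EuclideanSpace.single i (1 : ℝ) ∈ Metric.ball (x : EuclideanSpace ℝ (Fin m)) r := by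
    intro s
    rw [Metric.mem_ball, dist_eq_norm, add_sub_cancel_left]
    calc _ ≤ ∑ i ∈ s, ‖v i • EuclideanSpace.single i (1 : ℝ)‖ := norm_sum_le _ _
      _ = ∑ i ∈ s, |v i| := by simp [norm_smul]
      _ ≤ m * ‖v‖ := hsum s
      _ ≤ (m + 1) * ‖v‖ := by nlinarith [norm_nonneg v]
      _ < r := by rw [lt_div_iff₀ hm] at hv; linarith
  -- Induction over the set s of coordinates already moved; `hmem` keeps every intermediate point in
  -- the ball.
  have key : ∀ s : Finset (Fin m),
      ‖zeroExt F (x + ∑ i ∈ s, v i • EuclideanSpace.single i (1 : ℝ)) - F x -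
        ∑ i ∈ s, v i • F' i x‖ ≤ ε' * ∑ i ∈ s, |v i| := by
    classical
    intro s
    induction s using Finset.induction_on with
    | empty => simp
    | insert i s his ih =>
      have h3 := (h i).norm_sub_le hrU (hr1 i) (y := ⟨_, hrU (hmem s)⟩)
        (y' := ⟨_, hrU (hmem (insert i s))⟩) (t := v i) (hmem s) (hmem _) (by
          simp only [Finset.sum_insert his]
          abel)
      rw [← zeroExt_coe F ⟨_, hrU (hmem s)⟩, ← zeroExt_coe F ⟨_, hrU (hmem (insert i s))⟩] at h3
      refine (norm_add_le_of_le h3 ih).trans' (le_of_eq ?_) |>.trans_eq ?_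
      · congr 1
        rw [Finset.sum_insert his (f := fun i => v i • F' i x)]
        dsimp only
        abel
      · rw [Finset.sum_insert his]
        ring
  have h4 := key Finset.univ
  have h5 : ∑ i, v i • EuclideanSpace.single i (1 : ℝ) = v := by
    ext j
    simp [Pi.single_apply]
  rw [h5] at h4
  rw [zeroExt_coe]
  have h6 : (∑ i, (EuclideanSpace.proj i : EuclideanSpace ℝ (Fin m) →L[ℝ] ℝ).smulRight (F' i x)) v =
      ∑ i, v i • F' i x := by simp
  rw [h6]
  refine h4.trans ?_
  calc ε' * ∑ i, |v i| ≤ ε' * ((m + 1) * ‖v‖) := by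
        gcongr
        nlinarith [hsum Finset.univ, norm_nonneg v]
    _ = ε * ‖v‖ := by rw [hε'_def]; field_simp

end Calculus

/-! ### Jets: families of derivatives indexed by multi-indices -/

section Jets

variable {m : ℕ} {U : Opens (EuclideanSpace ℝ (Fin m))}
  {V : Type*} [NormedAddCommGroup V] [NormedSpace ℝ V]
  {W : Type*} [NormedAddCommGroup W] [NormedSpace ℝ W]

theorem IsCq.mono {q q' : ℕ} {F : U → V} (h : IsCq q F) (hq : q' ≤ q) : IsCq q' F :=
  ContDiffOn.of_le h (by exact_mod_cast hq)

theorem IsCq.contDiffAt {q : ℕ} {F : U → V} (h : IsCq q F) (x : U) :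
    ContDiffAt ℝ q (zeroExt F) (x : EuclideanSpace ℝ (Fin m)) :=
  ContDiffOn.contDiffAt h (U.isOpen.mem_nhds x.2)

theorem IsCq.continuous {q : ℕ} {F : U → V} (h : IsCq q F) : Continuous F := by
  have : F = fun x : U => zeroExt F x := funext fun x => (zeroExt_coe F x).symm
  rw [this]
  exact continuousOn_iff_continuous_domRestrict.1 (ContDiffOn.continuousOn h)

theorem IsCq.hasPartial {q : ℕ} {F : U → V} (h : IsCq (q + 1) F) (i : Fin m) :
    HasPartial i F (partialDeriv i F) := fun x =>
  (((h.contDiffAt x).differentiableAt (by simp)).lineDifferentiableAt).hasLineDerivAt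

theorem IsCq.partialDeriv_eq_fderiv {q : ℕ} {F : U → V} (h : IsCq (q + 1) F) (i : Fin m)
    (x : EuclideanSpace ℝ (Fin m)) (hx : x ∈ U) :
    zeroExt (partialDeriv i F) x = fderiv ℝ (zeroExt F) x (EuclideanSpace.single i (1 : ℝ)) :=
  (zeroExt_coe _ ⟨x, hx⟩).trans
    (((h.contDiffAt ⟨x, hx⟩).differentiableAt (by simp)).lineDeriv_eq_fderiv)

theorem IsCq.partialDeriv {q : ℕ} {F : U → V} (h : IsCq (q + 1) F) (i : Fin m) :
    IsCq q (partialDeriv i F) := by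
  have h1 : ContDiffOn ℝ q (fun x => fderiv ℝ (zeroExt F) x (EuclideanSpace.single i (1 : ℝ))) U :=
    (ContDiffOn.fderiv_of_isOpen (n := (q + 1 : ℕ)) h U.isOpen (by simp)).clm_apply contDiffOn_const
  exact h1.congr fun x hx => h.partialDeriv_eq_fderiv i x hx

theorem IsCq.partialDeriv_comm {F : U → V} (h : IsCq 2 F) (i j : Fin m) :
    OpKernel.partialDeriv i (OpKernel.partialDeriv j F) =
      OpKernel.partialDeriv j (OpKernel.partialDeriv i F) := by
  have key : ∀ (i j : Fin m) (x : U),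
      OpKernel.partialDeriv i (OpKernel.partialDeriv j F) x =
      fderiv ℝ (fderiv ℝ (zeroExt F)) x (EuclideanSpace.single i (1 : ℝ))
        (EuclideanSpace.single j (1 : ℝ)) := by
    intro i j x
    have h1 := (h.partialDeriv (q := 1) j)
    rw [← zeroExt_coe (OpKernel.partialDeriv i _) x, h1.partialDeriv_eq_fderiv (q := 0) i x x.2]
    have h2 : zeroExt (OpKernel.partialDeriv j F) =ᶠ[𝓝 (x : EuclideanSpace ℝ (Fin m))]
        fun y => fderiv ℝ (zeroExt F) y (EuclideanSpace.single j (1 : ℝ)) := by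
      filter_upwards [U.isOpen.mem_nhds x.2] with y hy
      exact h.partialDeriv_eq_fderiv (q := 1) j y hy
    rw [h2.fderiv_eq]
    have h3 : DifferentiableAt ℝ (fderiv ℝ (zeroExt F)) (x : EuclideanSpace ℝ (Fin m)) :=
      ((h.contDiffAt x).fderiv_right (m := 1) (by norm_num)).differentiableAt (by simp)
    rw [fderiv_clm_apply h3 (differentiableAt_const _)]
    simp
  funext x
  rw [key, key]
  exact ((h.contDiffAt x).isSymmSndFDerivAt (by simp)).eq _ _

theorem IsCq.iterate_partialDeriv {q a : ℕ} {F : U → V} (h : IsCq (q + a) F) (j : Fin m) :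
    IsCq q ((OpKernel.partialDeriv j)^[a] F) := by
  induction a generalizing F with
  | zero => exact h
  | succ a ih => exact ih (IsCq.partialDeriv (q := q + a) h j)

theorem IsCq.partialDeriv_iterate_comm {a : ℕ} {F : U → V} (h : IsCq (a + 1) F) (i j : Fin m) :
    OpKernel.partialDeriv i ((OpKernel.partialDeriv j)^[a] F) =
      (OpKernel.partialDeriv j)^[a] (OpKernel.partialDeriv i F) := by
  induction a generalizing F with
  | zero => rfl
  | succ a ih =>
    rw [Function.iterate_succ_apply, ih (h.partialDeriv (q := a + 1) j), Function.iterate_succ_apply,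
      (h.mono (q' := 2) (by omega)).partialDeriv_comm i j]

/-- The iterated partial derivative in the variables of the list `l`. -/
noncomputable def listDeriv (l : List (Fin m)) (α : Fin m → ℕ) (F : U → V) : U → V :=
  l.foldr (fun i G => (OpKernel.partialDeriv i)^[α i] G) F

theorem listDeriv_cons (i : Fin m) (l : List (Fin m)) (α : Fin m → ℕ) (F : U → V) :
    listDeriv (i :: l) α F = (OpKernel.partialDeriv i)^[α i] (listDeriv l α F) := rfl

theorem multiDeriv_eq_listDeriv (α : Fin m → ℕ) (F : U → V) :
    multiDeriv α F = listDeriv (List.finRange m) α F := rfl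

theorem listDeriv_congr {l : List (Fin m)} {α β : Fin m → ℕ} (h : ∀ i ∈ l, α i = β i) (F : U → V) :
    listDeriv l α F = listDeriv l β F := by
  induction l with
  | nil => rfl
  | cons i l ih =>
    rw [listDeriv_cons, listDeriv_cons, h i (by simp), ih fun j hj => h j (by simp [hj])]

theorem IsCq.listDeriv {q : ℕ} {l : List (Fin m)} {α : Fin m → ℕ} {F : U → V}
    (h : IsCq (q + (l.map α).sum) F) : IsCq q (listDeriv l α F) := by
  induction l generalizing q with
  | nil => exact h
  | cons i l ih =>
    rw [listDeriv_cons]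
    refine IsCq.iterate_partialDeriv (ih (h.mono ?_)) i
    simp only [List.map_cons, List.sum_cons]
    omega

/-- `multiDeriv` differentiates in a fixed order of the variables, so an additional derivative in
direction i must be commuted past the others to its own place. `Nodup` guarantees that this place is
unique. -/
theorem partialDeriv_listDeriv {l : List (Fin m)} (hl : l.Nodup) {α : Fin m → ℕ} {F : U → V}
    (h : IsCq (1 + (l.map α).sum) F) {i : Fin m} (hi : i ∈ l) :
    OpKernel.partialDeriv i (listDeriv l α F) = listDeriv l (α + Pi.single i 1) F := by
  induction l with
  | nil => simp at hi
  | cons j l ih =>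
    rw [List.nodup_cons] at hl
    simp only [List.map_cons, List.sum_cons] at h
    rw [listDeriv_cons, listDeriv_cons]
    by_cases hij : i = j
    · subst hij
      rw [← Function.iterate_succ_apply' (OpKernel.partialDeriv i)]
      congr 1
      · simp
      · refine listDeriv_congr (fun k hk => ?_) F
        have : k ≠ i := fun h => hl.1 (h ▸ hk)
        simp [this]
    · have hil : i ∈ l := by simpa [hij] using hi
      rw [IsCq.partialDeriv_iterate_comm (IsCq.listDeriv (h.mono (by omega))),
        ih hl.2 (h.mono (by omega)) hil]
      congr 1
      simp [Ne.symm hij]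

@[simp]
theorem multiDeriv_zero (F : U → V) : multiDeriv 0 F = F := by
  rw [multiDeriv_eq_listDeriv]
  induction List.finRange m with
  | nil => rfl
  | cons i l ih => rw [listDeriv_cons, ih]; rfl

/-- A family of functions indexed by multi-indices, consisting of all derivatives of order at most
`q` of its member of index zero. -/
def IsJet (q : ℕ) (J : (Fin m → ℕ) → U → V) : Prop :=
  (∀ α, ∑ i, α i ≤ q → Continuous (J α)) ∧
    ∀ α i, ∑ j, α j + 1 ≤ q → HasPartial i (J α) (J (α + Pi.single i 1))

theorem sum_add_single (α : Fin m → ℕ) (i : Fin m) (a : ℕ) :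
    ∑ j, (α + Pi.single i a : Fin m → ℕ) j = ∑ j, α j + a := by
  simp [Finset.sum_add_distrib]

theorem IsCq.isJet {q : ℕ} {F : U → V} (h : IsCq q F) : IsJet q fun α => multiDeriv α F := by
  constructor
  · intro α hα
    refine IsCq.continuous (q := 0) ?_
    dsimp only
    rw [multiDeriv_eq_listDeriv]
    refine IsCq.listDeriv (h.mono ?_)
    rw [← Fin.sum_univ_def]
    omega
  · intro α i hα
    have h1 : (1 : ℕ) + ((List.finRange m).map α).sum ≤ q := by
      rw [← Fin.sum_univ_def]
      omega
    dsimp only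
    rw [multiDeriv_eq_listDeriv, multiDeriv_eq_listDeriv,
      ← partialDeriv_listDeriv (List.nodup_finRange m) (h.mono h1) (List.mem_finRange i)]
    exact IsCq.hasPartial (q := 0) (IsCq.listDeriv (h.mono h1)) i

/-- Induction on q: continuous partial derivatives give a Fréchet derivative that is a linear
combination of the `J (Pi.single i 1)`, and each of these heads the shifted jet of order q. -/
theorem IsJet.isCq {q : ℕ} {J : (Fin m → ℕ) → U → V} (h : IsJet q J) : IsCq q (J 0) := by
  induction q generalizing J with
  | zero =>
    have := h.1 0 (by simp)
    rw [IsCq, Nat.cast_zero, contDiffOn_zero, continuousOn_iff_continuous_domRestrict]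
    exact this.congr fun x => (zeroExt_coe (J 0) x).symm
  | succ q ih =>
    have hp : ∀ i, HasPartial i (J 0) (J (Pi.single i 1)) := fun i => by
      simpa using h.2 0 i (by simp)
    have hd := hasFDerivAt_zeroExt hp fun i => h.1 _ (by
      have := sum_add_single (0 : Fin m → ℕ) i 1
      simp only [zero_add] at this
      rw [this]
      simp)
    have hs : ∀ i, IsCq q (J (Pi.single i 1)) := by
      intro i
      have h2 : IsJet q fun α => J (α + Pi.single i 1) := by
        refine ⟨fun α hα => h.1 _ (by rw [sum_add_single]; omega), fun α j hα => ?_⟩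
        have := h.2 (α + Pi.single i 1) j (by rw [sum_add_single]; omega)
        rwa [add_right_comm] at this
      simpa using ih h2
    rw [IsCq, Nat.cast_succ, contDiffOn_succ_iff_fderiv_of_isOpen U.isOpen]
    refine ⟨fun x hx => (hd ⟨x, hx⟩).differentiableAt.differentiableWithinAt, by simp, ?_⟩
    have h3 : ContDiffOn ℝ q (fun x => ∑ i,
        (EuclideanSpace.proj i : EuclideanSpace ℝ (Fin m) →L[ℝ] ℝ).smulRight
          (zeroExt (J (Pi.single i 1)) x)) U :=
      ContDiffOn.sum fun i _ =>
        (ContinuousLinearMap.smulRightL ℝ (EuclideanSpace ℝ (Fin m)) V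
          (EuclideanSpace.proj i)).contDiff.comp_contDiffOn (hs i)
    refine h3.congr fun x hx => ?_
    rw [(hd ⟨x, hx⟩).fderiv]
    refine Finset.sum_congr rfl fun i _ => ?_
    rw [← zeroExt_coe (J (Pi.single i 1)) ⟨x, hx⟩]

theorem IsJet.iterate_partialDeriv {q : ℕ} {J : (Fin m → ℕ) → U → V} (h : IsJet q J)
    (β : Fin m → ℕ) (i : Fin m) (a : ℕ) (ha : ∑ j, β j + a ≤ q) :
    (partialDeriv i)^[a] (J β) = J (β + Pi.single i a) := by
  induction a with
  | zero => simp
  | succ a ih =>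
    rw [Function.iterate_succ_apply', ih (by omega),
      (h.2 _ i (by rw [sum_add_single]; omega)).partialDeriv_eq, add_assoc, ← Pi.single_add]

/-- A jet only records single differentiation steps. Following the list of variables, one
differentiates up to α restricted to the variables already treated. -/
theorem IsJet.multiDeriv_eq {q : ℕ} {J : (Fin m → ℕ) → U → V} (h : IsJet q J)
    {α : Fin m → ℕ} (hα : ∑ i, α i ≤ q) : multiDeriv α (J 0) = J α := by
  have key : ∀ l : List (Fin m), l.Nodup →
      listDeriv l α (J 0) = J fun i => if i ∈ l then α i else 0 := by
    intro l hl
    induction l with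
    | nil => simp only [List.not_mem_nil, if_false]; rfl
    | cons i l ih =>
      rw [List.nodup_cons] at hl
      have h1 : (fun j => if j ∈ i :: l then α j else 0) =
          (fun j => if j ∈ l then α j else 0) + Pi.single i (α i) := by
        funext j
        by_cases hj : j = i
        · subst hj
          simp [hl.1]
        · simp [hj]
      rw [listDeriv_cons, ih hl.2, h.iterate_partialDeriv, h1]
      rw [← sum_add_single, ← h1]
      refine (Finset.sum_le_sum fun j _ => ?_).trans hα
      split_ifs <;> simp
  rw [multiDeriv_eq_listDeriv, key _ (List.nodup_finRange m)]
  simp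

theorem IsJet.multiDeriv_eq' {q : ℕ} {J : (Fin m → ℕ) → U → V} (h : IsJet q J)
    {α : Fin m → ℕ} (hα : α ∈ multiIndices m q) {F : U → V} (hF : J 0 = F) :
    multiDeriv α F = J α :=
  hF ▸ h.multiDeriv_eq (mem_multiIndices.1 hα)

theorem IsJet.comp_clm {q : ℕ} {J : (Fin m → ℕ) → U → V} (h : IsJet q J) (L : V →L[ℝ] W) :
    IsJet q fun α x => L (J α x) :=
  ⟨fun α hα => L.continuous.comp (h.1 α hα), fun α i hα => (h.2 α i hα).comp_clm L⟩

theorem IsCq.comp_clm {q : ℕ} {F : U → V} (h : IsCq q F) (L : V →L[ℝ] W) :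
    IsCq q fun x => L (F x) := by
  simpa using (h.isJet.comp_clm L).isCq

theorem IsCq.multiDeriv_comp_clm {q : ℕ} {F : U → V} (h : IsCq q F) (L : V →L[ℝ] W)
    {α : Fin m → ℕ} (hα : α ∈ multiIndices m q) (x : U) :
    multiDeriv α (fun x => L (F x)) x = L (multiDeriv α F x) :=
  congrFun ((h.isJet.comp_clm L).multiDeriv_eq' hα (by simp)) x

theorem IsCq.continuous_multiDeriv {q : ℕ} {F : U → V} (h : IsCq q F) {α : Fin m → ℕ}
    (hα : α ∈ multiIndices m q) : Continuous (multiDeriv α F) :=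
  h.isJet.1 α (mem_multiIndices.1 hα)

theorem zero_mem_multiIndices (m q : ℕ) : (0 : Fin m → ℕ) ∈ multiIndices m q := by
  simp [mem_multiIndices]

/-- Differentiation under the integral sign. -/
theorem isJet_integral {q : ℕ} {Ω : Type*} [MeasurableSpace Ω] {μ : Measure Ω}
    {J : Ω → (Fin m → ℕ) → U → V} {b : Ω → ℝ} (hJ : ∀ w, IsJet q (J w))
    (hm : ∀ α, ∑ i, α i ≤ q → ∀ x, AEStronglyMeasurable (fun w => J w α x) μ)
    (hb : ∀ α, ∑ i, α i ≤ q → ∀ w x, ‖J w α x‖ ≤ b w) (hbi : Integrable b μ) :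
    IsJet q fun α x => ∫ w, J w α x ∂μ := by
  constructor
  · intro α hα
    exact continuous_of_dominated (hm α hα) (fun x => Eventually.of_forall fun w => hb α hα w x) hbi
      (Eventually.of_forall fun w => (hJ w).1 α hα)
  · intro α i hα x
    set e := EuclideanSpace.single i (1 : ℝ)
    have hα1 : ∑ j, (α + Pi.single i 1 : Fin m → ℕ) j ≤ q := by rw [sum_add_single]; omega
    have hc : Continuous fun t : ℝ => (x : EuclideanSpace ℝ (Fin m)) + t • e := by fun_prop
    have hU : {t : ℝ | (x : EuclideanSpace ℝ (Fin m)) + t • e ∈ U} ∈ 𝓝 (0 : ℝ) :=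
      hc.continuousAt.eventually_mem (U.isOpen.mem_nhds (by simp))
    -- Extension by zero commutes with the integral, so the line derivative becomes an ordinary
    -- derivative in t under the integral sign.
    have hz : ∀ y : EuclideanSpace ℝ (Fin m), zeroExt (fun x => ∫ w, J w α x ∂μ) y =
        ∫ w, zeroExt (J w α) y ∂μ := by
      intro y
      by_cases hy : y ∈ U
      · rw [show zeroExt (fun x => ∫ w, J w α x ∂μ) y = _ from zeroExt_coe _ ⟨y, hy⟩]
        exact integral_congr_ae (Eventually.of_forall fun w => (zeroExt_coe (J w α) ⟨y, hy⟩).symm)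
      · simp [zeroExt_of_notMem _ hy]
    have hm' : ∀ y : EuclideanSpace ℝ (Fin m),
        AEStronglyMeasurable (fun w => zeroExt (J w α) y) μ := by
      intro y
      by_cases hy : y ∈ U
      · exact (hm α (by omega) ⟨y, hy⟩).congr
          (Eventually.of_forall fun w => (zeroExt_coe (J w α) ⟨y, hy⟩).symm)
      · simp only [zeroExt_of_notMem _ hy]
        exact aestronglyMeasurable_const
    rw [HasLineDerivAt]
    simp only [hz]
    have := (hasDerivAt_integral_of_dominated_loc_of_deriv_le (μ := μ) (x₀ := (0 : ℝ))
      (F := fun t w => zeroExt (J w α) (x + t • e))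
      (F' := fun t w => zeroExt (J w (α + Pi.single i 1)) (x + t • e)) (bound := b) hU
      (Eventually.of_forall fun t => hm' _)
      (hbi.mono' (hm' _) (Eventually.of_forall fun w => by simpa using hb α (by omega) w x))
      (by simpa using hm _ hα1 x)
      (Eventually.of_forall fun w t ht => by
        rw [show zeroExt (J w (α + Pi.single i 1)) (x + t • e) = _ from zeroExt_coe _ ⟨_, ht⟩]
        exact hb _ hα1 w _)
      hbi (Eventually.of_forall fun w t ht => by
        have h1 := (hJ w).2 α i hα ⟨_, ht⟩
        rw [show zeroExt (J w (α + Pi.single i 1)) (x + t • e) = _ from zeroExt_coe _ ⟨_, ht⟩]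
        rw [HasLineDerivAt] at h1
        have h2 : HasDerivAt (fun s : ℝ => s - t) 1 t := by
          simpa using (hasDerivAt_id t).sub_const t
        have h3 := HasDerivAt.scomp_of_eq (h := fun s : ℝ => s - t) t h1 h2 (by simp)
        rw [one_smul] at h3
        refine h3.congr_of_eventuallyEq (Eventually.of_forall fun s => ?_)
        simp only [Function.comp_apply]
        congr 1
        module)).2
    simpa using this

end Jets

/-! ### Kernels of class C^{q,q} -/

section TwoVariables

variable {m : ℕ} {U : Opens (EuclideanSpace ℝ (Fin m))}
  {V : Type*} [NormedAddCommGroup V] [NormedSpace ℝ V]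
  {W : Type*} [NormedAddCommGroup W] [NormedSpace ℝ W]

theorem IsCqq.isJet_left {q : ℕ} {K : U → U → V} (h : IsCqq q K) {β : Fin m → ℕ}
    (hβ : β ∈ multiIndices m q) (y : U) : IsJet q fun α x => mixedDeriv α β K x y :=
  (h.2.1 β hβ y).isJet

theorem mixedDeriv_zero_left (β : Fin m → ℕ) (K : U → U → V) (x y : U) :
    mixedDeriv 0 β K x y = multiDeriv β (K x) y := by
  rw [mixedDeriv, multiDeriv_zero]

theorem mixedDeriv_zero_right (α : Fin m → ℕ) (K : U → U → V) (x y : U) :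
    mixedDeriv α 0 K x y = multiDeriv α (fun x => K x y) x := by
  simp [mixedDeriv]

theorem mixedDeriv_zero (K : U → U → V) (x y : U) : mixedDeriv 0 0 K x y = K x y := by
  simp [mixedDeriv]

/-- `IsCqq` is asymmetric: differentiability in y is required only of K itself. Induction on |α|
restores the symmetry, each step passing a derivative ∂_j in y through one ∂_i in x by
`HasPartial.interchange`. -/
theorem IsCqq.isJet_right {q : ℕ} {K : U → U → V} (h : IsCqq q K) {α : Fin m → ℕ}
    (hα : α ∈ multiIndices m q) (x : U) : IsJet q fun β y => mixedDeriv α β K x y := by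
  induction hn : ∑ i, α i generalizing α x with
  | zero =>
    have : α = 0 := by
      funext i
      exact (Finset.sum_eq_zero_iff.1 hn) i (Finset.mem_univ i)
    subst this
    simp only [mixedDeriv_zero_left]
    exact (h.1 x).isJet
  | succ n ih =>
    rw [mem_multiIndices] at hα
    obtain ⟨i, -, hi⟩ : ∃ i ∈ Finset.univ, α i ≠ 0 := by
      by_contra! hcon
      rw [Finset.sum_eq_zero hcon] at hn
      omega
    obtain ⟨α', rfl⟩ : ∃ α' : Fin m → ℕ, α = α' + Pi.single i 1 := by
      refine ⟨α - Pi.single i 1, ?_⟩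
      funext j
      by_cases hj : j = i
      · subst hj
        simp only [Pi.add_apply, Pi.sub_apply, Pi.single_eq_same]
        omega
      · simp [hj]
    rw [sum_add_single] at hn hα
    have hα' : α' ∈ multiIndices m q := mem_multiIndices.2 (by omega)
    refine ⟨fun β hβ => ?_, fun β j hβ => ?_⟩
    · exact (h.2.2 _ (mem_multiIndices.2 (by rw [sum_add_single]; omega)) β
        (mem_multiIndices.2 hβ)).comp (Continuous.prodMk_right x)
    · have hβ' : β + Pi.single j 1 ∈ multiIndices m q :=
        mem_multiIndices.2 (by rw [sum_add_single]; omega)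
      have hβ'' : β ∈ multiIndices m q := mem_multiIndices.2 (by omega)
      exact HasPartial.interchange (f := mixedDeriv α' β K)
        (g := mixedDeriv α' (β + Pi.single j 1) K)
        (fun y => (h.isJet_left hβ'' y).2 α' i (by omega))
        (fun y => (h.isJet_left hβ' y).2 α' i (by omega))
        (fun x => (ih hα' x (by omega)).2 β j (by omega))
        (h.2.2 _ (mem_multiIndices.2 (by rw [sum_add_single]; omega)) _ hβ') x

/-- A criterion for `C^{q,q}` in terms of a doubly indexed family of derivatives. -/
theorem isCqq_of_jets {q : ℕ} {J : (Fin m → ℕ) → (Fin m → ℕ) → U → U → V}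
    (h0 : ∀ x, IsJet q fun β y => J 0 β x y)
    (h1 : ∀ β ∈ multiIndices m q, ∀ y, IsJet q fun α x => J α β x y)
    (hc : ∀ α ∈ multiIndices m q, ∀ β ∈ multiIndices m q,
      Continuous fun z : U × U => J α β z.1 z.2) :
    IsCqq q (J 0 0) ∧ ∀ α ∈ multiIndices m q, ∀ β ∈ multiIndices m q, ∀ x y,
      mixedDeriv α β (J 0 0) x y = J α β x y := by
  have e1 : ∀ β ∈ multiIndices m q, ∀ x y, multiDeriv β (J 0 0 x) y = J 0 β x y :=
    fun β hβ x y => congrFun ((h0 x).multiDeriv_eq (mem_multiIndices.1 hβ)) y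
  have e2 : ∀ α ∈ multiIndices m q, ∀ β ∈ multiIndices m q, ∀ x y,
      mixedDeriv α β (J 0 0) x y = J α β x y := by
    intro α hα β hβ x y
    rw [mixedDeriv]
    simp only [e1 β hβ]
    exact congrFun ((h1 β hβ y).multiDeriv_eq (mem_multiIndices.1 hα)) x
  refine ⟨⟨fun x => (h0 x).isCq, fun β hβ y => ?_, fun α hα β hβ => ?_⟩, e2⟩
  · simp only [e1 β hβ]
    exact (h1 β hβ y).isCq
  · simp only [e2 α hα β hβ]
    exact hc α hα β hβ

theorem IsCqq.comp_clm {q : ℕ} {K : U → U → V} (h : IsCqq q K) (L : V →L[ℝ] W) :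
    IsCqq q (fun x y => L (K x y)) ∧ ∀ α ∈ multiIndices m q, ∀ β ∈ multiIndices m q, ∀ x y,
      mixedDeriv α β (fun x y => L (K x y)) x y = L (mixedDeriv α β K x y) := by
  have := isCqq_of_jets (J := fun α β x y => L (mixedDeriv α β K x y)) (q := q)
    (fun x => (h.isJet_right (zero_mem_multiIndices m q) x).comp_clm L)
    (fun β hβ y => (h.isJet_left hβ y).comp_clm L)
    (fun α hα β hβ => L.continuous.comp (h.2.2 α hα β hβ))
  simpa only [mixedDeriv_zero] using this

end TwoVariables

/-! ### Feature maps and reproducing kernel Hilbert spaces -/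

section Features

open ContinuousLinearMap (adjoint)

variable {X : Type*} {H : Type*} [NormedAddCommGroup H] [InnerProductSpace ℂ H] [CompleteSpace H]
  {E : Type*} [NormedAddCommGroup E] [InnerProductSpace ℂ E] [CompleteSpace E]

open scoped ComplexOrder in
/-- A kernel which factors through a Hilbert space is positive definite. -/
theorem isPosDef_of_factor {K : X → X → H →L[ℂ] H} {Φ : X → H →L[ℂ] E}
    (hK : ∀ x y, K x y = adjoint (Φ x) ∘L Φ y) : IsPosDef K := by
  rw [isPosDef_iff]
  intro v
  have : (v.sum fun x a => v.sum fun y b => inner ℂ a (K x y b)) =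
      inner ℂ (v.sum fun x a => Φ x a) (v.sum fun x a => Φ x a) := by
    simp only [hK, ContinuousLinearMap.comp_apply, ContinuousLinearMap.adjoint_inner_right,
      Finsupp.sum, sum_inner, inner_sum]
    rw [Finset.sum_comm]
  rw [this, inner_self_eq_norm_sq_to_K]
  have := sq_nonneg ‖v.sum fun x a => Φ x a‖
  rw [← RCLike.ofReal_pow]
  exact RCLike.ofReal_nonneg.2 this

/-- Two feature maps of the same kernel differ by an isometry. -/
theorem exists_isometry_of_features {R : Type*} [NormedAddCommGroup R] [InnerProductSpace ℂ R]
    [CompleteSpace R] {Ψ : X → H →L[ℂ] R} {Φ : X → H →L[ℂ] E}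
    (h : ∀ x y, adjoint (Ψ x) ∘L Ψ y = adjoint (Φ x) ∘L Φ y)
    (hΨ : ∀ u : R, (∀ x, adjoint (Ψ x) u = 0) → u = 0) :
    ∃ T : R →L[ℂ] E, (∀ x, T ∘L Ψ x = Φ x) ∧ ∀ F, adjoint T (T F) = F := by
  let A : (X →₀ H) →ₗ[ℂ] R := Finsupp.lsum ℂ fun x => (Ψ x).toLinearMap
  let B : (X →₀ H) →ₗ[ℂ] E := Finsupp.lsum ℂ fun x => (Φ x).toLinearMap
  have hAs : ∀ x v, A (Finsupp.single x v) = Ψ x v := fun x v => by simp [A]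
  have hBs : ∀ x v, B (Finsupp.single x v) = Φ x v := fun x v => by simp [B]
  -- `A` and `B` send formal combinations of sections to the two feature spaces. They induce the
  -- same inner products, and `A` has dense range since nothing nonzero is orthogonal to all
  -- features; so `B` factors through `A` by an isometry.
  have hdense : DenseRange A := by
    have h1 : (LinearMap.range A)ᗮ = ⊥ := by
      rw [Submodule.eq_bot_iff]
      intro u hu
      refine hΨ u fun x => ext_inner_left ℂ fun v => ?_
      rw [ContinuousLinearMap.adjoint_inner_right, inner_zero_right]
      exact hu _ ⟨Finsupp.single x v, hAs x v⟩
    have h2 := Submodule.topologicalClosure_eq_top_iff.2 h1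
    rw [← Submodule.dense_iff_topologicalClosure_eq_top] at h2
    exact h2
  have hker : ∀ x y v w, inner ℂ (Ψ x v) (Ψ y w) = inner ℂ (Φ x v) (Φ y w) := by
    intro x y v w
    rw [← ContinuousLinearMap.adjoint_inner_right, ← ContinuousLinearMap.adjoint_inner_right]
    exact congrArg (inner ℂ v) (DFunLike.congr_fun (h x y) w)
  have hinner : ∀ c d, inner ℂ (B c) (B d) = inner ℂ (A c) (A d) := by
    intro c d
    simp only [A, B, Finsupp.lsum_apply, Finsupp.sum, sum_inner, inner_sum,
      ContinuousLinearMap.coe_coe, hker]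
  have hnorm : ∀ c, ‖B c‖ ≤ 1 * ‖A c‖ := by
    intro c
    rw [one_mul, @norm_eq_sqrt_re_inner ℂ, @norm_eq_sqrt_re_inner ℂ, hinner]
  have hT := LinearMap.extendOfNorm_eq hdense ⟨1, hnorm⟩
  refine ⟨B.extendOfNorm A, fun x => ?_, fun F => ?_⟩
  · ext v
    rw [← hBs, ContinuousLinearMap.comp_apply, ← hAs, hT]
  · refine hdense.induction_on F (isClosed_eq (by fun_prop) continuous_id) fun c => ?_
    refine hdense.eq_of_inner_right ℂ fun d => ?_
    rw [ContinuousLinearMap.adjoint_inner_right, hT, hT, hinner]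

/-- The reproducing kernel Hilbert space in terms of a feature map. -/
theorem mem_rkhs_iff {K : X → X → H →L[ℂ] H} {Φ : X → H →L[ℂ] E}
    (hK : ∀ x y, K x y = adjoint (Φ x) ∘L Φ y) {f : X → H} :
    f ∈ rkhs K ↔ ∃ u : E, ∀ x, f x = adjoint (Φ x) u := by
  have hpd : (Matrix.of K).PosSemidef := isPosDef_of_factor hK
  have : Fact (Matrix.of K).PosSemidef := ⟨hpd⟩
  obtain ⟨T, hT, hTT⟩ := exists_isometry_of_features
    (Ψ := RKHS.kerFun (RKHS.OfKernel (Matrix.of K))) (Φ := Φ)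
    (fun x y => by rw [← RKHS.kernel_apply, RKHS.OfKernel.kernel_ofKernel, ← hK, Matrix.of_apply])
    (fun u hu => RKHS.ext fun x => by
      rw [← RKHS.adjoint_kerFun, hu, RKHS.coe_zero, Pi.zero_apply])
  have hadj : ∀ u x, (adjoint T u) x = adjoint (Φ x) u := by
    intro u x
    rw [← RKHS.adjoint_kerFun, ← hT, ContinuousLinearMap.adjoint_comp,
      ContinuousLinearMap.comp_apply]
  constructor
  · rintro ⟨_, F, rfl⟩
    refine ⟨T F, fun x => ?_⟩
    rw [← hadj, hTT]
    rfl
  · rintro ⟨u, hu⟩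
    refine ⟨hpd, adjoint T u, ?_⟩
    funext x
    rw [hu, ← hadj]
    rfl

/-- The feature space is the reproducing kernel Hilbert space itself, with v ↦ K(·,x)v as feature
map at x. The last clause says that a function orthogonal to all sections vanishes. -/
theorem IsPosDef.exists_features {H : Type u} [NormedAddCommGroup H] [InnerProductSpace ℂ H]
    [CompleteSpace H] {X : Type v} {K : X → X → H →L[ℂ] H} (h : IsPosDef K) :
    ∃ (E : Type (max u v)) (_ : NormedAddCommGroup E) (_ : InnerProductSpace ℂ E)
      (_ : CompleteSpace E) (Φ : X → H →L[ℂ] E), (∀ x y, K x y = adjoint (Φ x) ∘L Φ y) ∧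
      ∀ u : E, (∀ x, adjoint (Φ x) u = 0) → u = 0 := by
  have : Fact (Matrix.of K).PosSemidef := ⟨h⟩
  refine ⟨RKHS.OfKernel (Matrix.of K), inferInstance, inferInstance, inferInstance,
    RKHS.kerFun _, fun x y => ?_, fun u hu => ?_⟩
  · rw [← RKHS.kernel_apply, RKHS.OfKernel.kernel_ofKernel, Matrix.of_apply]
  · refine RKHS.ext fun x => ?_
    rw [← RKHS.adjoint_kerFun, hu, RKHS.coe_zero, Pi.zero_apply]

theorem kernel_section_mem_rkhs {K : X → X → H →L[ℂ] H} (h : IsPosDef K) (y : X) (v : H) :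
    (fun x => K x y v) ∈ rkhs K := by
  obtain ⟨E, _, _, _, Φ, hΦ, -⟩ := h.exists_features
  exact (mem_rkhs_iff hΦ).2 ⟨Φ y v, fun x => by rw [hΦ]; rfl⟩

open scoped ComplexOrder in
theorem isPosDef_of_tendsto {ι : Type*} {l : Filter ι} [l.NeBot] {K : X → X → H →L[ℂ] H}
    {Kn : ι → X → X → H →L[ℂ] H} (h : ∀ n, IsPosDef (Kn n))
    (hlim : ∀ x y, Tendsto (fun n => Kn n x y) l (𝓝 (K x y))) : IsPosDef K := by
  rw [isPosDef_iff]
  intro v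
  have h1 : Tendsto (fun n => v.sum fun x a => v.sum fun y b => inner ℂ a (Kn n x y b)) l
      (𝓝 (v.sum fun x a => v.sum fun y b => inner ℂ a (K x y b))) := by
    refine tendsto_finsetSum _ fun x _ => tendsto_finsetSum _ fun y _ => ?_
    exact tendsto_const_nhds.inner ((ContinuousLinearMap.apply ℂ H (v y)).continuous.tendsto _ |>.comp
      (hlim x y))
  exact ge_of_tendsto h1 (Eventually.of_forall fun n => (isPosDef_iff _).1 (h n) v)

theorem adjoint_real_smul (t : ℝ) (T : H →L[ℂ] E) : adjoint (t • T) = t • adjoint T := by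
  refine ContinuousLinearMap.ext fun u => ext_inner_left ℂ fun v => ?_
  rw [ContinuousLinearMap.adjoint_inner_right]
  simp only [_root_.smul_apply, ← Complex.coe_smul, inner_smul_left, inner_smul_right,
    Complex.conj_ofReal, ContinuousLinearMap.adjoint_inner_right]

variable (H) in
/-- The map `T ↦ T* u`, as a real linear map. -/
noncomputable def adjointApply (u : E) : (H →L[ℂ] E) →L[ℝ] H :=
  LinearMap.mkContinuous
    { toFun := fun T => adjoint T u
      map_add' := fun S T => by simp
      map_smul' := fun c T => by simp [adjoint_real_smul] } ‖u‖ fun T => by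
    simpa [mul_comm] using (adjoint T).le_opNorm u

@[simp]
theorem adjointApply_apply (u : E) (T : H →L[ℂ] E) : adjointApply H u T = adjoint T u := rfl

end Features

/-! ### Derivatives of a positive definite kernel and of its feature map -/

section DerivativeKernel

open ContinuousLinearMap (adjoint)

variable {m : ℕ} {U : Opens (EuclideanSpace ℝ (Fin m))}
  {H : Type u} [NormedAddCommGroup H] [InnerProductSpace ℂ H] [CompleteSpace H]
  {V : Type*} [NormedAddCommGroup V] [NormedSpace ℝ V]

theorem eventually_add_smul_mem (x : U) (i : Fin m) : ∀ᶠ t : ℝ in 𝓝[≠] 0,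
    (x : EuclideanSpace ℝ (Fin m)) + t • EuclideanSpace.single i (1 : ℝ) ∈ U := by
  have hc : Continuous fun t : ℝ =>
      (x : EuclideanSpace ℝ (Fin m)) + t • EuclideanSpace.single i (1 : ℝ) := by fun_prop
  exact nhdsWithin_le_nhds (hc.continuousAt.eventually_mem (U.isOpen.mem_nhds (by simp)))

/-- The difference quotient of `F` at `x` in the `i`-th coordinate direction. -/
noncomputable def diffQuot (i : Fin m) (t : ℝ) (F : U → V) (x : U) : V :=
  t⁻¹ • (zeroExt F (x + t • EuclideanSpace.single i (1 : ℝ)) - F x)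

theorem diffQuot_of_mem {i : Fin m} {t : ℝ} {x : U} (F : U → V)
    (h : (x : EuclideanSpace ℝ (Fin m)) + t • EuclideanSpace.single i (1 : ℝ) ∈ U) :
    diffQuot i t F x = t⁻¹ • (F ⟨_, h⟩ - F x) := by
  rw [diffQuot, show zeroExt F (x + t • EuclideanSpace.single i (1 : ℝ)) = _ from
    zeroExt_coe F ⟨_, h⟩]

theorem HasPartial.tendsto_diffQuot {i : Fin m} {F F' : U → V} (h : HasPartial i F F') (x : U) :
    Tendsto (fun t => diffQuot i t F x) (𝓝[≠] 0) (𝓝 (F' x)) := by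
  have := (h x).tendsto_slope_zero
  simpa only [zeroExt_coe, diffQuot] using this

/-- Both quotients use the same increment t, so that the diagonal limit, in which the two
approximating features share one parameter, is available. -/
theorem tendsto_second_diffQuot {i j : Fin m} {f g k : U → U → V}
    (hgk : ∀ y, HasPartial i (fun x => g x y) fun x => k x y)
    (hfg : ∀ x, HasPartial j (f x) (g x))
    (hk : Continuous fun z : U × U => k z.1 z.2) (x y : U) :
    Tendsto (fun t => diffQuot i t (fun x => diffQuot j t (f x) y) x) (𝓝[≠] 0) (𝓝 (k x y)) := by
  rw [Metric.tendsto_nhds]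
  intro ε hε
  obtain ⟨δ, hδ, h1⟩ := norm_second_difference_le hgk hfg hk x y (half_pos hε)
  filter_upwards [self_mem_nhdsWithin, eventually_add_smul_mem x i, eventually_add_smul_mem y j,
    nhdsWithin_le_nhds (Metric.ball_mem_nhds (0 : ℝ) hδ)] with t ht0 hx hy htδ
  have ht0 : t ≠ 0 := ht0
  have htδ : |t| < δ := by simpa using htδ
  have h2 := h1 t t ⟨_, hx⟩ ⟨_, hy⟩ htδ htδ rfl rfl
  rw [dist_eq_norm, diffQuot_of_mem _ hx, diffQuot_of_mem _ hy, diffQuot_of_mem _ hy]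
  have h3 : t⁻¹ • (t⁻¹ • (f ⟨_, hx⟩ ⟨_, hy⟩ - f ⟨_, hx⟩ y) - t⁻¹ • (f x ⟨_, hy⟩ - f x y)) - k x y =
      (t⁻¹ * t⁻¹) • (f ⟨_, hx⟩ ⟨_, hy⟩ - f x ⟨_, hy⟩ - (f ⟨_, hx⟩ y - f x y) - (t * t) • k x y) := by
    rw [smul_sub (t⁻¹ * t⁻¹) _ ((t * t) • k x y), smul_smul,
      show t⁻¹ * t⁻¹ * (t * t) = 1 by field_simp, one_smul, ← smul_sub, smul_smul]
    congr 2
    abel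
  rw [h3, norm_smul, norm_mul, norm_inv, Real.norm_eq_abs]
  have ht : 0 < |t| := abs_pos.2 ht0
  calc |t|⁻¹ * |t|⁻¹ * _ ≤ |t|⁻¹ * |t|⁻¹ * (ε / 2 * |t| * |t|) := by gcongr
    _ = ε / 2 := by field_simp
    _ < ε := half_lt_self hε

theorem diffQuot_comp_clm {W : Type*} [NormedAddCommGroup W] [NormedSpace ℝ W] (i : Fin m) (t : ℝ)
    (F : U → V) (x : U) (L : V →L[ℝ] W) :
    L (diffQuot i t F x) = diffQuot i t (fun x => L (F x)) x := by
  rw [diffQuot, diffQuot, map_smul, map_sub]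
  congr 2
  by_cases hy : (x : EuclideanSpace ℝ (Fin m)) + t • EuclideanSpace.single i (1 : ℝ) ∈ U
  · rw [show zeroExt F _ = _ from zeroExt_coe F ⟨_, hy⟩]
    exact (zeroExt_coe (fun x => L (F x)) ⟨_, hy⟩).symm
  · rw [zeroExt_of_notMem _ hy, zeroExt_of_notMem _ hy, map_zero]

theorem adjoint_diffQuot {E : Type*} [NormedAddCommGroup E] [InnerProductSpace ℂ E]
    [CompleteSpace E] (i : Fin m) (t : ℝ) (Φ : U → H →L[ℂ] E) (x : U) (T : H →L[ℂ] E) :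
    adjoint (diffQuot i t Φ x) ∘L T = diffQuot i t (fun x => adjoint (Φ x) ∘L T) x := by
  rw [diffQuot, diffQuot, adjoint_real_smul, map_sub, ContinuousLinearMap.smul_comp,
    ContinuousLinearMap.sub_comp]
  congr 2
  by_cases hy : (x : EuclideanSpace ℝ (Fin m)) + t • EuclideanSpace.single i (1 : ℝ) ∈ U
  · rw [show zeroExt Φ _ = _ from zeroExt_coe Φ ⟨_, hy⟩]
    exact (zeroExt_coe (fun x => adjoint (Φ x) ∘L T) ⟨_, hy⟩).symm
  · rw [zeroExt_of_notMem _ hy, zeroExt_of_notMem _ hy, map_zero, ContinuousLinearMap.zero_comp]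

theorem comp_diffQuot {H E : Type*} [NormedAddCommGroup H] [InnerProductSpace ℂ H]
    [NormedAddCommGroup E] [InnerProductSpace ℂ E] (i : Fin m) (t : ℝ) (Φ : U → H →L[ℂ] E) (x : U) (T : E →L[ℂ] H) :
    T ∘L diffQuot i t Φ x = diffQuot i t (fun x => T ∘L Φ x) x :=
  diffQuot_comp_clm i t Φ x ((ContinuousLinearMap.compL ℂ H E H T).restrictScalars ℝ)

theorem exists_add_single_of_sum_eq_succ {n : ℕ} {α : Fin m → ℕ} (h : ∑ i, α i = n + 1) :
    ∃ (β : Fin m → ℕ) (i : Fin m), ∑ i, β i = n ∧ α = β + Pi.single i 1 := by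
  obtain ⟨i, -, hi⟩ : ∃ i ∈ Finset.univ, α i ≠ 0 := by
    by_contra! hcon
    rw [Finset.sum_eq_zero hcon] at h
    omega
  have hα : α = (α - Pi.single i 1) + Pi.single i 1 := by
    funext j
    by_cases hj : j = i
    · subst hj
      simp only [Pi.add_apply, Pi.sub_apply, Pi.single_eq_same]
      omega
    · simp [hj]
  refine ⟨α - Pi.single i 1, i, ?_, hα⟩
  rw [hα, sum_add_single] at h
  omega

/-- The derivatives of a positive definite kernel form a positive definite kernel. -/
theorem isPosDef_mixedDeriv {q : ℕ} {K : U → U → H →L[ℂ] H} (hK : IsPosDef K) (hq : IsCqq q K)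
    {n : ℕ} (hn : n ≤ q) :
    IsPosDef fun a b : {α : Fin m → ℕ // ∑ i, α i ≤ n} × U => mixedDeriv a.1 b.1 K a.2 b.2 := by
  induction n with
  | zero =>
    obtain ⟨E, _, _, _, Φ, hΦ, -⟩ := hK.exists_features
    refine isPosDef_of_factor (Φ := fun a => Φ a.2) fun a b => ?_
    have h0 : ∀ a : {α : Fin m → ℕ // ∑ i, α i ≤ 0}, a.1 = 0 := fun a => by
      funext i
      exact Finset.sum_eq_zero_iff.1 (Nat.le_zero.1 a.2) i (Finset.mem_univ i)
    rw [h0, h0, mixedDeriv_zero, hΦ]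
  | succ n ih =>
    obtain ⟨E, _, _, _, Ψ, hΨ, -⟩ := (ih (by omega)).exists_features
    have hdec : ∀ α : {α : Fin m → ℕ // ∑ i, α i ≤ n + 1}, ¬ ∑ i, α.1 i ≤ n →
        ∃ (β : {α : Fin m → ℕ // ∑ i, α i ≤ n}) (i : Fin m), α.1 = β.1 + Pi.single i 1 := by
      rintro ⟨α, hα⟩ hα'
      replace hα' : ¬ ∑ i, α i ≤ n := hα'
      obtain ⟨β, i, hβ, h⟩ := exists_add_single_of_sum_eq_succ (show ∑ i, α i = n + 1 by omega)
      exact ⟨⟨β, hβ.le⟩, i, h⟩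
    choose dβ di hd using hdec
    have hmem : ∀ α : {α : Fin m → ℕ // ∑ i, α i ≤ n + 1}, α.1 ∈ multiIndices m q :=
      fun α => mem_multiIndices.2 (α.2.trans hn)
    have hmem' : ∀ α : {α : Fin m → ℕ // ∑ i, α i ≤ n}, α.1 ∈ multiIndices m q :=
      fun α => mem_multiIndices.2 (α.2.trans (by omega))
    have hL : ∀ (α : {α : Fin m → ℕ // ∑ i, α i ≤ n + 1}) (hα : ¬ ∑ i, α.1 i ≤ n)
        (β) (_ : β ∈ multiIndices m q) (y : U),
        HasPartial (di α hα) (fun x => mixedDeriv (dβ α hα).1 β K x y)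
          fun x => mixedDeriv α.1 β K x y := by
      intro α hα β hβ y
      have := (hq.isJet_left hβ y).2 (dβ α hα).1 (di α hα)
        (by have := (dβ α hα).2; omega)
      rwa [← hd α hα] at this
    have hR : ∀ (α : {α : Fin m → ℕ // ∑ i, α i ≤ n + 1}) (hα : ¬ ∑ i, α.1 i ≤ n)
        (β) (_ : β ∈ multiIndices m q) (x : U),
        HasPartial (di α hα) (mixedDeriv β (dβ α hα).1 K x) (mixedDeriv β α.1 K x) := by
      intro α hα β hβ x
      have := (hq.isJet_right hβ x).2 (dβ α hα).1 (di α hα)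
        (by have := (dβ α hα).2; omega)
      rwa [← hd α hα] at this
    -- Features of order at most n are kept, and those of order n + 1 are replaced by difference
    -- quotients of lower ones. For every t this is a genuine feature map, and its kernel tends to
    -- the kernel of derivatives as t → 0.
    let Φ : ℝ → {α : Fin m → ℕ // ∑ i, α i ≤ n + 1} × U → H →L[ℂ] E := fun t a =>
      if h : ∑ i, a.1.1 i ≤ n then Ψ (⟨a.1.1, h⟩, a.2)
      else diffQuot (di a.1 h) t (fun x => Ψ (dβ a.1 h, x)) a.2
    refine isPosDef_of_tendsto (l := 𝓝[≠] (0 : ℝ)) (Kn := fun t a b => adjoint (Φ t a) ∘L Φ t b)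
      (fun t => isPosDef_of_factor fun _ _ => rfl) ?_
    rintro ⟨α, x⟩ ⟨β, y⟩
    by_cases hα : ∑ i, α.1 i ≤ n <;> by_cases hβ : ∑ i, β.1 i ≤ n
    · simp only [Φ, hα, hβ, dif_pos, ← hΨ]
      exact tendsto_const_nhds
    · simp only [Φ, hα, hβ, dif_pos, dif_neg, not_false_eq_true, comp_diffQuot, ← hΨ]
      exact (hR β hβ α.1 (hmem α) x).tendsto_diffQuot y
    · simp only [Φ, hα, hβ, dif_pos, dif_neg, not_false_eq_true, adjoint_diffQuot, ← hΨ]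
      exact (hL α hα β.1 (hmem β) y).tendsto_diffQuot x
    · simp only [Φ, hα, hβ, dif_neg, not_false_eq_true, adjoint_diffQuot]
      simp only [comp_diffQuot, ← hΨ]
      exact tendsto_second_diffQuot (hL α hα β.1 (hmem β)) (fun x => hR β hβ _ (hmem' _) x)
        (hq.2.2 _ (hmem α) _ (hmem β)) x y

/-- The derivatives of a positive definite kernel are represented by the derivatives of a feature
map. -/
theorem exists_jet_features {q : ℕ} {K : U → U → H →L[ℂ] H} (hK : IsPosDef K) (hq : IsCqq q K) :
    ∃ (E : Type u) (_ : NormedAddCommGroup E) (_ : InnerProductSpace ℂ E) (_ : CompleteSpace E)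
      (Φ : (Fin m → ℕ) → U → H →L[ℂ] E), IsJet q Φ ∧
      (∀ α ∈ multiIndices m q, ∀ β ∈ multiIndices m q, ∀ x y,
        mixedDeriv α β K x y = adjoint (Φ α x) ∘L Φ β y) ∧
      ∀ u : E, (∀ x, adjoint (Φ 0 x) u = 0) → u = 0 := by
  obtain ⟨E, _, _, _, Ψ, hΨ, hu⟩ := (isPosDef_mixedDeriv hK hq le_rfl).exists_features
  let Φ : (Fin m → ℕ) → U → H →L[ℂ] E := fun α x =>
    if h : ∑ i, α i ≤ q then Ψ (⟨α, h⟩, x) else 0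
  have hΦ : ∀ α ∈ multiIndices m q, ∀ β ∈ multiIndices m q, ∀ x y,
      mixedDeriv α β K x y = adjoint (Φ α x) ∘L Φ β y := by
    intro α hα β hβ x y
    rw [mem_multiIndices] at hα hβ
    simp only [Φ, hα, hβ, dif_pos, ← hΨ]
  have hjet : IsJet q Φ := by
    refine ⟨fun α hα => ?_, fun α i hα => ?_⟩
    · have hα' := mem_multiIndices.2 hα
      rw [continuous_iff_continuousAt]
      intro x
      rw [ContinuousAt, tendsto_iff_norm_sub_tendsto_zero]
      -- The identity ‖T‖² = ‖T*T‖ expresses norms of feature differences through the kernel, whose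
      -- joint continuity then applies.
      have h1 : ∀ y, ‖Φ α y - Φ α x‖ = √‖mixedDeriv α α K y y - mixedDeriv α α K x y -
          (mixedDeriv α α K y x - mixedDeriv α α K x x)‖ := by
        intro y
        rw [hΦ _ hα' _ hα', hΦ _ hα' _ hα', hΦ _ hα' _ hα', hΦ _ hα' _ hα',
          ← ContinuousLinearMap.sub_comp, ← ContinuousLinearMap.sub_comp,
          ← ContinuousLinearMap.comp_sub, ← map_sub, ContinuousLinearMap.norm_adjoint_comp_self,
          Real.sqrt_mul_self (norm_nonneg _)]
      simp only [h1]
      have hc := hq.2.2 α hα' α hα'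
      have h2 : Continuous fun y => √‖mixedDeriv α α K y y - mixedDeriv α α K x y -
          (mixedDeriv α α K y x - mixedDeriv α α K x x)‖ :=
        Real.continuous_sqrt.comp (((hc.comp (continuous_id.prodMk continuous_id)).sub
          (hc.comp (Continuous.prodMk_right x))).sub
          ((hc.comp (Continuous.prodMk_left x)).sub continuous_const)).norm
      simpa using h2.tendsto x
    · have hα' : α ∈ multiIndices m q := mem_multiIndices.2 (by omega)
      have hα1 : α + Pi.single i 1 ∈ multiIndices m q :=
        mem_multiIndices.2 (by rw [sum_add_single]; omega)
      have hL := fun β (hβ : β ∈ multiIndices m q) y => (hq.isJet_left hβ y).2 α i hα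
      have hR := fun β (hβ : β ∈ multiIndices m q) x => (hq.isJet_right hβ x).2 α i hα
      rw [hasPartial_iff]
      intro x ε hε
      -- `T* T` below splits into a second difference and two first difference errors; each
      -- contributes at most (ε²/3) t².
      have hε' : 0 < ε ^ 2 / 3 := by positivity
      obtain ⟨δ₁, hδ₁, h1⟩ := norm_second_difference_le (hL _ hα1) (hR _ hα') (hq.2.2 _ hα1 _ hα1)
        x x hε'
      obtain ⟨δ₂, hδ₂, h2⟩ := hasPartial_iff.1 (hL _ hα1 x) x _ hε'
      obtain ⟨δ₃, hδ₃, h3⟩ := hasPartial_iff.1 (hR _ hα1 x) x _ hε'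
      refine ⟨min δ₁ (min δ₂ δ₃), by positivity, fun t y ht hy => ?_⟩
      simp only [lt_min_iff] at ht
      have e1 := h1 t t y y ht.1 ht.1 hy hy
      have e2 := h2 t y ht.2.1 hy
      have e3 := h3 t y ht.2.2 hy
      set T := Φ α y - Φ α x - t • Φ (α + Pi.single i 1) x with hT
      have hTT : adjoint T ∘L T =
          (mixedDeriv α α K y y - mixedDeriv α α K x y - (mixedDeriv α α K y x - mixedDeriv α α K x x)
            - (t * t) • mixedDeriv (α + Pi.single i 1) (α + Pi.single i 1) K x x)
          - t • (mixedDeriv α (α + Pi.single i 1) K y x - mixedDeriv α (α + Pi.single i 1) K x x -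
            t • mixedDeriv (α + Pi.single i 1) (α + Pi.single i 1) K x x)
          - t • (mixedDeriv (α + Pi.single i 1) α K x y - mixedDeriv (α + Pi.single i 1) α K x x -
            t • mixedDeriv (α + Pi.single i 1) (α + Pi.single i 1) K x x) := by
        simp only [hΦ _ hα' _ hα', hΦ _ hα1 _ hα', hΦ _ hα' _ hα1, hΦ _ hα1 _ hα1, hT, map_sub,
          adjoint_real_smul, ContinuousLinearMap.sub_comp, ContinuousLinearMap.comp_sub,
          ContinuousLinearMap.smul_comp, ContinuousLinearMap.comp_smul]
        module
      have hnorm : ‖T‖ * ‖T‖ ≤ (ε * |t|) * (ε * |t|) := by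
        rw [← ContinuousLinearMap.norm_adjoint_comp_self, hTT]
        refine (norm_sub_le _ _).trans ((add_le_add_left (norm_sub_le _ _) _).trans ?_)
        rw [norm_smul, norm_smul, Real.norm_eq_abs]
        calc _ ≤ ε ^ 2 / 3 * |t| * |t| + |t| * (ε ^ 2 / 3 * |t|) + |t| * (ε ^ 2 / 3 * |t|) := by
              gcongr
          _ = _ := by ring
      exact abs_le_of_sq_le_sq' (by nlinarith) (by positivity) |>.2
  refine ⟨E, _, _, ‹_›, Φ, hjet, hΦ, fun u h => hu u ?_⟩
  rintro ⟨⟨α, hα⟩, x⟩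
  -- Orthogonality to the `Φ 0 x` implies orthogonality to all `Φ α x`, because `Φ α x* u` is the
  -- derivative ∂^α of the zero function `Φ 0 x* u`.
  have h0 : multiDeriv α (fun _ : U => (0 : H)) x = 0 := by
    have : IsJet q fun (_ : Fin m → ℕ) (_ : U) => (0 : H) := by
      simpa using hjet.comp_clm (0 : (H →L[ℂ] E) →L[ℝ] H)
    exact congrFun (this.multiDeriv_eq hα) x
  have h1 := congrFun ((hjet.comp_clm (adjointApply H u)).multiDeriv_eq hα) x
  simp only [adjointApply_apply, h] at h1
  rw [h0] at h1
  simpa only [Φ, hα, dif_pos] using h1.symm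

theorem mem_rkhs_iff_of_jet {q : ℕ} {K : U → U → H →L[ℂ] H} {E : Type*} [NormedAddCommGroup E]
    [InnerProductSpace ℂ E] [CompleteSpace E] {Φ : (Fin m → ℕ) → U → H →L[ℂ] E}
    (hΦ : ∀ α ∈ multiIndices m q, ∀ β ∈ multiIndices m q, ∀ x y,
      mixedDeriv α β K x y = adjoint (Φ α x) ∘L Φ β y) {f : U → H} :
    f ∈ rkhs K ↔ ∃ u : E, f = fun x => adjoint (Φ 0 x) u := by
  have h0 := zero_mem_multiIndices m q
  rw [mem_rkhs_iff (Φ := Φ 0) fun x y => by rw [← hΦ 0 h0 0 h0, mixedDeriv_zero]]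
  simp only [funext_iff]

theorem multiDeriv_adjoint {q : ℕ} {E : Type*} [NormedAddCommGroup E] [InnerProductSpace ℂ E]
    [CompleteSpace E] {Φ : (Fin m → ℕ) → U → H →L[ℂ] E} (hj : IsJet q Φ) {α : Fin m → ℕ}
    (hα : α ∈ multiIndices m q) (u : E) :
    multiDeriv α (fun x => adjoint (Φ 0 x) u) = fun x => adjoint (Φ α x) u :=
  (hj.comp_clm (adjointApply H u)).multiDeriv_eq (mem_multiIndices.1 hα)

theorem isCq_of_mem_rkhs {q : ℕ} {K : U → U → H →L[ℂ] H} (hK : IsPosDef K) (hq : IsCqq q K)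
    {f : U → H} (hf : f ∈ rkhs K) : IsCq q f := by
  obtain ⟨E, _, _, _, Φ, hj, hΦ, -⟩ := exists_jet_features hK hq
  obtain ⟨u, rfl⟩ := (mem_rkhs_iff_of_jet hΦ).1 hf
  exact (hj.comp_clm (adjointApply H u)).isCq

end DerivativeKernel

/-! ### Scalar projections of operator valued kernels -/

section ScalarKernels

open ContinuousLinearMap (adjoint)

variable {X : Type v} {H : Type u} [NormedAddCommGroup H] [InnerProductSpace ℂ H] [CompleteSpace H]

theorem kernelProj_factor {E : Type*} [NormedAddCommGroup E] [InnerProductSpace ℂ E]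
    [CompleteSpace E] {K : X → X → H →L[ℂ] H} {Φ : X → H →L[ℂ] E}
    (hΦ : ∀ x y, K x y = adjoint (Φ x) ∘L Φ y) (v : H) (x y : X) :
    scalarKernel (kernelProj K v) x y =
      adjoint (Φ x ∘L ContinuousLinearMap.toSpanSingleton ℂ v) ∘L
        (Φ y ∘L ContinuousLinearMap.toSpanSingleton ℂ v) := by
  refine ContinuousLinearMap.ext fun c => ext_inner_left ℂ fun d => ?_
  rw [ContinuousLinearMap.comp_apply, ContinuousLinearMap.adjoint_inner_right]
  simp only [scalarKernel, kernelProj, hΦ, ContinuousLinearMap.mul_apply',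
    ContinuousLinearMap.comp_apply, ContinuousLinearMap.toSpanSingleton_apply, map_smul,
    inner_smul_left, inner_smul_right, ContinuousLinearMap.adjoint_inner_right]
  simp only [RCLike.inner_apply]
  ring

theorem isPosDef_kernelProj {K : X → X → H →L[ℂ] H} (hK : IsPosDef K) (v : H) :
    IsPosDef (scalarKernel (kernelProj K v)) := by
  obtain ⟨E, _, _, _, Φ, hΦ, -⟩ := hK.exists_features
  exact isPosDef_of_factor (kernelProj_factor hΦ v)

/-- The projected kernel has feature map Φ(x)v with the same feature space, so each vector u gives
the function ⟨Φ(x)*u, v⟩, the projection of the function it gives in H_K. -/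
theorem mem_rkhs_kernelProj_iff {K : X → X → H →L[ℂ] H} (hK : IsPosDef K) (v : H) {f : X → ℂ} :
    f ∈ rkhs (scalarKernel (kernelProj K v)) ↔ ∃ F ∈ rkhs K, f = fun x => inner ℂ v (F x) := by
  obtain ⟨E, _, _, _, Φ, hΦ, -⟩ := hK.exists_features
  have key : ∀ x u, adjoint (Φ x ∘L ContinuousLinearMap.toSpanSingleton ℂ v) u =
      inner ℂ v (adjoint (Φ x) u) := by
    intro x u
    have := ContinuousLinearMap.adjoint_inner_right
      (Φ x ∘L ContinuousLinearMap.toSpanSingleton ℂ v) (1 : ℂ) u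
    rw [ContinuousLinearMap.adjoint_inner_right]
    simpa using this
  rw [mem_rkhs_iff (kernelProj_factor hΦ v)]
  simp only [key]
  constructor
  · rintro ⟨u, hu⟩
    exact ⟨_, (mem_rkhs_iff hΦ).2 ⟨u, fun x => rfl⟩, funext hu⟩
  · rintro ⟨F, hF, rfl⟩
    obtain ⟨u, hu⟩ := (mem_rkhs_iff hΦ).1 hF
    exact ⟨u, fun x => congrArg (inner ℂ v) (hu x)⟩

variable {m : ℕ} {U : Opens (EuclideanSpace ℝ (Fin m))}

theorem isCqq_scalarKernel {q : ℕ} {k : U → U → ℂ} (hk : IsCqq q k) :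
    IsCqq q (scalarKernel k) ∧ ∀ α ∈ multiIndices m q, ∀ β ∈ multiIndices m q, ∀ x y,
      mixedDeriv α β (scalarKernel k) x y = ContinuousLinearMap.mul ℂ ℂ (mixedDeriv α β k x y) :=
  hk.comp_clm ((ContinuousLinearMap.mul ℂ ℂ).restrictScalars ℝ)

theorem isCqq_kernelProj {q : ℕ} {K : U → U → H →L[ℂ] H} (hK : IsCqq q K) (v : H) :
    IsCqq q (kernelProj K v) ∧ ∀ α ∈ multiIndices m q, ∀ β ∈ multiIndices m q, ∀ x y,
      mixedDeriv α β (kernelProj K v) x y = inner ℂ v (mixedDeriv α β K x y v) :=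
  hK.comp_clm (((innerSL ℂ v).comp (ContinuousLinearMap.apply ℂ H v)).restrictScalars ℝ)

end ScalarKernels

/-! ### Integration against a vector measure with a density -/

section Density

variable {X : Type*} [MeasurableSpace X] {E F G : Type*}
  [NormedAddCommGroup E] [NormedSpace ℝ E] [NormedAddCommGroup F] [NormedSpace ℝ F]
  [CompleteSpace F] [NormedAddCommGroup G] [NormedSpace ℝ G]

theorem eq_withDensityᵥ {η : VectorMeasure X F} {μ : Measure X} {g : X → F} (hg : Integrable g μ)
    (hη : ∀ A, MeasurableSet A → η A = ∫ x in A, g x ∂μ) : η = μ.withDensityᵥ g := by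
  ext A hA
  rw [hη A hA, withDensityᵥ_apply hg hA]

theorem variation_eq_withDensity {η : VectorMeasure X F} {μ : Measure X} {g : X → F}
    (hg : Integrable g μ) (hη : ∀ A, MeasurableSet A → η A = ∫ x in A, g x ∂μ) :
    η.variation = μ.withDensity fun x => ‖g x‖ₑ := by
  rw [eq_withDensityᵥ hg hη, Measure.variation_withDensityᵥ hg]

/-- A null set of ‖g‖μ is μ-null apart from the zeros of g, and there both sides vanish. -/
theorem bilin_congr_ae {μ : Measure X} {g : X → F} (hg : Integrable g μ) (B : E →L[ℝ] F →L[ℝ] G)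
    {f f' : X → E} (h : f =ᵐ[μ.withDensity fun x => ‖g x‖ₑ] f') :
    (fun x => B (f x) (g x)) =ᵐ[μ] fun x => B (f' x) (g x) := by
  rw [EventuallyEq, ae_withDensity_iff' hg.aestronglyMeasurable.enorm] at h
  filter_upwards [h] with x hx
  by_cases hgx : g x = 0
  · simp [hgx]
  · rw [hx (by simpa using hgx)]

theorem integrable_norm_mul_norm {μ : Measure X} {g : X → F} (hg : Integrable g μ) {f : X → E}
    (hf : Integrable f (μ.withDensity fun x => ‖g x‖ₑ)) : Integrable (fun x => ‖f x‖ * ‖g x‖) μ ∧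
      ∫ x, ‖f x‖ * ‖g x‖ ∂μ = ∫ x, ‖f x‖ ∂(μ.withDensity fun x => ‖g x‖ₑ) := by
  have hfin : ∀ᵐ x ∂μ, ‖g x‖ₑ < ⊤ := Eventually.of_forall fun x => enorm_lt_top
  have h1 := (integrable_withDensity_iff_integrable_smul₀' hg.aestronglyMeasurable.enorm hfin).1
    hf.norm
  have h2 := integral_withDensity_eq_integral_toReal_smul₀ hg.aestronglyMeasurable.enorm hfin
    fun x => ‖f x‖
  simp only [toReal_enorm, smul_eq_mul, mul_comm ‖g _‖] at h1 h2
  exact ⟨h1, h2.symm⟩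

theorem integrable_bilin {μ : Measure X} {g : X → F} (hg : Integrable g μ)
    (B : E →L[ℝ] F →L[ℝ] G) {f : X → E} (hf : Integrable f (μ.withDensity fun x => ‖g x‖ₑ)) :
    Integrable (fun x => B (f x) (g x)) μ := by
  obtain ⟨f', hf', hff'⟩ := hf.aestronglyMeasurable
  refine ((integrable_norm_mul_norm hg hf).1.const_mul ‖B‖).mono' ?_
    (Eventually.of_forall fun x => ?_)
  · exact (B.aestronglyMeasurable_comp₂ hf'.aestronglyMeasurable hg.aestronglyMeasurable).congr
      (bilin_congr_ae hg B hff').symm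
  · rw [← mul_assoc]
    exact B.le_opNorm₂ _ _

/-- Integration with respect to a vector measure with a density. -/
theorem integral_eq_of_density [CompleteSpace G] {η : VectorMeasure X F} {μ : Measure X} {g : X → F}
    (hg : Integrable g μ) (hη : ∀ A, MeasurableSet A → η A = ∫ x in A, g x ∂μ)
    (B : E →L[ℝ] F →L[ℝ] G) {f : X → E} (hf : η.Integrable f) :
    η.integral f B = ∫ x, B (f x) (g x) ∂μ := by
  have hν := variation_eq_withDensity hg hη
  have hI : ∀ f : X → E, Integrable f η.variation → Integrable (fun x => B (f x) (g x)) μ :=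
    fun f hf => integrable_bilin hg B (by rwa [← hν])
  have hbound : ∀ f : X → E, Integrable f η.variation →
      ‖∫ x, B (f x) (g x) ∂μ‖ ≤ ‖B‖ * ∫ x, ‖f x‖ ∂η.variation := by
    intro f hf
    rw [hν] at hf ⊢
    obtain ⟨h1, h2⟩ := integrable_norm_mul_norm hg hf
    rw [← h2, ← integral_const_mul]
    refine norm_integral_le_of_norm_le (h1.const_mul _) (Eventually.of_forall fun x => ?_)
    rw [← mul_assoc]
    exact B.le_opNorm₂ _ _
  -- Induction over integrable functions. Closedness holds because the left side is continuous on L¹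
  -- of the variation and the right side is Lipschitz there by `hbound`.
  refine hf.induction (P := fun f => η.integral f B = ∫ x, B (f x) (g x) ∂μ) ?_ ?_ ?_ ?_
  · intro c s hs hc
    have : IsFiniteMeasure (η.variation.restrict s) := ⟨by simpa⟩
    rw [VectorMeasure.integral_indicator_const _ hs, hη s hs,
      ← (B c).integral_comp_comm hg.integrableOn, ← integral_indicator hs]
    refine integral_congr_ae (Eventually.of_forall fun x => ?_)
    by_cases hx : x ∈ s <;> simp [hx]
  · intro f f' _ hf hf' h h'
    rw [VectorMeasure.integral_add hf hf', h, h', ← integral_add (hI f hf) (hI f' hf')]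
    simp
  · have hlip : LipschitzWith ‖B‖₊ fun f : X →₁[η.variation] E => ∫ x, B (f x) (g x) ∂μ := by
      refine LipschitzWith.of_dist_le_mul fun f f' => ?_
      rw [dist_eq_norm, dist_eq_norm, ← integral_sub (hI _ (L1.integrable_coeFn f))
        (hI _ (L1.integrable_coeFn f')), L1.norm_eq_integral_norm]
      have h1 := hbound (fun x => f x - f' x)
        ((L1.integrable_coeFn f).sub (L1.integrable_coeFn f'))
      simp only [map_sub, _root_.sub_apply] at h1
      refine h1.trans (le_of_eq ?_)
      rw [coe_nnnorm]
      congr 1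
      refine integral_congr_ae ?_
      filter_upwards [Lp.coeFn_sub f f'] with x hx
      rw [hx, Pi.sub_apply]
    exact isClosed_eq VectorMeasure.continuous_integral hlip.continuous
  · intro f f' hff' _ h
    rw [← VectorMeasure.integral_congr_ae hff', h]
    rw [hν] at hff'
    exact integral_congr_ae (bilin_congr_ae hg B hff')

end Density

/-! ### Densities of Hilbert space valued measures -/

section HilbertDensity

variable {X : Type*} [MeasurableSpace X]
  {H : Type*} [NormedAddCommGroup H] [InnerProductSpace ℂ H] [CompleteSpace H]

/-- The pairing is bundled as a real bilinear map, so complex homogeneity needs an argument: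
multiplication by c passes through the pairing and hence through the integral. -/
theorem bartleIntegral_smul {η : VectorMeasure X H} {f : X → H} (hf : η.Integrable f) (c : ℂ) :
    bartleIntegral η (fun x => c • f x) = c * bartleIntegral η f := by
  have h1 := VectorMeasure.integral_continuousLinearMap_comp (B := pairing H)
    (C := (c • ContinuousLinearMap.id ℂ H).restrictScalars ℝ) hf
  have h2 := VectorMeasure.continuousLinearMap_apply_integral (B := pairing H)
    (C := (ContinuousLinearMap.mul ℂ ℂ c).restrictScalars ℝ) hf
  have h3 : (ContinuousLinearMap.compL ℝ H ℂ ℂ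
      ((ContinuousLinearMap.mul ℂ ℂ c).restrictScalars ℝ)) ∘L pairing H =
      pairing H ∘L (c • ContinuousLinearMap.id ℂ H).restrictScalars ℝ := by
    ext u v
    simp [pairing_apply]
  rw [h3, ← h1] at h2
  exact h2.symm

theorem norm_bartleIntegral_le (η : VectorMeasure X H) (f : X → H) :
    ‖bartleIntegral η f‖ ≤ ‖pairing H‖ * ∫ x, ‖f x‖ ∂η.variation :=
  VectorMeasure.norm_integral_le_integral_norm

/-- A vector measure of bounded variation with values in a Hilbert space has a density with respect
to its variation. -/
theorem exists_density (η : VectorMeasure X H) [IsFiniteMeasure η.variation] :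
    ∃ g : X → H, StronglyMeasurable g ∧ Integrable g η.variation ∧
      ∀ A, MeasurableSet A → η A = ∫ x in A, g x ∂η.variation := by
  set ν := η.variation
  have hint : ∀ f : Lp H 2 ν, Integrable f ν := fun f =>
    (Lp.memLp f).integrable (by norm_num)
  -- The Hölder constant of the embedding L² ⊂ L¹ for the finite measure ν. It makes f ↦ ∫⟨f,dη⟩
  -- bounded on L², where the Riesz theorem yields the density.
  let C : ℝ := (ν Set.univ ^ ((1 : ENNReal).toReal⁻¹ - (2 : ENNReal).toReal⁻¹)).toReal
  have hL1 : ∀ f : Lp H 2 ν, ∫ x, ‖f x‖ ∂ν ≤ ‖f‖ * C := by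
    intro f
    have h1 := eLpNorm_le_eLpNorm_mul_rpow_measure_univ (μ := ν) (p := 1) (q := 2) (by norm_num)
      (Lp.aestronglyMeasurable f)
    rw [eLpNorm_one_eq_lintegral_enorm] at h1
    rw [integral_norm_eq_lintegral_enorm (Lp.aestronglyMeasurable f), Lp.norm_def,
      ← ENNReal.toReal_mul]
    simp only [one_div] at h1
    refine ENNReal.toReal_mono ?_ h1
    exact ENNReal.mul_ne_top (Lp.eLpNorm_ne_top f)
      (ENNReal.rpow_ne_top_of_nonneg (by norm_num) (measure_ne_top _ _))
  let Λ : Lp H 2 ν →L[ℂ] ℂ := LinearMap.mkContinuous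
    { toFun := fun f => bartleIntegral η f
      map_add' := fun f f' => by
        rw [bartleIntegral, VectorMeasure.integral_congr_ae (Lp.coeFn_add f f'),
          VectorMeasure.integral_add (hint f) (hint f')]
        rfl
      map_smul' := fun c f => by
        rw [bartleIntegral, VectorMeasure.integral_congr_ae (Lp.coeFn_smul c f)]
        exact bartleIntegral_smul (hint f) c } (‖pairing H‖ * C) fun f => by
    refine (norm_bartleIntegral_le η f).trans ?_
    rw [mul_assoc, mul_comm C]
    gcongr
    exact hL1 f
  let g : Lp H 2 ν := (InnerProductSpace.toDual ℂ (Lp H 2 ν)).symm Λ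
  refine ⟨g, Lp.stronglyMeasurable g, hint g, fun A hA => ext_inner_left ℂ fun v => ?_⟩
  rw [← L2.inner_indicatorConstLp_eq_inner_setIntegral ℂ hA v g (hμs := measure_ne_top _ _),
    ← inner_conj_symm (indicatorConstLp _ _ _ _) g, InnerProductSpace.toDual_symm_apply]
  have : Λ (indicatorConstLp 2 hA (measure_ne_top ν A) v) = inner ℂ (η A) v := by
    change bartleIntegral η _ = _
    have : IsFiniteMeasure (η.variation.restrict A) := inferInstanceAs (IsFiniteMeasure (ν.restrict A))
    rw [bartleIntegral, VectorMeasure.integral_congr_ae indicatorConstLp_coeFn,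
      VectorMeasure.integral_indicator_const _ hA, pairing_apply]
  rw [this, inner_conj_symm]

theorem bartleIntegral_eq {η : VectorMeasure X H} {μ : Measure X} {g : X → H}
    (hg : Integrable g μ) (hη : ∀ A, MeasurableSet A → η A = ∫ x in A, g x ∂μ)
    {f : X → H} (hf : η.Integrable f) : bartleIntegral η f = ∫ x, inner ℂ (g x) (f x) ∂μ :=
  integral_eq_of_density hg hη (pairing H) hf

end HilbertDensity

/-! ### The energy as a squared norm, and functionals on jets -/

section Energy

open ContinuousLinearMap (adjoint)

variable {m : ℕ} {U : Opens (EuclideanSpace ℝ (Fin m))}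
  {H : Type u} [NormedAddCommGroup H] [InnerProductSpace ℂ H] [CompleteSpace H]

theorem integrable_of_continuous_of_bound {V : Type*} [NormedAddCommGroup V] {μ : Measure U}
    [IsFiniteMeasure μ] {f : U → V} (hf : Continuous f) {C : ℝ} (hC : ∀ x, ‖f x‖ ≤ C) :
    Integrable f μ :=
  Integrable.of_bound hf.stronglyMeasurable.aestronglyMeasurable C (Eventually.of_forall hC)

theorem IsWeakBochnerIntegral.unique {X : Type*} [MeasurableSpace X] {η : VectorMeasure X H}
    {T : X → H →L[ℂ] H} {u : H} (h : IsWeakBochnerIntegral η T u) :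
    weakBochnerIntegral η T = u := by
  have h1 : ∃ u, IsWeakBochnerIntegral η T u := ⟨u, h⟩
  rw [weakBochnerIntegral, dif_pos h1]
  exact ext_inner_right ℂ fun v => (h1.choose_spec.2 v).trans (h.2 v).symm

/-- The energy of a family of measures vanishes if and only if the associated functional vanishes on
the reproducing kernel Hilbert space. -/
theorem energy_eq_zero_iff {q : ℕ} {K : U → U → H →L[ℂ] H} (hK : IsPosDef K) (hq : IsCqq q K)
    (hb : ∀ α ∈ multiIndices m q, ∃ M : ℝ, ∀ x, ‖mixedDeriv α α K x x‖ ≤ M)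
    {η : (Fin m → ℕ) → VectorMeasure U H}
    (hη : ∀ α ∈ multiIndices m q, IsFiniteMeasure (η α).variation) :
    energy q K η = 0 ↔ ∀ f ∈ rkhs K,
      ∑ α ∈ multiIndices m q, bartleIntegral (η α) (multiDeriv α f) = 0 := by
  obtain ⟨E, _, _, _, Φ, hj, hΦ, -⟩ := exists_jet_features hK hq
  have hg : ∀ α, ∃ g : U → H, α ∈ multiIndices m q → StronglyMeasurable g ∧
      Integrable g (η α).variation ∧
      ∀ A, MeasurableSet A → η α A = ∫ x in A, g x ∂(η α).variation := by
    intro α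
    by_cases hα : α ∈ multiIndices m q
    · have := hη α hα
      obtain ⟨g, hg⟩ := exists_density (η α)
      exact ⟨g, fun _ => hg⟩
    · exact ⟨0, fun h => absurd h hα⟩
  choose g hg using hg
  have hM : ∀ α ∈ multiIndices m q, ∃ C : ℝ, 0 ≤ C ∧ ∀ x, ‖Φ α x‖ ≤ C := by
    intro α hα
    obtain ⟨M, hM⟩ := hb α hα
    -- ‖Φ_α(x)‖² is the norm of ∂₁^α∂₂^α K(x,x), so the diagonal bound controls the features
    -- uniformly.
    refine ⟨√M, Real.sqrt_nonneg _, fun x => Real.le_sqrt_of_sq_le ?_⟩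
    rw [sq, ← ContinuousLinearMap.norm_adjoint_comp_self, ← hΦ α hα α hα]
    exact hM x
  have hcont : ∀ α ∈ multiIndices m q, Continuous (Φ α) := fun α hα =>
    hj.1 α (mem_multiIndices.1 hα)
  have hint : ∀ α ∈ multiIndices m q, Integrable (fun x => Φ α x (g α x)) (η α).variation := by
    intro α hα
    obtain ⟨C, -, hC⟩ := hM α hα
    refine ((hg α hα).2.1.norm.const_mul C).mono' ?_ (Eventually.of_forall fun x => ?_)
    · exact (continuous_fst.clm_apply continuous_snd).comp_stronglyMeasurable
        ((hcont α hα).stronglyMeasurable.prodMk (hg α hα).1) |>.aestronglyMeasurable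
    · exact (Φ α x).le_of_opNorm_le (hC x) _
  have hadj : ∀ α ∈ multiIndices m q, ∀ u : E,
      Continuous (fun x => adjoint (Φ α x) u) ∧ (η α).Integrable (fun x => adjoint (Φ α x) u) := by
    intro α hα u
    have := hη α hα
    obtain ⟨C, hC0, hC⟩ := hM α hα
    have hc : Continuous (fun x => adjoint (Φ α x) u) :=
      (adjointApply H u).continuous.comp (hcont α hα)
    refine ⟨hc, integrable_of_continuous_of_bound hc (C := C * ‖u‖) fun x => ?_⟩
    refine ((adjoint (Φ α x)).le_opNorm u).trans ?_
    rw [LinearIsometryEquiv.norm_map]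
    gcongr
    exact hC x
  -- `Z α` represents u ↦ ∫⟨Φ_α(x)*u, dη_α(x)⟩. The inner integral of the energy is then `Φ β y* (Z
  -- α)`, and the energy is ‖∑ Z_α‖².
  let Z : (Fin m → ℕ) → E := fun α => ∫ x, Φ α x (g α x) ∂(η α).variation
  have hZ : ∀ α ∈ multiIndices m q, ∀ u : E,
      bartleIntegral (η α) (fun x => adjoint (Φ α x) u) = inner ℂ (Z α) u := by
    intro α hα u
    rw [bartleIntegral_eq (hg α hα).2.1 (hg α hα).2.2 (hadj α hα u).2,
      ← inner_conj_symm, ← integral_inner (hint α hα), ← integral_conj]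
    refine integral_congr_ae (Eventually.of_forall fun x => ?_)
    simp only [ContinuousLinearMap.adjoint_inner_right, inner_conj_symm]
  have hw : ∀ α ∈ multiIndices m q, ∀ β ∈ multiIndices m q, ∀ y,
      weakBochnerIntegral (η α) (fun x => mixedDeriv α β K x y) = adjoint (Φ β y) (Z α) := by
    intro α hα β hβ y
    refine IsWeakBochnerIntegral.unique ⟨fun v => ?_, fun v => ?_⟩
    · simp only [hΦ α hα β hβ]
      exact (hadj α hα _).2
    · simp only [hΦ α hα β hβ, ContinuousLinearMap.comp_apply]
      rw [hZ α hα, ContinuousLinearMap.adjoint_inner_left]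
  have hE : energy q K η =
      inner ℂ (∑ α ∈ multiIndices m q, Z α) (∑ α ∈ multiIndices m q, Z α) := by
    rw [energy, inner_sum]
    refine Finset.sum_congr rfl fun α hα => ?_
    rw [sum_inner]
    refine Finset.sum_congr rfl fun β hβ => ?_
    simp only [hw α hα β hβ]
    exact hZ β hβ _
  have hu : ∀ u : E, ∑ α ∈ multiIndices m q,
      bartleIntegral (η α) (multiDeriv α fun x => adjoint (Φ 0 x) u) =
      inner ℂ (∑ α ∈ multiIndices m q, Z α) u := by
    intro u
    rw [sum_inner]
    refine Finset.sum_congr rfl fun α hα => ?_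
    rw [multiDeriv_adjoint hj hα, hZ α hα]
  rw [hE, inner_self_eq_zero]
  constructor
  · intro h f hf
    obtain ⟨u, rfl⟩ := (mem_rkhs_iff_of_jet hΦ).1 hf
    rw [hu, h, inner_zero_left]
  · intro h
    -- Testing the functional on the function generated by u = ∑ Z_α itself.
    rw [← inner_self_eq_zero (𝕜 := ℂ), ← hu]
    exact h _ ((mem_rkhs_iff_of_jet hΦ).2 ⟨_, rfl⟩)

open scoped BoundedContinuousFunction

/-- The index set of the derivatives of order at most `q` at the points of `A`. -/
abbrev JetIndex (q : ℕ) (A : Set U) : Type := {α : Fin m → ℕ // α ∈ multiIndices m q} × A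

/-- `F` is the family of the derivatives of `f` at the points of `A`. -/
def IsJetOf {q : ℕ} {A : Set U} {V : Type*} [NormedAddCommGroup V] [NormedSpace ℝ V]
    (F : JetIndex q A →ᵇ V) (f : U → V) : Prop :=
  ∀ d, F d = multiDeriv d.1.1 f d.2.1

theorem exists_isJetOf {q : ℕ} {A : Set U} {V : Type*} [NormedAddCommGroup V] [NormedSpace ℝ V]
    {f : U → V} (hf : IsCq q f) {C : ℝ}
    (hC : ∀ α ∈ multiIndices m q, ∀ x ∈ A, ‖multiDeriv α f x‖ ≤ C) :
    ∃ F : JetIndex q A →ᵇ V, IsJetOf F f := by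
  refine ⟨BoundedContinuousFunction.ofNormedAddCommGroup
    (fun d : JetIndex q A => multiDeriv d.1.1 f d.2.1) ?_ C fun d => hC _ d.1.2 _ d.2.2, fun d => rfl⟩
  rw [continuous_prod_of_discrete_left]
  exact fun α => (hf.continuous_multiDeriv α.2).comp continuous_subtype_val

/-- A continuous functional on jets which vanishes on a dense set of kernel sections vanishes on the whole
reproducing kernel Hilbert space. -/
theorem jet_functional_eq_zero {q : ℕ} {K : U → U → H →L[ℂ] H} (hK : IsPosDef K) (hq : IsCqq q K)
    {A : Set U} {M : ℝ} (hM : ∀ α ∈ multiIndices m q, ∀ x ∈ A, ‖mixedDeriv α α K x x‖ ≤ M)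
    (L : (JetIndex q A →ᵇ H) →L[ℂ] ℂ)
    {D : Set U} (hD : Dense D)
    (hsec : ∀ y ∈ D, ∀ v, ∀ F : JetIndex q A →ᵇ H, IsJetOf F (fun x => K x y v) → L F = 0)
    {f : U → H} (hf : f ∈ rkhs K) {F : JetIndex q A →ᵇ H} (hF : IsJetOf F f) : L F = 0 := by
  obtain ⟨E, _, _, _, Φ, hj, hΦ, hsep⟩ := exists_jet_features hK hq
  have hmem : ∀ u : E, (fun x => adjoint (Φ 0 x) u) ∈ rkhs K := fun u =>
    (mem_rkhs_iff_of_jet hΦ).2 ⟨u, rfl⟩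
  have hbound : ∀ u : E, ∀ α ∈ multiIndices m q, ∀ x ∈ A,
      ‖multiDeriv α (fun x => adjoint (Φ 0 x) u) x‖ ≤ √M * ‖u‖ := by
    intro u α hα x hx
    rw [multiDeriv_adjoint hj hα]
    refine ((adjoint (Φ α x)).le_opNorm u).trans ?_
    rw [LinearIsometryEquiv.norm_map]
    gcongr
    refine Real.le_sqrt_of_sq_le ?_
    rw [sq, ← ContinuousLinearMap.norm_adjoint_comp_self, ← hΦ α hα α hα]
    exact hM α hα x hx
  choose T hT using fun u : E => exists_isJetOf (isCq_of_mem_rkhs hK hq (hmem u)) (hbound u)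
  have hT' : ∀ u d, T u d = adjoint (Φ d.1.1 d.2.1) u := fun u d => by
    rw [hT u d, multiDeriv_adjoint hj d.1.2]
  let ℓ : E →L[ℂ] ℂ := L ∘L LinearMap.mkContinuous
    { toFun := T
      map_add' := fun u v => by ext d; simp [hT']
      map_smul' := fun c u => by ext d; simp [hT'] } (√M) fun u => by
    refine (BoundedContinuousFunction.norm_le (by positivity)).2 fun d => ?_
    rw [LinearMap.coe_mk, AddHom.coe_mk, hT u d]
    exact hbound u _ d.1.2 _ d.2.2
  have hℓ : ∀ u, ℓ u = L (T u) := fun u => rfl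
  set Z := (InnerProductSpace.toDual ℂ E).symm ℓ with hZdef
  -- `Z` represents u ↦ L(jet of Φ_0(·)*u). Vanishing on the sections at y ∈ D means `Φ 0 y* Z = 0`;
  -- continuity in y extends this to U, and the features separate.
  have hZ : Z = 0 := by
    refine hsep Z (congrFun (Continuous.ext_on hD (g := fun _ => 0)
      ((adjointApply H Z).continuous.comp (hj.1 0 (by simp))) continuous_const
      fun y hy => ext_inner_right ℂ fun v => ?_))
    change inner ℂ (adjoint (Φ 0 y) Z) v = _
    rw [ContinuousLinearMap.adjoint_inner_left, InnerProductSpace.toDual_symm_apply, inner_zero_left,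
      hℓ]
    refine hsec y hy v _ ?_
    have h0 := zero_mem_multiIndices m q
    simp only [← mixedDeriv_zero K, hΦ 0 h0 0 h0]
    exact hT _
  obtain ⟨u, rfl⟩ := (mem_rkhs_iff_of_jet hΦ).1 hf
  have hFT : F = T u := by
    ext d
    rw [hF d, hT u d]
  rw [hFT, ← hℓ, ← InnerProductSpace.toDual_symm_apply, ← hZdef, hZ, inner_zero_left]

end Energy

/-! ### Sums and Schur products of positive definite kernels -/

section PositiveKernels

open ContinuousLinearMap (adjoint)

variable {X : Type v} {H : Type u} [NormedAddCommGroup H] [InnerProductSpace ℂ H] [CompleteSpace H]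

/-- The pair (Φ₁, Φ₂) in the Hilbert sum is a feature map of K₁ + K₂, and the vectors (u, 0)
generate the functions of the first space. -/
theorem rkhs_subset_add {K₁ K₂ : X → X → H →L[ℂ] H} (h₁ : IsPosDef K₁) (h₂ : IsPosDef K₂) :
    rkhs K₁ ⊆ rkhs fun x y => K₁ x y + K₂ x y := by
  obtain ⟨E₁, _, _, _, Φ₁, hΦ₁, -⟩ := h₁.exists_features
  obtain ⟨E₂, _, _, _, Φ₂, hΦ₂, -⟩ := h₂.exists_features
  let Φ : X → H →L[ℂ] WithLp 2 (E₁ × E₂) := fun x =>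
    (WithLp.prodContinuousLinearEquiv 2 ℂ E₁ E₂).symm.toContinuousLinearMap ∘L (Φ₁ x).prod (Φ₂ x)
  have hΦ : ∀ x y, K₁ x y + K₂ x y = adjoint (Φ x) ∘L Φ y := by
    intro x y
    refine ContinuousLinearMap.ext fun v => ext_inner_left ℂ fun w => ?_
    rw [ContinuousLinearMap.comp_apply, ContinuousLinearMap.adjoint_inner_right, _root_.add_apply,
      inner_add_right, hΦ₁, hΦ₂, WithLp.prod_inner_apply]
    simp [Φ, ContinuousLinearMap.adjoint_inner_right]
  intro f hf
  obtain ⟨u, hu⟩ := (mem_rkhs_iff hΦ₁).1 hf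
  refine (mem_rkhs_iff hΦ).2 ⟨WithLp.toLp 2 (u, 0), fun x => ext_inner_left ℂ fun w => ?_⟩
  rw [hu, ContinuousLinearMap.adjoint_inner_right, ContinuousLinearMap.adjoint_inner_right,
    WithLp.prod_inner_apply]
  simp [Φ]

open scoped ComplexOrder in
open Matrix in
/-- The product of a scalar positive definite kernel and a positive operator is positive definite. -/
theorem isPosDef_smul_of_isPositive {k : X → X → ℂ} (hk : IsPosDef (scalarKernel k))
    {T : H →L[ℂ] H} (hT : T.IsPositive) : IsPosDef fun x y => k x y • T := by
  obtain ⟨E, _, _, _, Φ, hΦ, -⟩ := hk.exists_features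
  obtain ⟨S, hS⟩ := CStarAlgebra.nonneg_iff_eq_star_mul_self.1
    ((ContinuousLinearMap.nonneg_iff_isPositive T).2 hT)
  have hk' : ∀ x y, k x y = inner ℂ (Φ x 1) (Φ y 1) := by
    intro x y
    rw [← ContinuousLinearMap.adjoint_inner_right, ← ContinuousLinearMap.comp_apply, ← hΦ]
    simp [scalarKernel]
  have hT' : ∀ a b, inner ℂ a (T b) = inner ℂ (S a) (S b) := by
    intro a b
    rw [hS, ContinuousLinearMap.star_eq_adjoint, mul_apply_eq_comp,
      ContinuousLinearMap.adjoint_inner_right]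
  rw [isPosDef_iff]
  intro v
  -- The quadratic form is the entry sum of the Hadamard product of two Gram matrices, one from the
  -- features of k and one from T = S*S.
  have h := ((posSemidef_gram ℂ fun x : v.support => Φ x 1).hadamard
    (posSemidef_gram ℂ fun x : v.support => S (v x))).dotProduct_mulVec_nonneg 1
  refine h.trans_eq ?_
  simp only [Finsupp.sum, ← Finset.sum_coe_sort v.support]
  simp only [dotProduct, mulVec, Pi.star_apply, Pi.one_apply, star_one, one_mul, mul_one,
    hadamard_apply, gram_apply]
  refine Finset.sum_congr rfl fun x _ => Finset.sum_congr rfl fun y _ => ?_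
  rw [_root_.smul_apply, inner_smul_right, hk', hT']

end PositiveKernels

/-! ### The kernel given by an operator valued density -/

section DensityKernel

variable {m : ℕ} {U : Opens (EuclideanSpace ℝ (Fin m))}
  {Ω : Type*} [TopologicalSpace Ω] [MeasurableSpace Ω] [BorelSpace Ω]
  {H : Type u} [NormedAddCommGroup H] [InnerProductSpace ℂ H] [CompleteSpace H]

/-- The kernel `∫ p_w(x, y) G(w) dν(w)`. -/
noncomputable def densityKernel (p : Ω → U → U → ℂ) (G : Ω → H →L[ℂ] H) (ν : Measure Ω) :
    U → U → H →L[ℂ] H :=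
  fun x y => ∫ w, p w x y • G w ∂ν

/-- The assumptions under which `densityKernel p G ν` is a positive definite kernel of class
`C^{q,q}`. -/
structure IsAdmissible (q : ℕ) (p : Ω → U → U → ℂ) (b : Ω → ℝ) (G : Ω → H →L[ℂ] H)
    (ν : Measure Ω) : Prop where
  cont : IsCzqq q p
  posDef : ∀ w, IsPosDef (scalarKernel (p w))
  bound : ∀ α ∈ multiIndices m q, ∀ β ∈ multiIndices m q, ∀ w x y, ‖mixedDeriv α β (p w) x y‖ ≤ b w
  meas : AEStronglyMeasurable G ν
  pos : ∀ᵐ w ∂ν, (G w).IsPositive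
  int : Integrable (fun w => b w * ‖G w‖) ν

variable {q : ℕ} {p : Ω → U → U → ℂ} {b : Ω → ℝ} {G : Ω → H →L[ℂ] H} {ν : Measure Ω}

theorem IsAdmissible.restrict (h : IsAdmissible q p b G ν) (B : Set Ω) :
    IsAdmissible q p b G (ν.restrict B) :=
  ⟨h.cont, h.posDef, h.bound, h.meas.restrict, ae_restrict_of_ae h.pos, h.int.restrict⟩

theorem continuous_mixedDeriv_param {Ω : Type*} [TopologicalSpace Ω] {p : Ω → U → U → ℂ}
    (h : IsCzqq q p) {α β : Fin m → ℕ} (hα : α ∈ multiIndices m q) (hβ : β ∈ multiIndices m q)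
    (x y : U) : Continuous fun w => mixedDeriv α β (p w) x y :=
  (h.2 α hα β hβ).comp (Continuous.prodMk_left (x, y))

theorem IsAdmissible.aestronglyMeasurable (h : IsAdmissible q p b G ν) {α β : Fin m → ℕ}
    (hα : α ∈ multiIndices m q) (hβ : β ∈ multiIndices m q) (x y : U) :
    AEStronglyMeasurable (fun w => mixedDeriv α β (p w) x y • G w) ν :=
  (continuous_mixedDeriv_param h.cont hα hβ x y).measurable.stronglyMeasurable.aestronglyMeasurable.smul
    h.meas

theorem IsAdmissible.norm_le (h : IsAdmissible q p b G ν) {α β : Fin m → ℕ}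
    (hα : α ∈ multiIndices m q) (hβ : β ∈ multiIndices m q) (w : Ω) (x y : U) :
    ‖mixedDeriv α β (p w) x y • G w‖ ≤ b w * ‖G w‖ := by
  rw [norm_smul]
  gcongr
  exact h.bound α hα β hβ w x y

theorem IsAdmissible.integrable (h : IsAdmissible q p b G ν) {α β : Fin m → ℕ}
    (hα : α ∈ multiIndices m q) (hβ : β ∈ multiIndices m q) (x y : U) :
    Integrable (fun w => mixedDeriv α β (p w) x y • G w) ν :=
  h.int.mono' (h.aestronglyMeasurable hα hβ x y) (Eventually.of_forall fun w => h.norm_le hα hβ w x y)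

/-- The derivatives of the kernel `∫ p_w G(w) dν(w)`. -/
theorem IsAdmissible.isCqq (h : IsAdmissible q p b G ν) :
    IsCqq q (densityKernel p G ν) ∧ ∀ α ∈ multiIndices m q, ∀ β ∈ multiIndices m q, ∀ x y,
      mixedDeriv α β (densityKernel p G ν) x y = ∫ w, mixedDeriv α β (p w) x y • G w ∂ν := by
  have h0 := zero_mem_multiIndices m q
  let S : Ω → ℂ →L[ℝ] H →L[ℂ] H := fun w =>
    (ContinuousLinearMap.toSpanSingleton ℂ (G w)).restrictScalars ℝ
  have := isCqq_of_jets (q := q) (J := fun α β x y => ∫ w, mixedDeriv α β (p w) x y • G w ∂ν)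
    (fun x => isJet_integral (J := fun w β y => mixedDeriv 0 β (p w) x y • G w)
      (fun w => ((h.cont.1 w).isJet_right h0 x).comp_clm (S w))
      (fun β hβ y => h.aestronglyMeasurable h0 (mem_multiIndices.2 hβ) x y)
      (fun β hβ w y => h.norm_le h0 (mem_multiIndices.2 hβ) w x y) h.int)
    (fun β hβ y => isJet_integral (J := fun w α x => mixedDeriv α β (p w) x y • G w)
      (fun w => ((h.cont.1 w).isJet_left hβ y).comp_clm (S w))
      (fun α hα x => h.aestronglyMeasurable (mem_multiIndices.2 hα) hβ x y)
      (fun α hα w x => h.norm_le (mem_multiIndices.2 hα) hβ w x y) h.int)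
    (fun α hα β hβ => continuous_of_dominated
      (fun z => h.aestronglyMeasurable hα hβ z.1 z.2)
      (fun z => Eventually.of_forall fun w => h.norm_le hα hβ w z.1 z.2) h.int
      (Eventually.of_forall fun w => ((h.cont.1 w).2.2 α hα β hβ).smul continuous_const))
  simpa only [mixedDeriv_zero] using! this

open scoped ComplexOrder in
theorem IsAdmissible.isPosDef (h : IsAdmissible q p b G ν) : IsPosDef (densityKernel p G ν) := by
  have h0 := zero_mem_multiIndices m q
  have hint : ∀ x y, Integrable (fun w => p w x y • G w) ν := fun x y => by
    simpa only [mixedDeriv_zero] using h.integrable h0 h0 x y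
  have hint' : ∀ x y (a b : H), Integrable (fun w => inner ℂ a ((p w x y • G w) b)) ν :=
    fun x y a b => ((innerSL ℂ a).comp (ContinuousLinearMap.apply ℂ H b)).integrable_comp (hint x y)
  rw [isPosDef_iff]
  intro v
  have h1 : (v.sum fun x a => v.sum fun y b => inner ℂ a (densityKernel p G ν x y b)) =
      ∫ w, v.sum fun x a => v.sum fun y b => inner ℂ a ((p w x y • G w) b) ∂ν := by
    simp only [Finsupp.sum]
    rw [integral_finsetSum _ fun x _ => integrable_finsetSum _ fun y _ => hint' _ _ _ _]
    refine Finset.sum_congr rfl fun x _ => ?_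
    rw [integral_finsetSum _ fun y _ => hint' _ _ _ _]
    refine Finset.sum_congr rfl fun y _ => ?_
    exact (((innerSL ℂ (v x)).comp (ContinuousLinearMap.apply ℂ H (v y))).integral_comp_comm
      (hint x y)).symm
  rw [h1]
  refine integral_nonneg_of_ae ?_
  filter_upwards [h.pos] with w hw
  exact (isPosDef_iff _).1 (isPosDef_smul_of_isPositive (h.posDef w) hw) v

/-- The kernel splits into its integrals over B and Bᶜ, both positive definite. This is what lets a
functional vanishing on H_P be tested on arbitrary Borel subsets of Ω. -/
theorem IsAdmissible.rkhs_restrict_subset (h : IsAdmissible q p b G ν) {B : Set Ω}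
    (hB : MeasurableSet B) :
    rkhs (densityKernel p G (ν.restrict B)) ⊆ rkhs (densityKernel p G ν) := by
  have h0 := zero_mem_multiIndices m q
  have : densityKernel p G ν = fun x y => densityKernel p G (ν.restrict B) x y +
      densityKernel p G (ν.restrict Bᶜ) x y := by
    funext x y
    refine (integral_add_compl hB ?_).symm
    simpa only [mixedDeriv_zero] using h.integrable h0 h0 x y
  rw [this]
  exact rkhs_subset_add (h.restrict B).isPosDef (h.restrict Bᶜ).isPosDef

end DensityKernel

open scoped BoundedContinuousFunction

/-! ### Reduction of vector valued functions to elementary tensors -/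

section Tensor

variable {D : Type*} [TopologicalSpace D] {H : Type u} [NormedAddCommGroup H]
  [InnerProductSpace ℂ H]

variable (D H) in
/-- The bounded continuous function `d ↦ φ(d) v`. -/
noncomputable def tensor : (D →ᵇ ℂ) →L[ℂ] H →L[ℂ] (D →ᵇ H) :=
  LinearMap.mkContinuous₂
    (LinearMap.mk₂ ℂ (fun (φ : D →ᵇ ℂ) (v : H) => BoundedContinuousFunction.ofNormedAddCommGroup
        (fun d => φ d • v) (φ.continuous.smul continuous_const) (‖φ‖ * ‖v‖) fun d => by
          rw [norm_smul]; gcongr; exact φ.norm_coe_le_norm d)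
      (fun φ ψ v => by ext d; simp [add_smul])
      (fun c φ v => by ext d; simp [mul_smul])
      (fun φ v w => by ext d; simp)
      (fun c φ v => by ext d; exact smul_comm (φ d) c v))
    1 fun φ v => by
      rw [one_mul]
      refine (BoundedContinuousFunction.norm_le (by positivity)).2 fun d => ?_
      change ‖φ d • v‖ ≤ _
      rw [norm_smul]
      gcongr
      exact φ.norm_coe_le_norm d

@[simp]
theorem tensor_apply (φ : D →ᵇ ℂ) (v : H) (d : D) : tensor D H φ v d = φ d • v := rfl

/-- A continuous functional vanishes at a function with totally bounded range if it vanishes on the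
tensors of its coefficients. -/
theorem functional_eq_zero_of_totallyBounded (L : (D →ᵇ H) →L[ℂ] ℂ) {F : D →ᵇ H}
    (hF : TotallyBounded (Set.range F))
    (h : ∀ e v, ∀ φ : D →ᵇ ℂ, (∀ d, φ d = inner ℂ e (F d)) → L (tensor D H φ v) = 0) :
    L F = 0 := by
  have hφ : ∀ e : H, ∃ φ : D →ᵇ ℂ, ∀ d, φ d = inner ℂ e (F d) := fun e =>
    ⟨(innerSL ℂ e).compLeftContinuousBounded D F, fun d => rfl⟩
  choose φ hφ using hφ
  refine norm_le_zero_iff.1 (le_of_forall_pos_le_add fun ε hε => ?_)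
  rw [zero_add]
  obtain ⟨δ, hδ, hδε⟩ : ∃ δ > 0, ‖L‖ * δ ≤ ε := by
    refine ⟨ε / (‖L‖ + 1), by positivity, ?_⟩
    rw [mul_div_assoc', div_le_iff₀ (by positivity)]
    nlinarith [norm_nonneg L]
  obtain ⟨t, ht, hcov⟩ := Metric.totallyBounded_iff.1 hF δ hδ
  -- A finite δ-net of the range spans a finite dimensional space. Orthogonal projection onto it
  -- moves F by at most δ, and the projected function S is a finite sum of tensors, on which L
  -- vanishes.
  have : FiniteDimensional ℂ (Submodule.span ℂ t) := FiniteDimensional.span_of_finite ℂ ht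
  let e := stdOrthonormalBasis ℂ (Submodule.span ℂ t)
  let S : D →ᵇ H := ∑ k, tensor D H (φ (e k)) (e k)
  have hS : ∀ d, S d = (Submodule.span ℂ t).starProjection (F d) := by
    intro d
    rw [e.starProjection_eq_sum_rankOne]
    simp [S, hφ]
  have hLS : L S = 0 := by
    rw [map_sum]
    exact Finset.sum_eq_zero fun k _ => h (e k) _ _ (hφ _)
  have hFS : ‖F - S‖ ≤ δ := by
    refine (BoundedContinuousFunction.norm_le hδ.le).2 fun d => ?_
    obtain ⟨a, ha, had⟩ := Set.mem_iUnion₂.1 (hcov ⟨d, rfl⟩)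
    rw [BoundedContinuousFunction.sub_apply, hS, Submodule.starProjection_minimal]
    refine (ciInf_le ⟨0, Set.forall_mem_range.2 fun _ => norm_nonneg _⟩
      (⟨a, Submodule.subset_span ha⟩ : Submodule.span ℂ t)).trans ?_
    rw [← dist_eq_norm]
    exact (Metric.mem_ball.1 had).le
  calc ‖L F‖ = ‖L (F - S)‖ := by rw [map_sub, hLS, sub_zero]
    _ ≤ ‖L‖ * ‖F - S‖ := L.le_opNorm _
    _ ≤ ‖L‖ * δ := by gcongr
    _ ≤ ε := hδε

end Tensor

/-! ### The duality argument -/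

section Core

variable {m : ℕ} {U : Opens (EuclideanSpace ℝ (Fin m))}
  {Ω : Type*} [TopologicalSpace Ω] [MeasurableSpace Ω] [BorelSpace Ω]
  {H : Type u} [NormedAddCommGroup H] [InnerProductSpace ℂ H] [CompleteSpace H]
  {q : ℕ} {p : Ω → U → U → ℂ} {b : Ω → ℝ} {G : Ω → H →L[ℂ] H} {ν : Measure Ω}

theorem IsAdmissible.exists_jet (h : IsAdmissible q p b G ν) (A : Set U) (w : Ω) (y : U) :
    ∃ J : JetIndex q A →ᵇ ℂ, ∀ d, J d = mixedDeriv d.1.1 0 (p w) d.2.1 y := by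
  have h0 := zero_mem_multiIndices m q
  obtain ⟨J, hJ⟩ := exists_isJetOf (A := A) (((h.cont.1 w).isJet_left h0 y).isCq) (C := b w)
    fun α hα x _ => by
      rw [((h.cont.1 w).isJet_left h0 y).multiDeriv_eq (mem_multiIndices.1 hα)]
      exact h.bound α hα 0 h0 w x y
  exact ⟨J, fun d => by
    rw [hJ, ((h.cont.1 w).isJet_left h0 y).multiDeriv_eq (mem_multiIndices.1 d.1.2)]⟩

/-- The functional `L` commutes with the integrals of the sections `p_w(·, y) G(w) v`. -/
def CommutesWithIntegral {q : ℕ} {A : Set U} (L : (JetIndex q A →ᵇ H) →L[ℂ] ℂ) (p : Ω → U → U → ℂ)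
    (G : Ω → H →L[ℂ] H) (ν : Measure Ω) : Prop :=
  ∀ y v, ∀ J : Ω → JetIndex q A →ᵇ ℂ, (∀ w d, J w d = mixedDeriv d.1.1 0 (p w) d.2.1 y) →
    Integrable (fun w => L (tensor _ H (J w) (G w v))) ν ∧
    ∀ B, MeasurableSet B → ∀ F : JetIndex q A →ᵇ H,
      (∀ d, F d = ∫ w in B, mixedDeriv d.1.1 0 (p w) d.2.1 y • G w v ∂ν) →
      L F = ∫ w in B, L (tensor _ H (J w) (G w v)) ∂ν

variable [SeparableSpace H] {A : Set U} {L : (JetIndex q A →ᵇ H) →L[ℂ] ℂ}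

/-- A functional which vanishes on the reproducing kernel Hilbert space of `∫ p_w G(w) dν(w)`
vanishes on the spaces of almost all of the kernels `p_w G(w)`. -/
theorem IsAdmissible.ae_functional_eq_zero (h : IsAdmissible q p b G ν)
    (hL : CommutesWithIntegral L p G ν)
    (hvan : ∀ f ∈ rkhs (densityKernel p G ν), ∀ F, IsJetOf F f → L F = 0) :
    ∀ᵐ w ∂ν, ∀ v, ∀ f ∈ rkhs (scalarKernel (p w)), ∀ F, IsJetOf F f →
      L (tensor _ H F (G w v)) = 0 := by
  have h0 := zero_mem_multiIndices m q
  choose J hJ using h.exists_jet A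
  have h1 : ∀ y v, ∀ᵐ w ∂ν, L (tensor _ H (J w y) (G w v)) = 0 := by
    intro y v
    obtain ⟨hint, hswap⟩ := hL y v (fun w => J w y) (fun w => hJ w y)
    -- The integral over B is L applied to the section of the kernel restricted to B, which lies in
    -- H_P.
    refine hint.ae_eq_zero_of_forall_setIntegral_eq_zero fun B hB _ => ?_
    have hB' := h.restrict B
    have hf : (fun x => densityKernel p G (ν.restrict B) x y v) ∈ rkhs (densityKernel p G ν) :=
      h.rkhs_restrict_subset hB (kernel_section_mem_rkhs hB'.isPosDef y v)
    have hder : ∀ α ∈ multiIndices m q, ∀ x,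
        multiDeriv α (fun x => densityKernel p G (ν.restrict B) x y v) x =
          ∫ w in B, mixedDeriv α 0 (p w) x y • G w v ∂ν := by
      intro α hα x
      have e1 := (hB'.isCqq.1.isJet_left h0 y).isCq.multiDeriv_comp_clm
        ((ContinuousLinearMap.apply ℂ H v).restrictScalars ℝ) hα x
      simp only [mixedDeriv_zero, ← mixedDeriv_zero_right] at e1
      refine e1.trans ?_
      rw [hB'.isCqq.2 α hα 0 h0]
      exact ContinuousLinearMap.integral_apply (hB'.integrable hα h0 x y) v
    obtain ⟨F, hF⟩ := exists_isJetOf (A := A) (isCq_of_mem_rkhs h.isPosDef h.isCqq.1 hf)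
      (C := ∫ w in B, b w * ‖G w‖ * ‖v‖ ∂ν) fun α hα x _ => by
        rw [hder α hα]
        refine norm_integral_le_of_norm_le (h.int.mul_const _).restrict
          (Eventually.of_forall fun w => ?_)
        exact (ContinuousLinearMap.le_opNorm (mixedDeriv α 0 (p w) x y • G w) v).trans
          (by gcongr; exact h.norm_le hα h0 w x y)
    rw [← hswap B hB F fun d => by rw [hF d, hder _ d.1.2]]
    exact hvan _ hf F hF
  -- The null sets depend on y and v; countably many of each suffice. Continuity extends the result
  -- from T to all v, and `jet_functional_eq_zero` extends it from the points of S to all of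
  -- H_{p_w}.
  obtain ⟨S, hSc, hS⟩ := exists_countable_dense U
  obtain ⟨T, hTc, hT⟩ := exists_countable_dense H
  have h2 : ∀ᵐ w ∂ν, ∀ y ∈ S, ∀ v ∈ T, L (tensor _ H (J w y) (G w v)) = 0 :=
    (ae_ball_iff hSc).2 fun y _ => (ae_ball_iff hTc).2 fun v _ => h1 y v
  filter_upwards [h2] with w hw v f hf F hF
  have h3 : ∀ y ∈ S, L (tensor _ H (J w y) (G w v)) = 0 := by
    intro y hy
    exact congrFun (Continuous.ext_on hT (g := fun _ => 0)
      ((L ∘L tensor _ H (J w y) ∘L G w).continuous) continuous_const fun v hv => hw y hy v hv) v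
  have hcq := (isCqq_scalarKernel (h.cont.1 w))
  refine jet_functional_eq_zero (h.posDef w) hcq.1 (A := A) (M := b w) (fun α hα x _ => ?_)
    (L ∘L (tensor _ H).flip (G w v)) hS (fun y hy c F hF => ?_) hf hF
  · rw [hcq.2 α hα α hα]
    refine (ContinuousLinearMap.opNorm_mul_apply_le ℂ ℂ _).trans ?_
    exact h.bound α hα α hα w x x
  · have : F = c • J w y := by
      ext d
      have e1 := ((h.cont.1 w).isJet_left h0 y).isCq.multiDeriv_comp_clm
        (((ContinuousLinearMap.mul ℂ ℂ).flip c).restrictScalars ℝ) d.1.2 d.2.1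
      simp only [mixedDeriv_zero, ← mixedDeriv_zero_right] at e1
      rw [hF d, BoundedContinuousFunction.smul_apply, hJ, smul_eq_mul, mul_comm]
      exact e1
    rw [this, map_smul]
    simp [h3 y hy]

/-- Shared by both properties: `𝓕` is the class of scalar functions determined by each p_w, through
`hdet`, and `hG` is the nondegeneracy of Λ. Self-adjointness of G(w) turns ⟨u, G(w)v⟩ = 0 into G(w)u
= 0. -/
theorem IsAdmissible.functional_eq_zero (h : IsAdmissible q p b G ν)
    (hL : CommutesWithIntegral L p G ν)
    (hvan : ∀ f ∈ rkhs (densityKernel p G ν), ∀ F, IsJetOf F f → L F = 0)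
    (hG : ∀ u, (∀ᵐ w ∂ν, G w u = 0) → u = 0) {𝓕 : Set (U → ℂ)}
    (hdet : ∀ w u, (∀ f ∈ rkhs (scalarKernel (p w)), ∀ F, IsJetOf F f → L (tensor _ H F u) = 0) →
      ∀ f ∈ 𝓕, ∀ F, IsJetOf F f → L (tensor _ H F u) = 0)
    {f : U → H} (hf : IsCq q f) (hf' : ∀ e, (fun x => inner ℂ e (f x)) ∈ 𝓕)
    {F : JetIndex q A →ᵇ H} (hF : IsJetOf F f) (hFr : TotallyBounded (Set.range F)) : L F = 0 := by
  refine functional_eq_zero_of_totallyBounded L hFr fun e v φ hφ => ?_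
  have hφ' : IsJetOf φ fun x => inner ℂ e (f x) := fun d => by
    rw [hφ, hF d]
    exact (hf.multiDeriv_comp_clm ((innerSL ℂ e).restrictScalars ℝ) d.1.2 _).symm
  set u := (InnerProductSpace.toDual ℂ H).symm (L ∘L tensor _ H φ) with hu
  have hu' : ∀ v, inner ℂ u v = L (tensor _ H φ v) := fun v =>
    InnerProductSpace.toDual_symm_apply
  have hu0 : u = 0 := by
    refine hG u ?_
    filter_upwards [h.ae_functional_eq_zero hL hvan, h.pos] with w hw hpos
    refine ext_inner_right ℂ fun v => ?_
    rw [show inner ℂ (G w u) v = inner ℂ u (G w v) from hpos.isSymmetric u v, hu', inner_zero_left]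
    exact hdet w _ (hw v) _ (hf' e) _ hφ'
  rw [← hu', hu0, inner_zero_left]

end Core

/-! ### Positive operator valued measures and their densities -/

section OperatorMeasures

variable {Ω : Type*} [MeasurableSpace Ω]
  {H : Type u} [NormedAddCommGroup H] [InnerProductSpace ℂ H]
  {Λ : VectorMeasure Ω (H →L[ℂ] H)} {lam : Measure Ω} {G : Ω → H →L[ℂ] H}

theorem measureProj_apply (Λ : VectorMeasure Ω (H →L[ℂ] H)) (v : H) (A : Set Ω) :
    measureProj Λ v A = inner ℂ v (Λ A v) := rfl

variable [CompleteSpace H]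

theorem inner_setIntegral_apply (hG : Integrable G lam) (v : H) (A : Set Ω) :
    inner ℂ v ((∫ w in A, G w ∂lam) v) = ∫ w in A, inner ℂ v (G w v) ∂lam :=
  (((innerSL ℂ v).comp (ContinuousLinearMap.apply ℂ H v)).integral_comp_comm hG.restrict).symm

theorem integrable_inner_apply (hG : Integrable G lam) (v : H) :
    Integrable (fun w => inner ℂ v (G w v)) lam :=
  ((innerSL ℂ v).comp (ContinuousLinearMap.apply ℂ H v)).integrable_comp hG

theorem measureProj_eq_zero_iff (hG : Integrable G lam)
    (hΛG : ∀ A, MeasurableSet A → Λ A = ∫ w in A, G w ∂lam) (v : H) :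
    measureProj Λ v = 0 ↔ ∀ᵐ w ∂lam, inner ℂ v (G w v) = 0 := by
  constructor
  · intro h
    refine (integrable_inner_apply hG v).ae_eq_zero_of_forall_setIntegral_eq_zero fun A hA _ => ?_
    rw [← inner_setIntegral_apply hG, ← hΛG A hA, ← measureProj_apply, h]
    rfl
  · intro h
    ext A hA
    rw [measureProj_apply, hΛG A hA, inner_setIntegral_apply hG]
    exact integral_eq_zero_of_ae (ae_restrict_of_ae h)

open scoped ComplexOrder in
/-- The density of a measure with positive values is positive almost everywhere. -/
theorem ae_isPositive_of_setIntegral [SeparableSpace H] (hG : Integrable G lam)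
    (h : ∀ A, MeasurableSet A → (∫ w in A, G w ∂lam).IsPositive) :
    ∀ᵐ w ∂lam, (G w).IsPositive := by
  have h1 : ∀ v, ∀ᵐ w ∂lam, 0 ≤ inner ℂ v (G w v) := by
    intro v
    have hint := integrable_inner_apply hG v
    have hpos : ∀ A, MeasurableSet A → 0 ≤ ∫ w in A, inner ℂ v (G w v) ∂lam := fun A hA => by
      rw [← inner_setIntegral_apply hG]
      exact (h A hA).inner_nonneg_right v
    have hre : 0 ≤ᵐ[lam] fun w => (inner ℂ v (G w v)).re :=
      ae_nonneg_of_forall_setIntegral_nonneg hint.re fun A hA _ => by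
        exact (Complex.le_def.1 (hpos A hA)).1.trans_eq (Complex.reCLM.integral_comp_comm
          hint.restrict).symm
    have him : (fun w => (inner ℂ v (G w v)).im) =ᵐ[lam] 0 :=
      hint.im.ae_eq_zero_of_forall_setIntegral_eq_zero fun A hA _ => by
        exact (Complex.imCLM.integral_comp_comm hint.restrict).trans
          (Complex.le_def.1 (hpos A hA)).2.symm
    filter_upwards [hre, him] with w h2 h3
    exact Complex.le_def.2 ⟨h2, h3.symm⟩
  -- Positivity of ⟨G(w)v,v⟩ holds off a null set depending on v; a countable dense set of v makes
  -- it uniform, since nonnegativity is a closed condition.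
  obtain ⟨T, hTc, hT⟩ := exists_countable_dense H
  filter_upwards [(ae_ball_iff hTc).2 fun v _ => h1 v] with w hw
  have h2 : ∀ v, 0 ≤ inner ℂ v (G w v) := fun v =>
    closure_minimal (s := T) (t := {v | 0 ≤ inner ℂ v (G w v)}) hw
      (isClosed_le continuous_const (continuous_id.inner (G w).continuous))
      (hT v)
  refine (ContinuousLinearMap.isPositive_iff_complex _).2 fun v => ?_
  obtain ⟨h3, h4⟩ := Complex.le_def.1 (h2 v)
  rw [← inner_conj_symm]
  refine ⟨Complex.ext rfl ?_, h3⟩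
  change (0 : ℝ) = -(inner ℂ v (G w v)).im
  rw [← h4, Complex.zero_im, neg_zero]

end OperatorMeasures

/-! ### Universality -/

section Universality

open ContinuousLinearMap (adjoint)

variable {m : ℕ} {U : Opens (EuclideanSpace ℝ (Fin m))}
  {H : Type u} [NormedAddCommGroup H] [InnerProductSpace ℂ H] [CompleteSpace H] {q : ℕ}

theorem isCq_const {V : Type*} [NormedAddCommGroup V] [NormedSpace ℝ V] (c : V) :
    IsCq q fun _ : U => c :=
  contDiffOn_const.congr fun x hx => zeroExt_coe (fun _ : U => c) ⟨x, hx⟩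

/-- A scalar g is the projection of g(x) v/‖v‖². Projecting an approximant of the latter costs a
factor ‖v‖ by Cauchy–Schwarz, hence the tolerance ε/‖v‖. -/
theorem IsCqUniversal.kernelProj {K : U → U → H →L[ℂ] H} (hK : IsCqUniversal q K) {v : H}
    (hv : v ≠ 0) : IsCqUniversal q (scalarKernel (kernelProj K v)) := by
  refine ⟨isPosDef_kernelProj hK.1 v, fun f hf => ?_, fun A hA g hg ε hε => ?_⟩
  · obtain ⟨F, hF, rfl⟩ := (mem_rkhs_kernelProj_iff hK.1 v).1 hf
    exact (hK.2.1 F hF).comp_clm ((innerSL ℂ v).restrictScalars ℝ)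
  · have hv' : 0 < ‖v‖ := norm_pos_iff.2 hv
    have hg' : IsCq q fun x => g x • ((inner ℂ v v : ℂ)⁻¹ • v) := hg.comp_clm
      ((ContinuousLinearMap.toSpanSingleton ℂ ((inner ℂ v v : ℂ)⁻¹ • v)).restrictScalars ℝ)
    obtain ⟨F, hF, hFg⟩ := hK.2.2 A hA _ hg' (ε / ‖v‖) (by positivity)
    refine ⟨_, (mem_rkhs_kernelProj_iff hK.1 v).2 ⟨F, hF, rfl⟩, fun x hx => ?_⟩
    have h1 := hFg x hx
    rw [lt_div_iff₀ hv', Finset.sum_mul] at h1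
    refine (Finset.sum_le_sum fun α hα => ?_).trans_lt h1
    have e1 := (hK.2.1 F hF).multiDeriv_comp_clm ((innerSL ℂ v).restrictScalars ℝ) hα x
    have e2 := hg'.multiDeriv_comp_clm ((innerSL ℂ v).restrictScalars ℝ) hα x
    have e3 : (fun x => ((innerSL ℂ v).restrictScalars ℝ) (g x • ((inner ℂ v v : ℂ)⁻¹ • v))) = g := by
      funext x
      have : (inner ℂ v v : ℂ) ≠ 0 := inner_self_ne_zero.2 hv
      simp [-inner_self_eq_norm_sq_to_K, this]
    rw [e3] at e2
    rw [e2]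
    refine (congrArg (fun z => ‖z - _‖) e1).trans_le ?_
    rw [← map_sub, mul_comm]
    exact norm_inner_le_norm _ _

theorem not_isCqUniversal_zero [Nonempty U] : ¬ IsCqUniversal q fun _ _ : U => (0 : ℂ →L[ℂ] ℂ) := by
  intro h
  obtain ⟨x⟩ := ‹Nonempty U›
  obtain ⟨f, hf, hfx⟩ := h.2.2 {x} isCompact_singleton _ (isCq_const 1) 1 one_pos
  obtain ⟨u, hu⟩ := (mem_rkhs_iff (E := ℂ) (Φ := fun _ : U => (0 : ℂ →L[ℂ] ℂ))
    (fun x y => by simp)).1 hf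
  have h1 := (Finset.single_le_sum (fun α _ => norm_nonneg _) (zero_mem_multiIndices m q)).trans_lt
    (hfx x rfl)
  rw [multiDeriv_zero, multiDeriv_zero, hu] at h1
  simp at h1

/-- Approximation by the reproducing kernel Hilbert space by duality. -/
theorem exists_approx_of_functional {K : U → U → H →L[ℂ] H} (hK : IsPosDef K) (hq : IsCqq q K)
    {A : Set U} {g : U → H} {F : JetIndex q A →ᵇ H} (hF : IsJetOf F g)
    (h : ∀ L : (JetIndex q A →ᵇ H) →L[ℂ] ℂ, (∀ f ∈ rkhs K, ∀ F, IsJetOf F f → L F = 0) → L F = 0)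
    {ε : ℝ} (hε : 0 < ε) : ∃ f ∈ rkhs K, ∀ x ∈ A,
      ∑ α ∈ multiIndices m q, ‖multiDeriv α f x - multiDeriv α g x‖ < ε := by
  obtain ⟨E, _, _, _, Φ, hj, hΦ, -⟩ := exists_jet_features hK hq
  let S : Submodule ℂ (JetIndex q A →ᵇ H) :=
    { carrier := {F | ∃ u : E, ∀ d, F d = adjoint (Φ d.1.1 d.2.1) u}
      add_mem' := fun ⟨u, hu⟩ ⟨v, hv⟩ => ⟨u + v, fun d => by simp [hu, hv]⟩
      zero_mem' := ⟨0, fun d => by simp⟩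
      smul_mem' := fun c _ ⟨u, hu⟩ => ⟨c • u, fun d => by simp [hu]⟩ }
  have hFS : F ∈ S.topologicalClosure := by
    by_contra hFS
    have : IsClosed (S.topologicalClosure : Set (JetIndex q A →ᵇ H)) :=
      S.isClosed_topologicalClosure
    -- Hahn–Banach on the quotient by the closure of the jets coming from H_K: functionals there are
    -- exactly those vanishing on H_K.
    refine hFS ((Submodule.Quotient.mk_eq_zero _).1
      (SeparatingDual.eq_zero_of_forall_dual_eq_zero (R := ℂ) fun L => ?_))
    refine h (L ∘L S.topologicalClosure.mkQL) fun f hf F' hF' => ?_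
    obtain ⟨u, rfl⟩ := (mem_rkhs_iff_of_jet hΦ).1 hf
    have : F' ∈ S.topologicalClosure := S.le_topologicalClosure
      ⟨u, fun d => by rw [hF' d, multiDeriv_adjoint hj d.1.2]⟩
    have e : S.topologicalClosure.mkQL F' = 0 := (Submodule.Quotient.mk_eq_zero _).2 this
    rw [ContinuousLinearMap.comp_apply, e, map_zero]
  have hN : (0 : ℝ) < (multiIndices m q).card := by
    exact_mod_cast Finset.card_pos.2 ⟨_, zero_mem_multiIndices m q⟩
  obtain ⟨F', ⟨u, hu⟩, hd⟩ := Metric.mem_closure_iff.1 hFS (ε / (multiIndices m q).card)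
    (by positivity)
  refine ⟨_, (mem_rkhs_iff_of_jet hΦ).2 ⟨u, rfl⟩, fun x hx => ?_⟩
  refine (Finset.sum_lt_sum_of_nonempty ⟨_, zero_mem_multiIndices m q⟩
    (g := fun _ => ε / (multiIndices m q).card) fun α hα => ?_).trans_eq ?_
  · rw [multiDeriv_adjoint hj hα]
    have h1 := (BoundedContinuousFunction.dist_coe_le_dist (f := F) (g := F')
      (⟨α, hα⟩, ⟨x, hx⟩)).trans_lt hd
    rwa [hu, hF, dist_comm, dist_eq_norm] at h1
  · rw [Finset.sum_const, nsmul_eq_mul, mul_div_cancel₀ _ hN.ne']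

variable {Ω : Type*} [TopologicalSpace Ω] [MeasurableSpace Ω] [BorelSpace Ω]
  {p : Ω → U → U → ℂ} {b : Ω → ℝ} {G : Ω → H →L[ℂ] H} {ν : Measure Ω}

theorem exists_isJetOf_of_isCompact {A : Set U} (hA : IsCompact A) {V : Type*}
    [NormedAddCommGroup V] [NormedSpace ℝ V] {f : U → V} (hf : IsCq q f) :
    ∃ F : JetIndex q A →ᵇ V, IsJetOf F f := by
  have : ∀ α, ∃ C : ℝ, α ∈ multiIndices m q → ∀ x ∈ A, ‖multiDeriv α f x‖ ≤ C := by
    intro α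
    by_cases hα : α ∈ multiIndices m q
    · obtain ⟨C, hC⟩ := hA.exists_bound_of_continuousOn (hf.continuous_multiDeriv hα).continuousOn
      exact ⟨C, fun _ => hC⟩
    · exact ⟨0, fun h => absurd h hα⟩
  choose C hC using this
  exact exists_isJetOf hf (C := ∑ α ∈ multiIndices m q, |C α|) fun α hα x hx =>
    (hC α hα x hx).trans ((le_abs_self _).trans
      (Finset.single_le_sum (fun α _ => abs_nonneg (C α)) hα))

theorem IsAdmissible.bound_nonneg [Nonempty U] (h : IsAdmissible q p b G ν) (w : Ω) : 0 ≤ b w := by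
  obtain ⟨x⟩ := ‹Nonempty U›
  have h0 := zero_mem_multiIndices m q
  exact (norm_nonneg _).trans (h.bound 0 h0 0 h0 w x x)

/-- Over a compact A, joint continuity of the derivatives makes w ↦ J w continuous in the sup norm.
The sections are then Bochner integrable, and any continuous functional passes through the integral.
-/
theorem IsAdmissible.commutesWithIntegral_of_isCompact [Nonempty U] (h : IsAdmissible q p b G ν)
    {A : Set U} (hA : IsCompact A) (L : (JetIndex q A →ᵇ H) →L[ℂ] ℂ) :
    CommutesWithIntegral L p G ν := by
  have h0 := zero_mem_multiIndices m q
  have : CompactSpace A := isCompact_iff_compactSpace.1 hA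
  intro y v J hJ
  have hJm : StronglyMeasurable J := by
    let c : C(Ω × JetIndex q A, ℂ) := ⟨fun z => mixedDeriv z.2.1.1 0 (p z.1) z.2.2.1 y, by
      rw [← (Homeomorph.prodComm _ _).comp_continuous_iff', ← (Homeomorph.prodAssoc _ _ _).symm.comp_continuous_iff',
        continuous_prod_of_discrete_left]
      intro α
      exact (h.cont.2 α.1 α.2 0 h0).comp (f := fun z : A × Ω => (z.2, z.1.1, y)) (by fun_prop)⟩
    have hc : J = fun w => BoundedContinuousFunction.mkOfCompact (c.curry w) := by
      funext w
      ext d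
      exact hJ w d
    rw [hc]
    exact (ContinuousMap.isometryEquivBoundedOfCompact _ _).continuous.comp_stronglyMeasurable
      c.curry.continuous.stronglyMeasurable
  have hbd : ∀ w, ‖tensor _ H (J w) (G w v)‖ ≤ b w * ‖G w‖ * ‖v‖ := by
    intro w
    have hb := h.bound_nonneg w
    refine (BoundedContinuousFunction.norm_le (by positivity)).2 fun d => ?_
    rw [tensor_apply, norm_smul, mul_assoc, hJ]
    gcongr
    · exact h.bound _ d.1.2 0 h0 w _ y
    · exact (G w).le_opNorm v
  have hint : Integrable (fun w => tensor _ H (J w) (G w v)) ν := by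
    refine (h.int.mul_const ‖v‖).mono' ?_ (Eventually.of_forall hbd)
    exact (tensor _ H).aestronglyMeasurable_comp₂ hJm.aestronglyMeasurable
      (h.meas.apply_continuousLinearMap v)
  refine ⟨L.integrable_comp hint, fun B _ F hF => ?_⟩
  rw [L.integral_comp_comm hint.restrict]
  congr 1
  ext d
  rw [hF d]
  refine Eq.trans ?_
    ((BoundedContinuousFunction.evalCLM ℂ d).integral_comp_comm hint.restrict)
  simp [hJ]

theorem IsAdmissible.isCqUniversal [Nonempty U] [SeparableSpace H] (h : IsAdmissible q p b G ν)
    (hG : ∀ u, (∀ᵐ w ∂ν, G w u = 0) → u = 0)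
    (hu : ∀ w, IsCqUniversal q (scalarKernel (p w))) : IsCqUniversal q (densityKernel p G ν) := by
  refine ⟨h.isPosDef, fun f hf => isCq_of_mem_rkhs h.isPosDef h.isCqq.1 hf,
    fun A hA g hg ε hε => ?_⟩
  have : CompactSpace A := isCompact_iff_compactSpace.1 hA
  obtain ⟨F, hF⟩ := exists_isJetOf_of_isCompact hA hg
  refine exists_approx_of_functional h.isPosDef h.isCqq.1 hF (fun L hvan => ?_) hε
  refine h.functional_eq_zero (h.commutesWithIntegral_of_isCompact hA L) hvan hG
    (𝓕 := {f | IsCq q f}) (fun w u hw f hf F hF => ?_) hg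
    (fun e => hg.comp_clm ((innerSL ℂ e).restrictScalars ℝ)) hF
    (isCompact_range F.continuous).totallyBounded
  -- For fixed u this is a scalar functional on jets; it vanishes on H_{p_w}, which is dense by
  -- universality.
  set M := L ∘L (tensor _ H).flip u
  change M F = 0
  have hM : ∀ f ∈ rkhs (scalarKernel (p w)), ∀ F, IsJetOf F f → M F = 0 := hw
  refine norm_le_zero_iff.1 (le_of_forall_pos_le_add fun ε hε => ?_)
  rw [zero_add]
  obtain ⟨δ, hδ, hδε⟩ : ∃ δ > 0, ‖M‖ * δ ≤ ε := by
    refine ⟨ε / (‖M‖ + 1), by positivity, ?_⟩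
    rw [mul_div_assoc', div_le_iff₀ (by positivity)]
    nlinarith [norm_nonneg M]
  obtain ⟨f', hf', hff'⟩ := (hu w).2.2 A hA f hf δ hδ
  obtain ⟨F', hF'⟩ := exists_isJetOf_of_isCompact hA ((hu w).2.1 f' hf')
  calc ‖M F‖ = ‖M (F' - F)‖ := by rw [map_sub, hM f' hf' F' hF', zero_sub, norm_neg]
    _ ≤ ‖M‖ * ‖F' - F‖ := M.le_opNorm _
    _ ≤ ‖M‖ * δ := by
      gcongr
      refine (BoundedContinuousFunction.norm_le hδ.le).2 fun d => ?_
      rw [BoundedContinuousFunction.sub_apply, hF' d, hF d]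
      exact (Finset.single_le_sum (fun α _ => norm_nonneg (multiDeriv α f' d.2.1 - multiDeriv α f d.2.1)) d.1.2).trans (hff' _ d.2.2).le
    _ ≤ ε := hδε

end Universality

/-! ### Functionals on jets given by measures -/

section Functionals

open ContinuousLinearMap (adjoint)

variable {m : ℕ} {U : Opens (EuclideanSpace ℝ (Fin m))}
  {H : Type u} [NormedAddCommGroup H] [InnerProductSpace ℂ H] [CompleteSpace H] {q : ℕ}

theorem exists_isJetOf_of_mem_rkhs {K : U → U → H →L[ℂ] H} (hK : IsPosDef K) (hq : IsCqq q K)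
    (hb : ∀ α ∈ multiIndices m q, ∃ M : ℝ, ∀ x, ‖mixedDeriv α α K x x‖ ≤ M) (A : Set U)
    {f : U → H} (hf : f ∈ rkhs K) : ∃ F : JetIndex q A →ᵇ H, IsJetOf F f := by
  have hcq := isCq_of_mem_rkhs hK hq hf
  obtain ⟨E, _, _, _, Φ, hj, hΦ, -⟩ := exists_jet_features hK hq
  obtain ⟨u, rfl⟩ := (mem_rkhs_iff_of_jet hΦ).1 hf
  have : ∀ α, ∃ M : ℝ, α ∈ multiIndices m q → ∀ x, ‖mixedDeriv α α K x x‖ ≤ M := by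
    intro α
    by_cases hα : α ∈ multiIndices m q
    · exact (hb α hα).imp fun _ h _ => h
    · exact ⟨0, fun h => absurd h hα⟩
  choose M hM using this
  refine exists_isJetOf hcq (C := √(∑ α ∈ multiIndices m q, |M α|) * ‖u‖) fun α hα x _ => ?_
  rw [multiDeriv_adjoint hj hα]
  refine ((adjoint (Φ α x)).le_opNorm u).trans ?_
  rw [LinearIsometryEquiv.norm_map]
  gcongr
  refine Real.le_sqrt_of_sq_le ?_
  rw [sq, ← ContinuousLinearMap.norm_adjoint_comp_self, ← hΦ α hα α hα]
  exact (hM α hα x).trans ((le_abs_self _).trans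
    (Finset.single_le_sum (fun α _ => abs_nonneg (M α)) hα))

/-- The variation is ‖g‖μ, a finite Borel measure on an open subset of ℝ^m, so regularity is
automatic. -/
theorem isRadonBV_withDensityᵥ {μ : Measure U} {g : U → H} (hg : Integrable g μ) :
    IsRadonBV (μ.withDensityᵥ g) := by
  have h : (μ.withDensityᵥ g).variation = μ.withDensity fun x => ‖g x‖ₑ :=
    variation_eq_withDensity hg fun A hA => withDensityᵥ_apply hg hA
  have hfin : IsFiniteMeasure (μ.withDensityᵥ g).variation := by
    rw [h]
    exact isFiniteMeasure_withDensity hg.2.ne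
  have : LocallyCompactSpace U := U.isOpen.locallyCompactSpace
  exact ⟨hfin, inferInstance⟩

theorem integrable_boundedContinuous {η : VectorMeasure U H} [IsFiniteMeasure η.variation]
    (F : U →ᵇ H) : η.Integrable F :=
  integrable_of_continuous_of_bound F.continuous F.norm_coe_le_norm

/-- The transpose of `F ↦ T ∘ F` on vector measures. -/
theorem exists_transpose_measure {H' : Type v} [NormedAddCommGroup H'] [InnerProductSpace ℂ H']
    [CompleteSpace H'] (η : VectorMeasure U H) [IsFiniteMeasure η.variation] (T : H' →L[ℂ] H) :
    ∃ η' : VectorMeasure U H', IsRadonBV η' ∧ ∀ F : U →ᵇ H',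
      bartleIntegral η' F = bartleIntegral η fun x => T (F x) := by
  obtain ⟨g, -, hg, hη⟩ := exists_density η
  have hg' : Integrable (fun x => adjoint T (g x)) η.variation := (adjoint T).integrable_comp hg
  have hη' := isRadonBV_withDensityᵥ hg'
  refine ⟨_, hη', fun F => ?_⟩
  have := hη'.1
  rw [bartleIntegral_eq hg' (fun A hA => withDensityᵥ_apply hg' hA) (integrable_boundedContinuous F),
    show (bartleIntegral η fun x => T (F x)) = _ from bartleIntegral_eq hg hη
      (integrable_boundedContinuous (T.compLeftContinuousBounded U F))]
  simp only [ContinuousLinearMap.adjoint_inner_left]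

/-- The values of a jet on `U` for one multi-index. -/
noncomputable def jetComponent {V : Type*} [NormedAddCommGroup V]
    (α : {α : Fin m → ℕ // α ∈ multiIndices m q}) (F : JetIndex q (Set.univ : Set U) →ᵇ V) :
    U →ᵇ V :=
  F.compContinuous ⟨fun x => (α, ⟨x, trivial⟩), by fun_prop⟩

theorem jetComponent_apply {V : Type*} [NormedAddCommGroup V]
    (α : {α : Fin m → ℕ // α ∈ multiIndices m q}) (F : JetIndex q (Set.univ : Set U) →ᵇ V) (x : U) :
    jetComponent α F x = F (α, ⟨x, trivial⟩) := rfl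

theorem IsJetOf.jetComponent_eq {V : Type*} [NormedAddCommGroup V] [NormedSpace ℝ V]
    {F : JetIndex q (Set.univ : Set U) →ᵇ V} {f : U → V} (h : IsJetOf F f)
    (α : {α : Fin m → ℕ // α ∈ multiIndices m q}) : ⇑(jetComponent α F) = multiDeriv α.1 f :=
  funext fun x => h (α, ⟨x, trivial⟩)

/-- The functional `F ↦ ∑ ∫ ⟨F_α, dη_α⟩` on jets. -/
theorem exists_functional_of_measures {η : (Fin m → ℕ) → VectorMeasure U H}
    (hη : ∀ α ∈ multiIndices m q, IsFiniteMeasure (η α).variation) :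
    ∃ L : (JetIndex q (Set.univ : Set U) →ᵇ H) →L[ℂ] ℂ,
      ∀ F, L F = ∑ α : {α // α ∈ multiIndices m q}, bartleIntegral (η α) (jetComponent α F) := by
  have key : ∀ α : {α // α ∈ multiIndices m q},
      ∃ L : (JetIndex q (Set.univ : Set U) →ᵇ H) →L[ℂ] ℂ,
        ∀ F, L F = bartleIntegral (η α) (jetComponent α F) := by
    intro α
    have := hη α α.2
    obtain ⟨g, -, hg, hgη⟩ := exists_density (η α)
    have hB : ∀ F : JetIndex q (Set.univ : Set U) →ᵇ H, bartleIntegral (η α) (jetComponent α F) =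
        ∫ x, inner ℂ (g x) (jetComponent α F x) ∂(η α).variation := fun F =>
      bartleIntegral_eq hg hgη (integrable_boundedContinuous _)
    have hint : ∀ F : JetIndex q (Set.univ : Set U) →ᵇ H,
        Integrable (fun x => inner ℂ (g x) (jetComponent α F x)) (η α).variation := fun F =>
      (hg.norm.mul_const ‖F‖).mono'
        (hg.1.inner (jetComponent α F).continuous.stronglyMeasurable.aestronglyMeasurable)
        (Eventually.of_forall fun x => (norm_inner_le_norm _ _).trans
          (by gcongr; exact F.norm_coe_le_norm _))
    refine ⟨LinearMap.mkContinuous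
      { toFun := fun F => bartleIntegral (η α) (jetComponent α F)
        map_add' := fun F F' => ?_
        map_smul' := fun c F => ?_ } (∫ x, ‖g x‖ ∂(η α).variation) fun F => ?_, fun F => rfl⟩
    · rw [hB, hB, hB, ← integral_add (hint F) (hint F')]
      simp only [jetComponent_apply, BoundedContinuousFunction.add_apply, inner_add_right]
    · rw [hB, hB, RingHom.id_apply, smul_eq_mul, ← integral_const_mul]
      simp only [jetComponent_apply, BoundedContinuousFunction.smul_apply, inner_smul_right]
    · rw [LinearMap.coe_mk, AddHom.coe_mk, hB, ← integral_mul_const]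
      exact norm_integral_le_of_norm_le (hg.norm.mul_const _) (Eventually.of_forall fun x =>
        (norm_inner_le_norm _ _).trans (by gcongr; exact F.norm_coe_le_norm _))
  choose L hL using key
  exact ⟨∑ α, L α, fun F => by simp [hL]⟩

/-- A continuous function vanishing at infinity has relatively compact range once 0 is added, and
there are finitely many derivatives. This total boundedness replaces the compactness of A in the
universal case. -/
theorem IsCqZero.exists_isJetOf {V : Type*} [NormedAddCommGroup V] [NormedSpace ℝ V] {f : U → V}
    (hf : IsCqZero q f) : ∃ F : JetIndex q (Set.univ : Set U) →ᵇ V, IsJetOf F f ∧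
      TotallyBounded (Set.range F) := by
  have hK : IsCompact (⋃ α : {α // α ∈ multiIndices m q},
      insert 0 (Set.range (multiDeriv α.1 f))) :=
    isCompact_iUnion fun α => (hf.2 α α.2).isCompact_insert_range_of_cocompact
      (hf.1.continuous_multiDeriv α.2)
  obtain ⟨C, hC⟩ := hK.isBounded.exists_norm_le
  have hmem : ∀ α : {α // α ∈ multiIndices m q}, ∀ x, multiDeriv α.1 f x ∈
      ⋃ α : {α // α ∈ multiIndices m q}, insert 0 (Set.range (multiDeriv α.1 f)) := fun α x =>
    Set.mem_iUnion.2 ⟨α, Or.inr ⟨x, rfl⟩⟩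
  obtain ⟨F, hF⟩ := OpKernel.exists_isJetOf (A := Set.univ) hf.1 fun α hα x _ => hC _ (hmem ⟨α, hα⟩ x)
  refine ⟨F, hF, hK.totallyBounded.subset ?_⟩
  rintro _ ⟨d, rfl⟩
  rw [hF d]
  exact hmem d.1 d.2.1

theorem IsCqZero.comp_clm {V W : Type*} [NormedAddCommGroup V] [NormedSpace ℝ V]
    [NormedAddCommGroup W] [NormedSpace ℝ W] {f : U → V} (hf : IsCqZero q f) (L : V →L[ℝ] W) :
    IsCqZero q fun x => L (f x) := by
  refine ⟨hf.1.comp_clm L, fun α hα => ?_⟩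
  rw [show multiDeriv α (fun x => L (f x)) = fun x => L (multiDeriv α f x) from
    funext (hf.1.multiDeriv_comp_clm L hα)]
  exact (map_zero L ▸ L.continuous.tendsto 0).comp (hf.2 α hα)

end Functionals

/-! ### Integral strict positive definiteness -/

section StrictPositivity

open ContinuousLinearMap (adjoint)

variable {m : ℕ} {U : Opens (EuclideanSpace ℝ (Fin m))}
  {H : Type u} [NormedAddCommGroup H] [InnerProductSpace ℂ H] [CompleteSpace H] {q : ℕ}

/-- Strict positive definiteness, in terms of functionals on jets. -/
theorem IsCqIntStrictPosDef.sum_eq_zero {K : U → U → H →L[ℂ] H} (hK : IsCqIntStrictPosDef q K)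
    {η : (Fin m → ℕ) → VectorMeasure U H} (hη : ∀ α ∈ multiIndices m q, IsRadonBV (η α))
    (h : ∀ f ∈ rkhs K, ∑ α ∈ multiIndices m q, bartleIntegral (η α) (multiDeriv α f) = 0)
    {f : U → H} (hf : IsCqZero q f) :
    ∑ α ∈ multiIndices m q, bartleIntegral (η α) (multiDeriv α f) = 0 :=
  hK.2.2.2 η hη ((energy_eq_zero_iff hK.1 hK.2.1 hK.2.2.1 fun α hα => (hη α hα).1).2 h) f hf

/-- Transposing a family of measures. -/
theorem exists_transpose_measures {H' : Type v} [NormedAddCommGroup H'] [InnerProductSpace ℂ H']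
    [CompleteSpace H'] {η : (Fin m → ℕ) → VectorMeasure U H}
    (hη : ∀ α ∈ multiIndices m q, IsFiniteMeasure (η α).variation) (T : H' →L[ℂ] H) :
    ∃ η' : (Fin m → ℕ) → VectorMeasure U H', (∀ α ∈ multiIndices m q, IsRadonBV (η' α)) ∧
      ∀ α ∈ multiIndices m q, ∀ F : JetIndex q (Set.univ : Set U) →ᵇ H', ∀ f : U → H',
        IsCq q f → IsJetOf F f → bartleIntegral (η' α) (multiDeriv α f) =
          bartleIntegral (η α) (multiDeriv α fun x => T (f x)) := by
  have : ∀ α, ∃ η' : VectorMeasure U H', α ∈ multiIndices m q → IsRadonBV η' ∧ ∀ F : U →ᵇ H',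
      bartleIntegral η' F = bartleIntegral (η α) fun x => T (F x) := by
    intro α
    by_cases hα : α ∈ multiIndices m q
    · have := hη α hα
      exact (exists_transpose_measure (η α) T).imp fun _ h _ => h
    · exact ⟨0, fun h => absurd h hα⟩
  choose η' hη' using this
  refine ⟨η', fun α hα => (hη' α hα).1, fun α hα F f hf hF => ?_⟩
  rw [← hF.jetComponent_eq ⟨α, hα⟩, (hη' α hα).2, hF.jetComponent_eq ⟨α, hα⟩]
  congr 1
  funext x
  exact (hf.multiDeriv_comp_clm (T.restrictScalars ℝ) hα x).symm

/-- Scalar measures are lifted to H by transposing F ↦ ⟨F, v⟩. The lifted family kills H_K because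
the original kills its projection, and it is then tested on f(x) v/‖v‖². -/
theorem IsCqIntStrictPosDef.kernelProj {K : U → U → H →L[ℂ] H} (hK : IsCqIntStrictPosDef q K)
    {v : H} (hv : v ≠ 0) : IsCqIntStrictPosDef q (scalarKernel (kernelProj K v)) := by
  have hpd := isPosDef_kernelProj hK.1 v
  have hproj := isCqq_kernelProj hK.2.1 v
  have hcq := isCqq_scalarKernel hproj.1
  have hb : ∀ α ∈ multiIndices m q, ∃ M : ℝ, ∀ x,
      ‖mixedDeriv α α (scalarKernel (OpKernel.kernelProj K v)) x x‖ ≤ M := by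
    intro α hα
    obtain ⟨M, hM⟩ := hK.2.2.1 α hα
    refine ⟨‖v‖ * (M * ‖v‖), fun x => ?_⟩
    rw [hcq.2 α hα α hα, hproj.2 α hα α hα]
    refine (ContinuousLinearMap.opNorm_mul_apply_le ℂ ℂ _).trans
      ((norm_inner_le_norm _ _).trans ?_)
    gcongr
    exact ContinuousLinearMap.le_of_opNorm_le _ (hM x) v
  refine ⟨hpd, hcq.1, hb, fun η hη hE f hf => ?_⟩
  rw [energy_eq_zero_iff hpd hcq.1 hb fun α hα => (hη α hα).1] at hE
  obtain ⟨η', hη', hηη'⟩ := exists_transpose_measures (fun α hα => (hη α hα).1) (innerSL ℂ v)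
  have hf' : IsCqZero q fun x => f x • ((inner ℂ v v : ℂ)⁻¹ • v) := hf.comp_clm
    ((ContinuousLinearMap.toSpanSingleton ℂ ((inner ℂ v v : ℂ)⁻¹ • v)).restrictScalars ℝ)
  obtain ⟨F, hF, -⟩ := hf'.exists_isJetOf
  have h1 := hK.sum_eq_zero hη' (fun g hg => ?_) hf'
  · rw [← h1]
    refine Finset.sum_congr rfl fun α hα => ?_
    rw [hηη' α hα F _ hf'.1 hF]
    congr 2
    funext x
    have : (inner ℂ v v : ℂ) ≠ 0 := inner_self_ne_zero.2 hv
    simp [-inner_self_eq_norm_sq_to_K, this]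
  · obtain ⟨F, hF⟩ := exists_isJetOf_of_mem_rkhs hK.1 hK.2.1 hK.2.2.1 Set.univ hg
    rw [Finset.sum_congr rfl fun α hα => hηη' α hα F g (isCq_of_mem_rkhs hK.1 hK.2.1 hg) hF]
    exact hE _ ((mem_rkhs_kernelProj_iff hK.1 v).2 ⟨g, hg, rfl⟩)

variable {Ω : Type*} [TopologicalSpace Ω] [MeasurableSpace Ω] [BorelSpace Ω]
  {p : Ω → U → U → ℂ} {b : Ω → ℝ} {G : Ω → H →L[ℂ] H} {ν : Measure Ω}

/-- Joint measurability comes from continuity in x and measurability in w; the integrand is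
dominated by the product of ‖g‖ and b‖G‖‖v‖. -/
theorem IsAdmissible.integrable_prod [SFinite ν] (h : IsAdmissible q p b G ν) {μ : Measure U}
    [SFinite μ] {g : U → H} (hg : Integrable g μ) {α : Fin m → ℕ} (hα : α ∈ multiIndices m q)
    (y : U) (v : H) :
    Integrable (fun z : U × Ω => inner ℂ (g z.1) (mixedDeriv α 0 (p z.2) z.1 y • G z.2 v))
      (μ.prod ν) := by
  have h0 := zero_mem_multiIndices m q
  refine (hg.norm.mul_prod (h.int.mul_const ‖v‖)).mono' ?_ (Eventually.of_forall fun z => ?_)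
  · refine hg.1.comp_fst.inner (AEStronglyMeasurable.smul ?_
      (h.meas.apply_continuousLinearMap v).comp_snd)
    refine (stronglyMeasurable_uncurry_of_continuous_of_stronglyMeasurable
      (u := fun x w => mixedDeriv α 0 (p w) x y) (fun w => ?_) fun x => ?_).aestronglyMeasurable
    · exact ((h.cont.1 w).2.2 α hα 0 h0).comp (Continuous.prodMk_left y)
    · exact (continuous_mixedDeriv_param h.cont hα h0 x y).stronglyMeasurable
  · refine (norm_inner_le_norm _ _).trans ?_
    rw [norm_smul, mul_assoc]
    gcongr
    · exact (norm_nonneg _).trans (h.bound α hα 0 h0 z.2 z.1 y)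
    · exact h.bound α hα 0 h0 z.2 z.1 y
    · exact (G z.2).le_opNorm v

/-- Since L is given by integrals, Fubini suffices here, and no sup norm measurability of w ↦ J w on
the noncompact U is needed. -/
theorem IsAdmissible.commutesWithIntegral_of_measures [SFinite ν] (h : IsAdmissible q p b G ν)
    {η : (Fin m → ℕ) → VectorMeasure U H}
    (hη : ∀ α ∈ multiIndices m q, IsFiniteMeasure (η α).variation)
    {L : (JetIndex q (Set.univ : Set U) →ᵇ H) →L[ℂ] ℂ}
    (hL : ∀ F, L F = ∑ α : {α // α ∈ multiIndices m q}, bartleIntegral (η α) (jetComponent α F)) :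
    CommutesWithIntegral L p G ν := by
  intro y v J hJ
  have hd : ∀ α : {α // α ∈ multiIndices m q}, ∃ g : U → H, Integrable g (η α).variation ∧
      ∀ F, bartleIntegral (η α) (jetComponent α F) =
        ∫ x, inner ℂ (g x) (jetComponent α F x) ∂(η α).variation := by
    intro α
    have := hη α α.2
    obtain ⟨g, -, hg, hgη⟩ := exists_density (η α)
    exact ⟨g, hg, fun F => bartleIntegral_eq hg hgη (integrable_boundedContinuous _)⟩
  choose g hg hgη using hd
  have hLJ : ∀ w, L (tensor _ H (J w) (G w v)) = ∑ α : {α // α ∈ multiIndices m q},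
      ∫ x, inner ℂ (g α x) (mixedDeriv α.1 0 (p w) x y • G w v) ∂(η α).variation := by
    intro w
    simp only [hL, hgη, jetComponent_apply, tensor_apply, hJ]
  have hint : ∀ B, ∀ α : {α // α ∈ multiIndices m q}, Integrable (fun w =>
      ∫ x, inner ℂ (g α x) (mixedDeriv α.1 0 (p w) x y • G w v) ∂(η α).variation)
      (ν.restrict B) := by
    intro B α
    have := hη α α.2
    exact ((h.restrict B).integrable_prod (hg α) α.2 y v).integral_prod_right
  simp only [hLJ]
  refine ⟨integrable_finsetSum _ fun α _ => by simpa using hint Set.univ α, fun B hB F hF => ?_⟩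
  rw [integral_finsetSum _ fun α _ => hint B α, hL]
  refine Finset.sum_congr rfl fun α _ => ?_
  have := hη α α.2
  rw [hgη, ← integral_integral_swap ((h.restrict B).integrable_prod (hg α) α.2 y v)]
  refine integral_congr_ae (Eventually.of_forall fun x => ?_)
  simp only [jetComponent_apply, hF]
  refine (integral_inner ?_ _).symm
  exact ((h.restrict B).integrable α.2 (zero_mem_multiIndices m q) x y).apply_continuousLinearMap v

theorem IsAdmissible.isCqIntStrictPosDef [SFinite ν] [SeparableSpace H]
    (h : IsAdmissible q p b G ν) (hG : ∀ u, (∀ᵐ w ∂ν, G w u = 0) → u = 0)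
    (hs : ∀ w, IsCqIntStrictPosDef q (scalarKernel (p w))) :
    IsCqIntStrictPosDef q (densityKernel p G ν) := by
  have hb : ∀ α ∈ multiIndices m q, ∃ M : ℝ, ∀ x, ‖mixedDeriv α α (densityKernel p G ν) x x‖ ≤ M :=
    fun α hα => ⟨∫ w, b w * ‖G w‖ ∂ν, fun x => by
      rw [h.isCqq.2 α hα α hα]
      exact norm_integral_le_of_norm_le h.int (Eventually.of_forall fun w => h.norm_le hα hα w x x)⟩
  refine ⟨h.isPosDef, h.isCqq.1, hb, fun η hη hE f hf => ?_⟩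
  have hη' := fun α hα => (hη α hα).1
  rw [energy_eq_zero_iff h.isPosDef h.isCqq.1 hb hη'] at hE
  obtain ⟨L, hL⟩ := exists_functional_of_measures hη'
  have hLj : ∀ F f, IsJetOf F f → L F = ∑ α ∈ multiIndices m q,
      bartleIntegral (η α) (multiDeriv α f) := by
    intro F f hF
    rw [hL, ← Finset.sum_coe_sort (multiIndices m q)]
    exact Finset.sum_congr rfl fun α _ => by rw [hF.jetComponent_eq]
  obtain ⟨F, hF, hFr⟩ := hf.exists_isJetOf
  rw [← hLj F f hF]
  refine h.functional_eq_zero (h.commutesWithIntegral_of_measures hη' hL)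
    (fun f hf F hF => (hLj F f hF).trans (hE f hf)) hG (𝓕 := {f | IsCqZero q f})
    (fun w u hw f hf F hF => ?_) hf.1 (fun e => hf.comp_clm ((innerSL ℂ e).restrictScalars ℝ)) hF hFr
  -- For fixed u, φ ↦ L(φ ⊗ u) is again given by Radon measures, now scalar, so strict positivity of
  -- p_w applies to it.
  obtain ⟨η', hηr, hηη'⟩ := exists_transpose_measures hη' (ContinuousLinearMap.toSpanSingleton ℂ u)
  have hten : ∀ f : U → ℂ, IsCq q f → ∀ F, IsJetOf F f → L (tensor _ H F u) =
      ∑ α ∈ multiIndices m q, bartleIntegral (η' α) (multiDeriv α f) := by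
    intro f hf F hF
    rw [Finset.sum_congr rfl fun α hα => hηη' α hα F f hf hF]
    refine hLj _ _ fun d => ?_
    rw [tensor_apply, hF d]
    exact (hf.multiDeriv_comp_clm
      ((ContinuousLinearMap.toSpanSingleton ℂ u).restrictScalars ℝ) d.1.2 _).symm
  rw [hten f hf.1 F hF]
  refine (hs w).sum_eq_zero hηr (fun g hg => ?_) hf
  obtain ⟨F, hF⟩ := exists_isJetOf_of_mem_rkhs (hs w).1 (hs w).2.1 (hs w).2.2.1 Set.univ hg
  rw [← hten g (isCq_of_mem_rkhs (hs w).1 (hs w).2.1 hg) F hF]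
  exact hw g hg F hF

end StrictPositivity

/-! ### The zero kernel has neither property -/

section ZeroKernel

variable {m : ℕ} {U : Opens (EuclideanSpace ℝ (Fin m))}
  {V : Type*} [NormedAddCommGroup V] [NormedSpace ℝ V] {q : ℕ}

theorem multiDeriv_eq_zero_of_isOpen {W : Set U} (hW : IsOpen W) (α : Fin m → ℕ) {f : U → V}
    (hf : ∀ x ∈ W, f x = 0) : ∀ x ∈ W, multiDeriv α f x = 0 := by
  have h1 : ∀ (i : Fin m) (g : U → V), (∀ x ∈ W, g x = 0) → ∀ x ∈ W, partialDeriv i g x = 0 := by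
    intro i g hg x hx
    have hW' : IsOpen (Subtype.val '' W) := U.isOpen.isOpenMap_subtype_val _ hW
    have h2 : zeroExt g =ᶠ[𝓝 (x : EuclideanSpace ℝ (Fin m))] fun _ => 0 := by
      filter_upwards [hW'.mem_nhds ⟨x, hx, rfl⟩]
      rintro _ ⟨y, hy, rfl⟩
      rw [zeroExt_coe, hg y hy]
    rw [partialDeriv, h2.lineDeriv_eq]
    simp [lineDeriv]
  rw [multiDeriv]
  induction List.finRange m with
  | nil => exact hf
  | cons i l ih =>
    rw [List.foldr_cons]
    generalize l.foldr (fun i G => (partialDeriv i)^[α i] G) f = g at ih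
    induction α i with
    | zero => exact ih
    | succ n hn =>
      rw [Function.iterate_succ_apply']
      exact h1 i _ hn

theorem multiDeriv_fun_zero (α : Fin m → ℕ) : multiDeriv α (fun _ : U => (0 : V)) = fun _ => 0 :=
  funext fun x => multiDeriv_eq_zero_of_isOpen isOpen_univ α (fun _ _ => rfl) x trivial

theorem exists_isCqZero_ne_zero (x : U) : ∃ f : U → ℂ, IsCqZero q f ∧ f x ≠ 0 := by
  obtain ⟨r, hr, hrU⟩ := Metric.nhds_basis_closedBall.mem_iff.1 (U.isOpen.mem_nhds x.2)
  let φ : ContDiffBump (x : EuclideanSpace ℝ (Fin m)) := ⟨r / 2, r, by positivity, by linarith⟩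
  refine ⟨fun y => (φ y : ℂ), ⟨?_, fun α _ => ?_⟩, ?_⟩
  · exact (Complex.ofRealCLM.contDiff.comp φ.contDiff).contDiffOn.congr fun y hy =>
      zeroExt_coe (fun y : U => (φ y : ℂ)) ⟨y, hy⟩
  · have hK : IsCompact {y : U | (y : EuclideanSpace ℝ (Fin m)) ∈ Metric.closedBall x.1 r} :=
      Topology.IsInducing.subtypeVal.isCompact_preimage' (isCompact_closedBall x.1 r)
        (by simpa using hrU)
    refine tendsto_const_nhds.congr' ?_
    filter_upwards [hK.compl_mem_cocompact] with y hy
    refine (multiDeriv_eq_zero_of_isOpen hK.isClosed.isOpen_compl α (fun z hz => ?_) y hy).symm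
    rw [φ.zero_of_le_dist (le_of_lt (not_le.1 fun hle => hz (Metric.mem_closedBall.2 hle))), Complex.ofReal_zero]
  · change (φ x : ℂ) ≠ 0
    rw [φ.one_of_mem_closedBall (Metric.mem_closedBall_self (by positivity)), Complex.ofReal_one]
    exact one_ne_zero

/-- A Dirac mass at x in the component of index 0 kills the trivial space H_0, but not a bump
function at x. -/
theorem not_isCqIntStrictPosDef_zero [Nonempty U] :
    ¬ IsCqIntStrictPosDef q fun _ _ : U => (0 : ℂ →L[ℂ] ℂ) := by
  intro h
  obtain ⟨x⟩ := ‹Nonempty U›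
  obtain ⟨f, hf, hfx⟩ := exists_isCqZero_ne_zero (q := q) x
  have hzero : ∀ η : VectorMeasure U ℂ, bartleIntegral η (fun _ => 0) = 0 := fun η => by
    simpa using bartleIntegral_smul (η := η) (f := fun _ => 0) (integrable_zero _ _ _) 0
  let c : (Fin m → ℕ) → ℂ := fun α => if α = 0 then 1 else 0
  let η : (Fin m → ℕ) → VectorMeasure U ℂ := fun α => (Measure.dirac x).withDensityᵥ fun _ => c α
  have hη : ∀ α, IsRadonBV (η α) := fun α => isRadonBV_withDensityᵥ (integrable_const _)
  have h1 := h.sum_eq_zero (fun α _ => hη α) (fun g hg => ?_) hf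
  · obtain ⟨F, hF, -⟩ := hf.exists_isJetOf
    have hB : ∀ α ∈ multiIndices m q, bartleIntegral (η α) (multiDeriv α f) =
        inner ℂ (c α) (multiDeriv α f x) := by
      intro α hα
      have := (hη α).1
      rw [← hF.jetComponent_eq ⟨α, hα⟩, bartleIntegral_eq (integrable_const _)
        (fun A hA => withDensityᵥ_apply (integrable_const _) hA) (integrable_boundedContinuous _),
        integral_dirac]
    rw [Finset.sum_congr rfl hB, Finset.sum_eq_single_of_mem 0 (zero_mem_multiIndices m q)
      fun α _ hα => by simp [c, hα], multiDeriv_zero] at h1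
    exact hfx (by simpa [c] using h1)
  · obtain ⟨u, hu⟩ := (mem_rkhs_iff (E := ℂ) (Φ := fun _ : U => (0 : ℂ →L[ℂ] ℂ))
      (fun x y => by simp)).1 hg
    have : g = fun _ => 0 := funext fun x => by simp [hu]
    subst this
    exact Finset.sum_eq_zero fun α _ => by rw [multiDeriv_fun_zero, hzero]

end ZeroKernel

/-! ### From the operator valued measure to its density -/

section IntegralKernel

variable {m q : ℕ} {U : Opens (EuclideanSpace ℝ (Fin m))}
  {Ω : Type*} [TopologicalSpace Ω] [MeasurableSpace Ω] [BorelSpace Ω]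
  {H : Type u} [NormedAddCommGroup H] [InnerProductSpace ℂ H] [CompleteSpace H]
  {p : Ω → U → U → ℂ} {Λ : VectorMeasure Ω (H →L[ℂ] H)} {lam : Measure Ω} {G : Ω → H →L[ℂ] H}

theorem IsCqDominated.integrable (hp : IsCzqq q p) {μ : Measure Ω} (h : IsCqDominated q p μ)
    (x y : U) : Integrable (fun w => p w x y) μ := by
  obtain ⟨h, hi, hb⟩ := h
  have h0 := zero_mem_multiIndices m q
  have hc := continuous_mixedDeriv_param hp h0 h0 x y
  have hb' := fun w => hb 0 h0 0 h0 w x y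
  simp only [mixedDeriv_zero] at hc hb'
  exact hi.norm.mono' hc.stronglyMeasurable.aestronglyMeasurable (Eventually.of_forall hb')

theorem integralKernel_eq_densityKernel (hint : ∀ x y, Integrable (fun w => p w x y) Λ.variation)
    (hG : Integrable G lam) (hΛG : ∀ A, MeasurableSet A → Λ A = ∫ w in A, G w ∂lam) :
    integralKernel p Λ = densityKernel p G lam := by
  funext x y
  exact integral_eq_of_density hG hΛG _ (hint x y)

/-- The variation of Λ is ‖G‖λ, so domination by h with respect to |Λ| becomes λ-integrability of
‖h‖‖G‖. -/
theorem exists_isAdmissible [SeparableSpace H] (hp : IsCzqq q p)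
    (hpd : ∀ w, IsPosDef (scalarKernel (p w))) (hΛpos : ∀ A, (Λ A).IsPositive)
    (hG : Integrable G lam) (hΛG : ∀ A, MeasurableSet A → Λ A = ∫ w in A, G w ∂lam)
    (hdom : IsCqDominated q p Λ.variation) : ∃ b, IsAdmissible q p b G lam := by
  obtain ⟨h, hi, hb⟩ := hdom
  rw [variation_eq_withDensity hG hΛG] at hi
  exact ⟨fun w => ‖h w‖, hp, hpd, hb, hG.1,
    ae_isPositive_of_setIntegral hG fun A hA => hΛG A hA ▸ hΛpos A, (integrable_norm_mul_norm hG hi).1⟩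

theorem scalarKernel_kernelProj_eq_zero (hint : ∀ x y, Integrable (fun w => p w x y • G w) lam)
    {v : H} (hv : ∀ᵐ w ∂lam, inner ℂ v (G w v) = 0) :
    scalarKernel (kernelProj (densityKernel p G lam) v) = fun _ _ => 0 := by
  funext x y
  have : kernelProj (densityKernel p G lam) v x y = 0 := by
    refine (((innerSL ℂ v).comp (ContinuousLinearMap.apply ℂ H v)).integral_comp_comm
      (hint x y)).symm.trans (integral_eq_zero_of_ae ?_)
    filter_upwards [hv] with w hw
    simp [hw]
  rw [scalarKernel, this, map_zero]

end IntegralKernel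

end OpKernel

theorem mainTheorem5
    {m q : ℕ} (U : TopologicalSpace.Opens (EuclideanSpace ℝ (Fin m))) [Nonempty U]
    {Ω : Type*} [TopologicalSpace Ω] [T2Space Ω] [LocallyCompactSpace Ω]
    [MeasurableSpace Ω] [BorelSpace Ω]
    {H : Type*} [NormedAddCommGroup H] [InnerProductSpace ℂ H] [CompleteSpace H]
    [TopologicalSpace.SeparableSpace H]
    (p : Ω → U → U → ℂ) (hp : OpKernel.IsCzqq q p)
    (hpd : ∀ w, OpKernel.IsPosDef (OpKernel.scalarKernel (p w)))
    (Λ : MeasureTheory.VectorMeasure Ω (H →L[ℂ] H))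
    (hΛpos : ∀ A, (Λ A).IsPositive) (hΛ : OpKernel.IsRadonBV Λ)
    (lam : MeasureTheory.Measure Ω) [MeasureTheory.IsFiniteMeasure lam]
    (G : Ω → H →L[ℂ] H) (hG : MeasureTheory.Integrable G lam)
    (hΛG : ∀ A, MeasurableSet A → Λ A = ∫ w in A, G w ∂lam)
    (hdom : OpKernel.IsCqDominated q p Λ.variation) :
    (∀ x y, MeasureTheory.Integrable (fun w => p w x y) Λ.variation) ∧
    OpKernel.IsPosDef (OpKernel.integralKernel p Λ) ∧
    OpKernel.IsCqq q (OpKernel.integralKernel p Λ) ∧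
    (∀ f ∈ OpKernel.rkhs (OpKernel.integralKernel p Λ), OpKernel.IsCq q f) ∧
    ((∀ w, OpKernel.IsCqUniversal q (OpKernel.scalarKernel (p w))) →
      List.TFAE [
        OpKernel.IsCqUniversal q (OpKernel.integralKernel p Λ),
        ∀ v : H, v ≠ 0 → OpKernel.IsCqUniversal q
          (OpKernel.scalarKernel (OpKernel.kernelProj (OpKernel.integralKernel p Λ) v)),
        ∀ v : H, v ≠ 0 → OpKernel.measureProj Λ v ≠ 0]) ∧
    ((∀ w, OpKernel.IsCqIntStrictPosDef q (OpKernel.scalarKernel (p w))) →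
      List.TFAE [
        OpKernel.IsCqIntStrictPosDef q (OpKernel.integralKernel p Λ),
        ∀ v : H, v ≠ 0 → OpKernel.IsCqIntStrictPosDef q
          (OpKernel.scalarKernel (OpKernel.kernelProj (OpKernel.integralKernel p Λ) v)),
        ∀ v : H, v ≠ 0 → OpKernel.measureProj Λ v ≠ 0]) := by
  have hint := hdom.integrable hp
  obtain ⟨b, h⟩ := OpKernel.exists_isAdmissible hp hpd hΛpos hG hΛG hdom
  rw [OpKernel.integralKernel_eq_densityKernel hint hG hΛG]
  have h0 := OpKernel.zero_mem_multiIndices m q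
  have hint' : ∀ x y, Integrable (fun w => p w x y • G w) lam := fun x y => by
    simpa only [OpKernel.mixedDeriv_zero] using h.integrable h0 h0 x y
  have hzero : ∀ v, OpKernel.measureProj Λ v = 0 → OpKernel.scalarKernel
      (OpKernel.kernelProj (OpKernel.densityKernel p G lam) v) = fun _ _ => 0 := fun v hv =>
    OpKernel.scalarKernel_kernelProj_eq_zero hint'
      ((OpKernel.measureProj_eq_zero_iff hG hΛG v).1 hv)
  -- Nondegeneracy of Λ in the form used by the duality argument: G(w)u = 0 almost everywhere gives
  -- Λ_u = 0.
  have hinj : (∀ v : H, v ≠ 0 → OpKernel.measureProj Λ v ≠ 0) →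
      ∀ u, (∀ᵐ w ∂lam, G w u = 0) → u = 0 := by
    intro hΛv u hu
    by_contra hu0
    refine hΛv u hu0 ((OpKernel.measureProj_eq_zero_iff hG hΛG u).2 ?_)
    filter_upwards [hu] with w hw
    rw [hw, inner_zero_right]
  refine ⟨hint, h.isPosDef, h.isCqq.1, fun f hf => OpKernel.isCq_of_mem_rkhs h.isPosDef h.isCqq.1 hf,
    fun hu => ?_, fun hs => ?_⟩
  · tfae_have 1 → 2 := fun hP v hv => hP.kernelProj hv
    tfae_have 2 → 3 := fun hP v hv hΛv => by
      have := hP v hv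
      rw [hzero v hΛv] at this
      exact OpKernel.not_isCqUniversal_zero this
    tfae_have 3 → 1 := fun hΛv => h.isCqUniversal (hinj hΛv) hu
    tfae_finish
  · tfae_have 1 → 2 := fun hP v hv => hP.kernelProj hv
    tfae_have 2 → 3 := fun hP v hv hΛv => by
      have := hP v hv
      rw [hzero v hΛv] at this
      exact OpKernel.not_isCqIntStrictPosDef_zero this
    tfae_have 3 → 1 := fun hΛv => h.isCqIntStrictPosDef (hinj hΛv) hs
    tfae_finish
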